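/- **Theorem 1.1.** Let $d\ge 1$, let $\Omega\subset\mathbb{R}^d$ be a bounded domain with $C^\infty$ boundary and outward unit normal $\nu$, let $T>0$, $Q=\Omega\times(0,T)$, $\rho_0\in\mathbb{R}$, $K>0$, $M>0$ and $\varepsilon\in(0,T)$. For an open set $D\subset\mathbb{R}^{d+1}$ put $$\|u\|_{H^{2,1}(D)}=\Big(\|u\|^2_{L^2(D)}+\|\nabla u\|^2_{L^2(D)}+\sum_{i,j=1}^d\|\partial_i\partial_j u\|^2_{L^2(D)}+\|\partial_t u\|^2_{L^2(D)}\Big)^{1/2},$$ where $\nabla$ and $\partial_i$ refer to the space variables $x$. Then there are constants $C>0$, $\theta\in(0,1)$ and $\delta>0$, depending only on $d,\Omega,T,\rho_0,K,\varepsilon,M$, such that the following holds. Let $u,v\in H^{2,1}(Q)$ satisfy $$\partial_t u+\Delta u=Q_1u+Sv,\qquad \partial_t v-\Delta v=Q_2(u,v)+\rho_0\Delta u\quad\text{a.e. in }Q,\qquad \partial_\nu u=\partial_\nu v=0\ \text{ on }\partial\Omega\times(0,T),$$ where the operators $Q_1$, $Q_2$ and $S$ (with $Sv$ measurable) satisfy,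 for almost every $(x,t)\in Q$, $$|Q_1u(x,t)|\le K(|u(x,t)|+|\nabla u(x,t)|),\qquad |Q_2(u,v)(x,t)|\le K(|u(x,t)|+|v(x,t)|+|\nabla u(x,t)|+|\nabla v(x,t)|),$$ and either $|Sv(x,t)|\le K|v(x,t)|$ for almost every $(x,t)\in Q$, or $\|Sv(\cdot,t)\|_{L^2(\Omega)}\le K\|v(\cdot,t)\|_{L^2(\Omega)}$ for almost every $t\in(0,T)$. Assume also $\|\nabla v(\cdot,0)\|_{L^2(\Omega)}\le M$. If $$\|u(\cdot,T)\|_{H^1(\Omega)}+\|v(\cdot,T)\|_{L^2(\Omega)}<\delta,$$ then $$\|u\|_{H^{2,1}(\Omega\times(\varepsilon,T))}+\|v\|_{H^{2,1}(\Omega\times(\varepsilon,T))}\le C\big(\|u(\cdot,T)\|_{H^1(\Omega)}+\|v(\cdot,T)\|_{L^2(\Omega)}\big)^{\theta}.$$ -/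

import Mathlib

open MeasureTheory Set Filter Topology
open scoped ENNReal ContDiff

namespace MFG

/-- Euclidean space of dimension `d`. -/
abbrev Space (d : ℕ) := EuclideanSpace ℝ (Fin d)

/-- Space-time; a point is written `(x, t)`. Its volume is the product Lebesgue measure. -/
abbrev SpaceTime (d : ℕ) := Space d × ℝ

/-- The `i`-th coordinate direction of space. -/
noncomputable def spaceDir {d : ℕ} (i : Fin d) : Space d := EuclideanSpace.single i 1

/-- The `i`-th spatial coordinate direction of space-time. -/
noncomputable def xDir {d : ℕ} (i : Fin d) : SpaceTime d := (spaceDir i, 0)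

/-- The time direction of space-time. -/
def tDir (d : ℕ) : SpaceTime d := (0, 1)

/-- The open cylinder `Ω × (a, b)`. -/
def stCylinder {d : ℕ} (Ω : Set (Space d)) (a b : ℝ) : Set (SpaceTime d) := Ω ×ˢ Ioo a b

/-- A bounded domain (non-empty, open, connected) with `C^∞` boundary: near each boundary point
the domain is the negativity set of a smooth function with non-vanishing differential there. -/
structure IsSmoothBoundedDomain {d : ℕ} (Ω : Set (Space d)) : Prop where
  isOpen : IsOpen Ω
  isConnected : IsConnected Ω
  isBounded : Bornology.IsBounded Ω
  smooth_boundary : ∀ p ∈ frontier Ω, ∃ ρ : Space d → ℝ,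
    ContDiff ℝ ∞ ρ ∧ fderiv ℝ ρ p ≠ 0 ∧ ∀ᶠ x in 𝓝 p, (x ∈ Ω ↔ ρ x < 0)

/-- `f` and `g` belong to `L²(D)` and `g` is the weak (distributional) derivative of `f` on the
open set `D` in the direction `e`. -/
structure HasWeakDeriv {X : Type*} [NormedAddCommGroup X] [NormedSpace ℝ X] [MeasureSpace X]
    (D : Set X) (e : X) (f g : X → ℝ) : Prop where
  memLp : MemLp f 2 (volume.restrict D)
  memLp_deriv : MemLp g 2 (volume.restrict D)
  integral_eq : ∀ φ : X → ℝ, ContDiff ℝ ∞ φ → HasCompactSupport φ → tsupport φ ⊆ D →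
    ∫ z in D, f z * fderiv ℝ φ z e = -∫ z in D, g z * φ z

/-- `g ∈ H¹(Ω)` with weak gradient `Dg`. -/
structure IsH1 {d : ℕ} (Ω : Set (Space d)) (g : Space d → ℝ) (Dg : Space d → Space d) : Prop where
  memLp : MemLp g 2 (volume.restrict Ω)
  grad : ∀ i, HasWeakDeriv Ω (spaceDir i) g (fun x => Dg x i)

/-- The norm `‖∇g‖_{L²(Ω)}`. The weak gradient is unique almost everywhere, so that the infimum is
over a single value; it is `∞` exactly when `g ∉ H¹(Ω)`. -/
noncomputable def gradNorm {d : ℕ} (Ω : Set (Space d)) (g : Space d → ℝ) : ℝ≥0∞ :=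
  ⨅ (Dg : Space d → Space d) (_ : IsH1 Ω g Dg), eLpNorm Dg 2 (volume.restrict Ω)

/-- The norm `‖g‖_{H¹(Ω)}`, equal to `∞` exactly when `g ∉ H¹(Ω)`. -/
noncomputable def h1Norm {d : ℕ} (Ω : Set (Space d)) (g : Space d → ℝ) : ℝ≥0∞ :=
  (eLpNorm g 2 (volume.restrict Ω) ^ 2 + gradNorm Ω g ^ 2) ^ (1 / 2 : ℝ)

/-- `u ∈ H^{2,1}(D)`, where `ut`, `Du`, `D2u` are the weak derivatives `∂_t u`, `∇u` and
`(∂_i ∂_j u)`, all in `L²(D)`. -/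
structure IsH21 {d : ℕ} (D : Set (SpaceTime d)) (u ut : SpaceTime d → ℝ)
    (Du : SpaceTime d → Space d) (D2u : Fin d → Fin d → SpaceTime d → ℝ) : Prop where
  time : HasWeakDeriv D (tDir d) u ut
  grad : ∀ i, HasWeakDeriv D (xDir i) u (fun z => Du z i)
  hess : ∀ i j, HasWeakDeriv D (xDir i) (fun z => Du z j) (D2u i j)

/-- The norm `‖u‖_{H^{2,1}(D)}`. The weak derivatives are unique almost everywhere, so that the
infimum is over a single value; it is `∞` exactly when `u ∉ H^{2,1}(D)`. -/
noncomputable def h21Norm {d : ℕ} (D : Set (SpaceTime d)) (u : SpaceTime d → ℝ) : ℝ≥0∞ :=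
  ⨅ (ut : SpaceTime d → ℝ) (Du : SpaceTime d → Space d)
    (D2u : Fin d → Fin d → SpaceTime d → ℝ) (_ : IsH21 D u ut Du D2u),
    (eLpNorm u 2 (volume.restrict D) ^ 2 + eLpNorm Du 2 (volume.restrict D) ^ 2
      + ∑ i, ∑ j, eLpNorm (D2u i j) 2 (volume.restrict D) ^ 2
      + eLpNorm ut 2 (volume.restrict D) ^ 2) ^ (1 / 2 : ℝ)

/-- The Laplacian in space, read off the second derivatives. -/
def lap {d : ℕ} (D2u : Fin d → Fin d → SpaceTime d → ℝ) (z : SpaceTime d) : ℝ := ∑ i, D2u i i z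

/-- The condition `∂_ν u = 0` on `∂Ω × (0, T)` for `u` with `∇u = Du` and `∂_i ∂_j u = D2u i j` in
`L²(Q)`, `Q = Ω × (0, T)`. The normal derivative is the normal trace of `∇u`, that is, the functional
`φ ↦ ∫_Q (Δu φ + ∇u · ∇φ)` on `L²(0, T; H¹(Ω))`, which by Green's formula is
`∫_{∂Ω × (0, T)} (∂_ν u) φ`; it has to vanish. -/
def NeumannZero {d : ℕ} (Ω : Set (Space d)) (T : ℝ) (Du : SpaceTime d → Space d)
    (D2u : Fin d → Fin d → SpaceTime d → ℝ) : Prop :=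
  ∀ (φ : SpaceTime d → ℝ) (Dφ : SpaceTime d → Space d),
    (∀ i, HasWeakDeriv (stCylinder Ω 0 T) (xDir i) φ (fun z => Dφ z i)) →
    ∫ z in stCylinder Ω 0 T, (lap D2u z * φ z + ∑ i, Du z i * Dφ z i) = 0

/-- `g = u(·, τ)` in `L²(Ω)` for an end point `τ` of `(0, T)`: `‖u(·, t) - g‖_{L²(Ω)} → 0` as
`t → τ`, `t ∈ (0, T)`, up to a null set of times, so that the condition does not depend on the
representative of `u`. -/
def HasTimeTrace {d : ℕ} (Ω : Set (Space d)) (T : ℝ) (u : SpaceTime d → ℝ) (τ : ℝ)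
    (g : Space d → ℝ) : Prop :=
  MemLp g 2 (volume.restrict Ω) ∧
  Tendsto (fun t => eLpNorm (fun x => u (x, t) - g x) 2 (volume.restrict Ω))
    (ae (volume.restrict (Ioo 0 T)) ⊓ 𝓝 τ) (𝓝 0)

end MFG

/-!
The proof rests on two `L²` Carleman estimates with a weight that depends on time only,
`E(t) = exp (2 s e^{λ t})`, whose rate is `P = s λ e^{λ t}`, so that `E' = 2 P E`. Put `L = Δv` for the
forward equation and `L = -Δu` for the backward one, and expand the square of
`∂_t w - L = (∂_t w + P w) - (L + P w)` against `E` (`IsH21.carleman_split`). The cross terms are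
evaluated by integration by parts, in space by the Neumann condition and in time by the energy
inequalities for `‖w(·, t)‖²` and `‖∇w(·, t)‖²`. The terms `P E |∇w|²` cancel, and what remains is a
positive multiple of `P E w²` together with boundary terms: for `v`
(`IsH21.carleman_forward`) those are `E(0) ‖∇v(·, 0)‖²` and `P(T) E(T) ‖v(·, T)‖²`, for `u`
(`IsH21.carleman_backward`) only norms at time `T`. Because the weight does not depend on `x`, a
nonlocal bound on `Sv` is as good as a pointwise one (`lintegral_weight_le`), and the term `ρ₀ Δu` in
the second equation is controlled by the first estimate. For large fixed `λ` all lower-order terms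
are absorbed (`exists_absorption_constants`, `exists_system_estimate`). Since `E` increases in time,
dividing by `E(ε)` bounds the integral over `Ω × (ε, T)` by
`A s² (e^{-2 s a} N + e^{2 s b} D²)` with `a, b > 0`, where `N` bounds the data at time `0` and `D` the
data at time `T` (`exists_slab_estimate`); taking `s = 1 + κ log (1 / D)` gives the Hölder
rate (`exists_holder_rate`).

Two points need care at the low regularity of the statement.

*Energy inequalities.* The traces at `t = 0, T` are limits in `L²(Ω)` only, while the initial gradient
enters. The function `u` is continued to `t < 0` by its trace, shifted forward by `τ` (`delay`), and
subtracted from itself; convexity of the square and the limit `τ → 0` give `energy_inequality`. The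
difference is an admissible test function for the Neumann condition, which turns the gradient term
into the Laplacian (`IsH21.energy_grad`). Only an inequality is needed, so neither continuity in
`H¹(Ω)` nor chain rules are used. The statements at `T` follow by reversing time.

*Second derivatives.* The Carleman estimates bound `Δu`, whereas the norm contains the Hessian. Near
a boundary point with defining function `ρ` and `N = ∇ρ`, the Neumann condition gives an identity
(`NeumannZero.integral_tang`) for the tangential derivatives `N_i ∂_j ∂_k u - N_j ∂_i ∂_k u` tested with smooth
functions. Mollification with shifts that point into the domain
(`integral_eq_zero_of_transversal`) extends it to the test function
`ζ² (N_i ∂_j u - N_j ∂_i u)`, which yields an `L²` bound (`IsChart.exists_tang_estimate`). A symmetric matrix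
is determined by its trace and these combinations (`sq_le_of_tangential`), and compactness of the
closure of `Ω` gives `IsSmoothBoundedDomain.exists_hess_estimate`.
-/

namespace MFG

/-! ### Test functions and weak derivatives -/

section

instance isAddHaarMeasure_spaceTime (d : ℕ) :
    (volume : Measure (SpaceTime d)).IsAddHaarMeasure :=
  inferInstanceAs ((volume : Measure (Space d)).prod (volume : Measure ℝ)).IsAddHaarMeasure

/-- `φ` is a test function on `D`: smooth, with compact support contained in `D`. -/
structure IsTest {X : Type*} [NormedAddCommGroup X] [NormedSpace ℝ X] (D : Set X) (φ : X → ℝ) :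
    Prop where
  smooth : ContDiff ℝ ∞ φ
  compact : HasCompactSupport φ
  subset : tsupport φ ⊆ D

section Tests

variable {X : Type*} [NormedAddCommGroup X] [NormedSpace ℝ X] {D D' : Set X} {φ ψ ζ : X → ℝ}

lemma contDiff_fderiv_apply (hφ : ContDiff ℝ ∞ φ) (e : X) :
    ContDiff ℝ ∞ (fun z => fderiv ℝ φ z e) :=
  (hφ.fderiv_right (m := ∞) (by simp)).clm_apply contDiff_const

lemma fderiv_mul_apply (hφ : ContDiff ℝ ∞ φ) (hψ : ContDiff ℝ ∞ ψ) (z e : X) :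
    fderiv ℝ (fun z => φ z * ψ z) z e = φ z * fderiv ℝ ψ z e + fderiv ℝ φ z e * ψ z := by
  rw [fderiv_fun_mul (hφ.differentiable (by simp) z) (hψ.differentiable (by simp) z)]
  simp [mul_comm]

lemma tsupport_fderiv_apply_subset (φ : X → ℝ) (e : X) :
    tsupport (fun z => fderiv ℝ φ z e) ⊆ tsupport φ := by
  refine closure_minimal (fun z hz => ?_) (isClosed_tsupport φ)
  refine support_fderiv_subset ℝ (f := φ) ?_
  intro h
  exact hz (by simp [h])

lemma IsTest.fderiv_apply (h : IsTest D φ) (e : X) : IsTest D (fun z => fderiv ℝ φ z e) :=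
  ⟨contDiff_fderiv_apply h.smooth e,
    h.compact.mono' (subset_closure.trans (tsupport_fderiv_apply_subset φ e)),
    (tsupport_fderiv_apply_subset φ e).trans h.subset⟩

lemma IsTest.smooth_mul (h : IsTest D φ) (hζ : ContDiff ℝ ∞ ζ) :
    IsTest D (fun z => ζ z * φ z) :=
  ⟨hζ.mul h.smooth, h.compact.mul_left, (tsupport_mul_subset_right).trans h.subset⟩

lemma IsTest.mono (h : IsTest D φ) (hD : D ⊆ D') : IsTest D' φ :=
  ⟨h.smooth, h.compact, h.subset.trans hD⟩

lemma IsTest.sub (h : IsTest D φ) (h' : IsTest D ψ) : IsTest D (fun z => φ z - ψ z) := by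
  have hs : tsupport (fun z => φ z - ψ z) ⊆ tsupport φ ∪ tsupport ψ := by
    refine closure_minimal (fun z hz => ?_) ((isClosed_tsupport φ).union (isClosed_tsupport ψ))
    by_contra hc
    rw [mem_union, not_or] at hc
    exact hz (by simp [image_eq_zero_of_notMem_tsupport hc.1,
      image_eq_zero_of_notMem_tsupport hc.2])
  refine ⟨h.smooth.sub h'.smooth, ?_, hs.trans (union_subset h.subset h'.subset)⟩
  exact (h.compact.isCompact.union h'.compact.isCompact).of_isClosed_subset
    (isClosed_tsupport _) hs

lemma IsTest.eq_zero (h : IsTest D φ) {z : X} (hz : z ∉ D) : φ z = 0 :=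
  image_eq_zero_of_notMem_tsupport fun hc => hz (h.subset hc)

lemma IsTest.continuous (h : IsTest D φ) : Continuous φ := h.smooth.continuous

lemma IsTest.exists_bound (h : IsTest D φ) : ∃ C : ℝ, 0 ≤ C ∧ ∀ z, |φ z| ≤ C := by
  obtain ⟨C, hC⟩ := h.compact.exists_bound_of_continuous h.continuous
  exact ⟨C, (norm_nonneg _).trans (hC 0), hC⟩

variable [MeasurableSpace X] [BorelSpace X]

lemma IsTest.memLp (h : IsTest D φ) (μ : Measure X) [IsFiniteMeasureOnCompacts μ] :
    MemLp φ 2 μ :=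
  h.continuous.memLp_of_hasCompactSupport h.compact

end Tests

section Weak

variable {X : Type*} [NormedAddCommGroup X] [NormedSpace ℝ X] [MeasureSpace X]
  {D D' : Set X} {e : X} {f g f₁ g₁ f₂ g₂ φ ζ : X → ℝ}

lemma HasWeakDeriv.integral_test (h : HasWeakDeriv D e f g) (hφ : IsTest D φ) :
    ∫ z in D, f z * fderiv ℝ φ z e = -∫ z in D, g z * φ z :=
  h.integral_eq φ hφ.smooth hφ.compact hφ.subset

lemma _root_.MeasureTheory.MemLp.integrable_mul_two {α : Type*} {m : MeasurableSpace α} {μ : Measure α} {f g : α → ℝ}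
    (hf : MemLp f 2 μ) (hg : MemLp g 2 μ) : Integrable (fun z => f z * g z) μ :=
  hf.integrable_mul hg

lemma IsTest.setIntegral_mul (h : IsTest D φ) (f : X → ℝ) :
    ∫ z in D, f z * φ z = ∫ z, f z * φ z :=
  setIntegral_eq_integral_of_forall_compl_eq_zero fun z hz => by rw [h.eq_zero hz, mul_zero]

lemma HasWeakDeriv.mono (h : HasWeakDeriv D e f g) (hD : D' ⊆ D) : HasWeakDeriv D' e f g := by
  refine ⟨h.memLp.mono_measure (Measure.restrict_mono_set _ hD),
    h.memLp_deriv.mono_measure (Measure.restrict_mono_set _ hD), fun φ h1 h2 h3 => ?_⟩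
  have ht : IsTest D' φ := ⟨h1, h2, h3⟩
  have := h.integral_test (ht.mono hD)
  rw [((ht.mono hD).fderiv_apply e).setIntegral_mul, (ht.mono hD).setIntegral_mul] at this
  rwa [(ht.fderiv_apply e).setIntegral_mul, ht.setIntegral_mul]

lemma IsTest.integrable_mul [BorelSpace X] {μ : Measure X} (h : IsTest D φ) (hf : Integrable f μ) :
    Integrable (fun z => f z * φ z) μ := by
  obtain ⟨C, -, hC⟩ := h.exists_bound
  exact hf.mul_bdd (c := C) h.continuous.aestronglyMeasurable (ae_of_all _ hC)

variable [BorelSpace X] [(volume : Measure X).IsAddHaarMeasure]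

lemma HasWeakDeriv.sub (h₁ : HasWeakDeriv D e f₁ g₁) (h₂ : HasWeakDeriv D e f₂ g₂) :
    HasWeakDeriv D e (fun z => f₁ z - f₂ z) (fun z => g₁ z - g₂ z) := by
  refine ⟨h₁.memLp.sub h₂.memLp, h₁.memLp_deriv.sub h₂.memLp_deriv, fun φ a b c => ?_⟩
  have ht : IsTest D φ := ⟨a, b, c⟩
  simp_rw [sub_mul]
  rw [integral_sub (h₁.memLp.integrable_mul_two ((ht.fderiv_apply e).memLp _))
      (h₂.memLp.integrable_mul_two ((ht.fderiv_apply e).memLp _)),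
    integral_sub (h₁.memLp_deriv.integrable_mul_two (ht.memLp _))
      (h₂.memLp_deriv.integrable_mul_two (ht.memLp _)), h₁.integral_test ht, h₂.integral_test ht]
  ring

lemma _root_.MeasureTheory.MemLp.bdd_mul_two {α : Type*} {m : MeasurableSpace α}
    {μ : Measure α} {f ζ : α → ℝ} {C : ℝ}
    (hf : MemLp f 2 μ) (hζ : AEStronglyMeasurable ζ μ) (hC : ∀ᵐ z ∂μ, |ζ z| ≤ C) :
    MemLp (fun z => ζ z * f z) 2 μ := by
  refine hf.of_le_mul (c := C) (hζ.mul hf.1) ?_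
  filter_upwards [hC] with z hz
  rw [norm_mul]
  exact mul_le_mul_of_nonneg_right hz (norm_nonneg _)

/-- Product rule for a smooth factor that is bounded on `D` together with its derivative. -/
lemma HasWeakDeriv.smooth_mul (h : HasWeakDeriv D e f g) (hD : MeasurableSet D)
    (hζ : ContDiff ℝ ∞ ζ) {C : ℝ} (hC : ∀ z ∈ D, |ζ z| ≤ C)
    (hC' : ∀ z ∈ D, |fderiv ℝ ζ z e| ≤ C) :
    HasWeakDeriv D e (fun z => ζ z * f z) (fun z => ζ z * g z + fderiv ℝ ζ z e * f z) := by
  have hζ' := contDiff_fderiv_apply hζ e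
  have m1 : MemLp (fun z => ζ z * f z) 2 (volume.restrict D) :=
    h.memLp.bdd_mul_two hζ.continuous.aestronglyMeasurable (ae_restrict_of_forall_mem hD hC)
  have m2 : MemLp (fun z => ζ z * g z) 2 (volume.restrict D) :=
    h.memLp_deriv.bdd_mul_two hζ.continuous.aestronglyMeasurable (ae_restrict_of_forall_mem hD hC)
  have m3 : MemLp (fun z => fderiv ℝ ζ z e * f z) 2 (volume.restrict D) :=
    h.memLp.bdd_mul_two hζ'.continuous.aestronglyMeasurable (ae_restrict_of_forall_mem hD hC')
  refine ⟨m1, m2.add m3, fun φ a b c => ?_⟩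
  have ht : IsTest D φ := ⟨a, b, c⟩
  have key := h.integral_test (ht.smooth_mul hζ)
  simp_rw [fderiv_mul_apply hζ a, mul_add] at key
  rw [integral_add] at key
  · simp_rw [add_mul]
    rw [integral_add (m2.integrable_mul_two (ht.memLp _)) (m3.integrable_mul_two (ht.memLp _))]
    have e1 : ∫ z in D, f z * (ζ z * fderiv ℝ φ z e) = ∫ z in D, ζ z * f z * fderiv ℝ φ z e := by
      congr 1 with z; ring
    have e2 : ∫ z in D, f z * (fderiv ℝ ζ z e * φ z) = ∫ z in D, fderiv ℝ ζ z e * f z * φ z := by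
      congr 1 with z; ring
    have e3 : ∫ z in D, g z * (ζ z * φ z) = ∫ z in D, ζ z * g z * φ z := by
      congr 1 with z; ring
    linarith
  · exact h.memLp.integrable_mul_two (((ht.fderiv_apply e).smooth_mul hζ).memLp _)
  · exact h.memLp.integrable_mul_two ((ht.smooth_mul hζ').memLp _)

variable [FiniteDimensional ℝ X]

/-- A smooth function with compact support has its classical derivative as weak derivative, on any
set `D`. -/
lemma IsTest.hasWeakDeriv (h : IsTest univ φ) (D : Set X) (e : X) :
    HasWeakDeriv D e φ (fun z => fderiv ℝ φ z e) := by
  refine ⟨h.memLp _, (h.fderiv_apply e).memLp _, fun ψ a b c => ?_⟩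
  have ht : IsTest D ψ := ⟨a, b, c⟩
  rw [(ht.fderiv_apply e).setIntegral_mul, ht.setIntegral_mul]
  refine integral_mul_fderiv_eq_neg_fderiv_mul_of_integrable
    (((h.fderiv_apply e).memLp volume).integrable_mul_two (ht.memLp volume))
    ((h.memLp volume).integrable_mul_two ((ht.fderiv_apply e).memLp volume))
    ((h.memLp volume).integrable_mul_two (ht.memLp volume)) (fun x _ => ?_) (fun x _ => ?_)
  · exact h.smooth.differentiable (by simp) x
  · exact a.differentiable (by simp) x

/-- Two integrable functions on `D` that agree against every test function agree almost
everywhere. -/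
lemma ae_eq_of_forall_test (hD : IsOpen D) (hf : IntegrableOn f D)
    (hg : IntegrableOn g D)
    (h : ∀ φ, IsTest D φ → ∫ z in D, f z * φ z = ∫ z in D, g z * φ z) :
    f =ᵐ[volume.restrict D] g := by
  have := hD.ae_eq_zero_of_integral_contDiff_smul_eq_zero
    (hf.sub hg).locallyIntegrableOn (fun φ a b c => by
    have ht : IsTest D φ := ⟨a, b, c⟩
    rw [← setIntegral_eq_integral_of_forall_compl_eq_zero (s := D)
      (fun z hz => by rw [ht.eq_zero hz, zero_smul])]
    have e1 : ∀ z, φ z • (f - g) z = f z * φ z - g z * φ z := fun z => by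
      rw [smul_eq_mul, Pi.sub_apply]; ring
    simp_rw [e1]
    rw [integral_sub (ht.integrable_mul hf) (ht.integrable_mul hg), h φ ht, sub_self])
  rw [EventuallyEq, ae_restrict_iff' hD.measurableSet]
  filter_upwards [this] with z hz hzD
  exact sub_eq_zero.mp (hz hzD)

end Weak

end

/-! ### Cylinders, cutoffs in time, and translations -/

section

/-- A smooth cutoff in time, supported in `[a + 1/n, b - 1/n]` and converging to `1` on `(a, b)`. -/
noncomputable def timeCutoff (a b : ℝ) (n : ℕ) (t : ℝ) : ℝ :=
  Real.smoothTransition (n * (t - a) - 1) * Real.smoothTransition (n * (b - t) - 1)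

section

variable {a b : ℝ} {n : ℕ} {t : ℝ}

lemma contDiff_timeCutoff (a b : ℝ) (n : ℕ) : ContDiff ℝ ∞ (timeCutoff a b n) := by
  unfold timeCutoff
  exact (Real.smoothTransition.contDiff.comp (by fun_prop)).mul
    (Real.smoothTransition.contDiff.comp (by fun_prop))

lemma timeCutoff_nonneg : 0 ≤ timeCutoff a b n t :=
  mul_nonneg (Real.smoothTransition.nonneg _) (Real.smoothTransition.nonneg _)

lemma timeCutoff_le_one : timeCutoff a b n t ≤ 1 :=
  mul_le_one₀ (Real.smoothTransition.le_one _) (Real.smoothTransition.nonneg _)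
    (Real.smoothTransition.le_one _)

lemma tsupport_timeCutoff_subset : tsupport (timeCutoff a b n) ⊆ Ioo a b := by
  have h : tsupport (timeCutoff a b n) ⊆ {t | 1 ≤ n * (t - a)} ∩ {t | 1 ≤ n * (b - t)} := by
    refine closure_minimal (fun t ht => ?_) ?_
    · by_contra hc
      rw [mem_inter_iff, not_and_or] at hc
      simp only [mem_ofPred_eq, not_le] at hc
      refine ht ?_
      unfold timeCutoff
      rcases hc with hc | hc
      · rw [Real.smoothTransition.zero_of_nonpos (by linarith), zero_mul]
      · rw [mul_comm, Real.smoothTransition.zero_of_nonpos (by linarith), zero_mul]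
    · exact (isClosed_le continuous_const (by fun_prop)).inter
        (isClosed_le continuous_const (by fun_prop))
  refine h.trans fun t ht => ?_
  obtain ⟨h1, h2⟩ := ht
  simp only [mem_ofPred_eq] at h1 h2
  have hn : (0 : ℝ) ≤ n := Nat.cast_nonneg n
  constructor
  · by_contra hc
    nlinarith
  · by_contra hc
    nlinarith

lemma eventually_timeCutoff_eq_one (ht : t ∈ Ioo a b) :
    ∀ᶠ n : ℕ in atTop, timeCutoff a b n t = 1 := by
  have h1 := (tendsto_natCast_atTop_atTop (R := ℝ)).atTop_mul_const (sub_pos.mpr ht.1)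
  have h2 := (tendsto_natCast_atTop_atTop (R := ℝ)).atTop_mul_const (sub_pos.mpr ht.2)
  filter_upwards [h1.eventually_ge_atTop 2, h2.eventually_ge_atTop 2] with n h1 h2
  unfold timeCutoff
  rw [Real.smoothTransition.one_of_one_le (by linarith),
    Real.smoothTransition.one_of_one_le (by linarith), one_mul]

lemma tendsto_timeCutoff (ht : t ∈ Ioo a b) :
    Tendsto (fun n : ℕ => timeCutoff a b n t) atTop (𝓝 1) :=
  tendsto_const_nhds.congr' ((eventually_timeCutoff_eq_one ht).mono fun _ h => h.symm)

end

variable {d : ℕ} {Ω : Set (Space d)} {a b : ℝ}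

lemma isOpen_stCylinder (hΩ : IsOpen Ω) (a b : ℝ) : IsOpen (stCylinder Ω a b) :=
  hΩ.prod isOpen_Ioo

lemma volume_stCylinder (Ω : Set (Space d)) (a b : ℝ) :
    (volume : Measure (SpaceTime d)).restrict (stCylinder Ω a b) =
      (volume.restrict Ω).prod (volume.restrict (Ioo a b)) :=
  (Measure.prod_restrict Ω (Ioo a b)).symm

lemma fderiv_comp_snd_xDir {θ : ℝ → ℝ} (hθ : ContDiff ℝ ∞ θ) (z : SpaceTime d) (i : Fin d) :
    fderiv ℝ (fun z : SpaceTime d => θ z.2) z (xDir i) = 0 := by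
  have h : HasFDerivAt (fun z : SpaceTime d => θ z.2)
      ((fderiv ℝ θ z.2).comp (ContinuousLinearMap.snd ℝ (Space d) ℝ)) z :=
    ((hθ.differentiable (by simp) z.2).hasFDerivAt).comp z hasFDerivAt_snd
  rw [h.fderiv]
  simp [xDir]

lemma fderiv_comp_snd_tDir {θ : ℝ → ℝ} (hθ : ContDiff ℝ ∞ θ) (z : SpaceTime d) :
    fderiv ℝ (fun z : SpaceTime d => θ z.2) z (tDir d) = deriv θ z.2 := by
  have h : HasFDerivAt (fun z : SpaceTime d => θ z.2)
      ((fderiv ℝ θ z.2).comp (ContinuousLinearMap.snd ℝ (Space d) ℝ)) z :=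
    ((hθ.differentiable (by simp) z.2).hasFDerivAt).comp z hasFDerivAt_snd
  rw [h.fderiv]
  simp [tDir]

lemma IsTest.timeCutoff_mul {φ : SpaceTime d → ℝ} (h : IsTest (Ω ×ˢ univ) φ) (a b : ℝ) (n : ℕ) :
    IsTest (stCylinder Ω a b) (fun z => timeCutoff a b n z.2 * φ z) := by
  have h' := h.smooth_mul (ζ := fun z : SpaceTime d => timeCutoff a b n z.2)
    ((contDiff_timeCutoff a b n).comp contDiff_snd)
  refine ⟨h'.smooth, h'.compact, fun z hz => ⟨(h'.subset hz).1, ?_⟩⟩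
  refine tsupport_timeCutoff_subset (n := n) ?_
  have : tsupport (fun z : SpaceTime d => timeCutoff a b n z.2) ⊆
      Prod.snd ⁻¹' tsupport (timeCutoff a b n) :=
    closure_minimal (fun z hz => subset_closure hz)
      ((isClosed_tsupport _).preimage continuous_snd)
  exact this (tsupport_mul_subset_left hz)

/-- On a cylinder, the definition of the weak derivative in a space direction also holds for test
functions that do not vanish near the bottom and the top. -/
lemma HasWeakDeriv.integral_test_cylinder {i : Fin d} {f g φ : SpaceTime d → ℝ}
    (h : HasWeakDeriv (stCylinder Ω a b) (xDir i) f g) (hΩ : IsOpen Ω)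
    (hφ : IsTest (Ω ×ˢ univ) φ) :
    ∫ z in stCylinder Ω a b, f z * fderiv ℝ φ z (xDir i) =
      -∫ z in stCylinder Ω a b, g z * φ z := by
  have hD := (isOpen_stCylinder hΩ a b).measurableSet
  have key : ∀ f φ : SpaceTime d → ℝ, MemLp f 2 (volume.restrict (stCylinder Ω a b)) →
      IsTest (Ω ×ˢ univ) φ → Tendsto (fun n : ℕ => ∫ z in stCylinder Ω a b,
        f z * (timeCutoff a b n z.2 * φ z)) atTop (𝓝 (∫ z in stCylinder Ω a b, f z * φ z)) := by
    intro f φ hf hφ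
    refine tendsto_integral_of_dominated_convergence (fun z => ‖f z * φ z‖) (fun n => ?_)
      (hf.integrable_mul_two (hφ.memLp _)).norm (fun n => ?_) ?_
    · exact hf.1.mul (((contDiff_timeCutoff a b n).continuous.comp
        continuous_snd).aestronglyMeasurable.mul (hφ.memLp _).1)
    · refine ae_of_all _ fun z => ?_
      rw [norm_mul, norm_mul, norm_mul]
      refine mul_le_mul_of_nonneg_left ?_ (norm_nonneg _)
      rw [Real.norm_of_nonneg timeCutoff_nonneg]
      exact mul_le_of_le_one_left (norm_nonneg _) timeCutoff_le_one
    · refine ae_restrict_of_forall_mem hD fun z hz => ?_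
      simpa using ((tendsto_timeCutoff hz.2).mul_const (φ z)).const_mul (f z)
  refine tendsto_nhds_unique (key f _ h.memLp (hφ.fderiv_apply _))
    ((key g φ h.memLp_deriv hφ).neg.congr fun n => ?_)
  rw [← h.integral_test (hφ.timeCutoff_mul a b n)]
  congr 1 with z
  rw [fderiv_mul_apply (φ := fun z : SpaceTime d => timeCutoff a b n z.2)
    ((contDiff_timeCutoff a b n).comp contDiff_snd) hφ.smooth]
  rw [fderiv_comp_snd_xDir (contDiff_timeCutoff a b n), zero_mul, add_zero]

/-- The cross-correlation of two square integrable functions is continuous. -/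
lemma continuous_integral_mul_translate {f g : SpaceTime d → ℝ} (hf : MemLp f 2 volume)
    (hg : MemLp g 2 volume) : Continuous fun y : SpaceTime d => ∫ z, f z * g (z - y) := by
  let τ : SpaceTime d → C(SpaceTime d, SpaceTime d) := fun y => ⟨fun z => z - y, by fun_prop⟩
  have hτ : Continuous τ := ContinuousMap.continuous_of_continuous_uncurry _ (by
    simp only [τ]; exact continuous_snd.sub continuous_fst)
  have hm : ∀ y, MeasurePreserving (τ y) volume volume := fun y =>
    measurePreserving_sub_right volume y
  have h := (continuous_const (y := hg.toLp g)).compMeasurePreservingLp hτ hm (by norm_num)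
  have h2 := (continuous_const (y := hf.toLp f)).inner (𝕜 := ℝ) h
  refine h2.congr fun y => ?_
  rw [L2.inner_def]
  refine integral_congr_ae ?_
  filter_upwards [hf.coeFn_toLp, Lp.coeFn_compMeasurePreserving (hg.toLp g) (hm y),
    (hm y).quasiMeasurePreserving.ae_eq_comp hg.coeFn_toLp] with z h1 h2 h3
  rw [h1, h2, h3]
  simp [τ, mul_comm]

end

/-! ### Functions with a time derivative as primitives in time -/

section

variable {d : ℕ} {Ω : Set (Space d)} {T : ℝ}

section Shear

variable {P : Type*} [MeasurableSpace P] {s : P → SpaceTime d}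

lemma measurePreserving_shear (ν : Measure P) [SFinite ν] (hs : Measurable s) :
    MeasurePreserving (fun p : P × SpaceTime d => (p.1, p.2 - s p.1)) (ν.prod volume)
      (ν.prod volume) := by
  refine MeasurePreserving.skew_product (f := id) (g := fun a c => c - s a)
    (MeasurePreserving.id ν) ?_ (ae_of_all _ fun a => ?_)
  · simp only [Function.uncurry_def]
    exact measurable_snd.sub (hs.comp measurable_fst)
  · exact (measurePreserving_sub_right volume (s a)).map_eq

lemma integrable_shear {ν : Measure P} [IsFiniteMeasure ν] {f : SpaceTime d → ℝ}
    (hf : Integrable f) (hs : Measurable s) :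
    Integrable (fun p : P × SpaceTime d => f (p.2 - s p.1)) (ν.prod volume) :=
  (measurePreserving_shear ν hs).integrable_comp_of_integrable (hf.comp_snd ν)

lemma integrable_mul_shear {ν : Measure P} [IsFiniteMeasure ν] {f g : SpaceTime d → ℝ}
    (hf : MemLp f 2) (hg : MemLp g 2) (hs : Measurable s) :
    Integrable (fun p : P × SpaceTime d => f p.2 * g (p.2 - s p.1)) (ν.prod volume) := by
  have h1 : Integrable (fun p : P × SpaceTime d => f p.2 ^ 2) (ν.prod volume) :=
    hf.integrable_sq.comp_snd ν
  have h2 := integrable_shear (ν := ν) hg.integrable_sq hs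
  have m1 : AEStronglyMeasurable (fun p : P × SpaceTime d => f p.2) (ν.prod volume) :=
    hf.1.comp_snd
  have m2 : AEStronglyMeasurable (fun p : P × SpaceTime d => g (p.2 - s p.1))
      (ν.prod volume) :=
    (hg.1.comp_snd (μ := ν)).comp_measurePreserving (measurePreserving_shear ν hs)
  refine (h1.add h2).mono' (m1.mul m2) (ae_of_all _ fun p => ?_)
  rw [norm_mul, Real.norm_eq_abs, Real.norm_eq_abs, Pi.add_apply]
  nlinarith [sq_nonneg (|f p.2| - |g (p.2 - s p.1)|), sq_abs (f p.2),
    sq_abs (g (p.2 - s p.1)), sq_nonneg (|f p.2|), sq_nonneg (|g (p.2 - s p.1)|)]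

end Shear

lemma measurable_smul_dir (e : SpaceTime d) : Measurable fun σ : ℝ => σ • e := by
  fun_prop

/-- The primitive of a test function in time that vanishes at the final time. -/
noncomputable def testPrimitive (T : ℝ) (ψ : SpaceTime d → ℝ) (z : SpaceTime d) : ℝ :=
  ∫ σ in (0 : ℝ)..T, ψ (z + σ • tDir d)

lemma tDir_snd : (tDir d).2 = 1 := rfl

lemma contDiff_testPrimitive {D : Set (SpaceTime d)} {ψ : SpaceTime d → ℝ} (hψ : IsTest D ψ)
    (hT : 0 ≤ T) : ContDiff ℝ ∞ (testPrimitive T ψ) := by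
  -- the primitive is the convolution of `ψ` with the length measure of a segment
  let j : ℝ → SpaceTime d := fun σ => -(σ • tDir d)
  have hj : Measurable j := by fun_prop
  have hje : MeasurableEmbedding j := by
    refine Continuous.measurableEmbedding (by fun_prop) fun s t h => ?_
    have := congrArg Prod.snd h
    simpa [j, tDir] using this
  let μ := (volume.restrict (Ioc 0 T)).map j
  have : IsFiniteMeasure μ := Measure.isFiniteMeasure_map _ _
  have h := hψ.compact.contDiff_convolution_right (n := ⊤) (f := fun _ : SpaceTime d => (1 : ℝ))
    (μ := μ) (ContinuousLinearMap.mul ℝ ℝ) (integrable_const 1).locallyIntegrable hψ.smooth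
  convert h using 1
  ext z
  rw [testPrimitive, convolution_def, hje.integral_map, intervalIntegral.integral_of_le hT]
  simp [j]

lemma isTest_testPrimitive {ψ : SpaceTime d → ℝ} (hψ : IsTest (stCylinder Ω 0 T) ψ)
    (hT : 0 ≤ T) : IsTest (Ω ×ˢ Iio T) (testPrimitive T ψ) := by
  let K : Set (SpaceTime d) := (fun p : SpaceTime d × ℝ => p.1 - p.2 • tDir d) ''
    (tsupport ψ ×ˢ Icc 0 T)
  have hK : IsCompact K := (hψ.compact.isCompact.prod isCompact_Icc).image (by fun_prop)
  have hs : tsupport (testPrimitive T ψ) ⊆ K := by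
    refine closure_minimal (fun z hz => ?_) hK.isClosed
    by_contra hc
    refine hz ?_
    rw [testPrimitive, intervalIntegral.integral_of_le hT]
    refine setIntegral_eq_zero_of_forall_eq_zero fun σ hσ => ?_
    refine image_eq_zero_of_notMem_tsupport fun hm => hc ?_
    exact ⟨(z + σ • tDir d, σ), ⟨hm, ⟨hσ.1.le, hσ.2⟩⟩, by simp⟩
  refine ⟨contDiff_testPrimitive hψ hT, hK.of_isClosed_subset (isClosed_tsupport _) hs,
    hs.trans ?_⟩
  rintro _ ⟨⟨w, σ⟩, ⟨hw, hσ⟩, rfl⟩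
  have := hψ.subset hw
  refine ⟨by simpa [tDir] using this.1, ?_⟩
  have h2 := this.2.2
  have h3 := hσ.1
  simp only [Prod.snd_sub, Prod.smul_snd, tDir_snd, smul_eq_mul, mem_Iio] at *
  linarith

lemma fderiv_testPrimitive {ψ : SpaceTime d → ℝ} (hψ : IsTest (stCylinder Ω 0 T) ψ)
    (hT : 0 ≤ T) {z : SpaceTime d} (hz : 0 ≤ z.2) :
    fderiv ℝ (testPrimitive T ψ) z (tDir d) = -ψ z := by
  have hd := ((contDiff_testPrimitive hψ hT).differentiable (by simp) z).hasFDerivAt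
  have h1 := hd.hasLineDerivAt (tDir d)
  have hc : Continuous fun σ : ℝ => ψ (z + σ • tDir d) := hψ.continuous.comp (by fun_prop)
  have h2 : HasDerivAt (fun h : ℝ => testPrimitive T ψ (z + h • tDir d))
      (ψ (z + T • tDir d) - ψ z) 0 := by
    have e : ∀ h : ℝ, testPrimitive T ψ (z + h • tDir d) =
        (∫ σ in (0 : ℝ)..(T + h), ψ (z + σ • tDir d)) - ∫ σ in (0 : ℝ)..h, ψ (z + σ • tDir d) := by
      intro h
      rw [intervalIntegral.integral_interval_sub_left (hc.intervalIntegrable _ _)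
        (hc.intervalIntegrable _ _)]
      have := intervalIntegral.integral_comp_add_right (a := 0) (b := T)
        (fun σ : ℝ => ψ (z + σ • tDir d)) h
      rw [zero_add] at this
      rw [← this, testPrimitive]
      congr 1 with σ
      rw [add_assoc, ← add_smul, add_comm h σ]
    simp_rw [e]
    have i1 : HasDerivAt (fun u : ℝ => ∫ σ in (0 : ℝ)..u, ψ (z + σ • tDir d))
        (ψ (z + T • tDir d)) (T + 0) := by
      simpa using intervalIntegral.integral_hasDerivAt_right (hc.intervalIntegrable 0 (T + 0))
        hc.aestronglyMeasurable.stronglyMeasurableAtFilter hc.continuousAt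
    have i2 : HasDerivAt (fun u : ℝ => ∫ σ in (0 : ℝ)..u, ψ (z + σ • tDir d)) (ψ z) 0 := by
      simpa using intervalIntegral.integral_hasDerivAt_right (hc.intervalIntegrable 0 0)
        hc.aestronglyMeasurable.stronglyMeasurableAtFilter hc.continuousAt
    exact (i1.comp_const_add T 0).sub i2
  have h3 : ψ (z + T • tDir d) = 0 := hψ.eq_zero fun hm => by
    have := hm.2.2
    simp only [Prod.snd_add, Prod.smul_snd, tDir_snd, smul_eq_mul] at this
    linarith
  rw [h3, zero_sub] at h2
  exact HasDerivAt.unique h1 h2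

end

section

variable {d : ℕ} {Ω : Set (Space d)} {T : ℝ}

lemma hasDerivAt_time {φ : SpaceTime d → ℝ} (hφ : ContDiff ℝ ∞ φ) (x : Space d) (t : ℝ) :
    HasDerivAt (fun t => φ (x, t)) (fderiv ℝ φ (x, t) (tDir d)) t := by
  have h1 : HasDerivAt (fun t : ℝ => ((x, t) : SpaceTime d)) (tDir d) t :=
    (hasDerivAt_const t x).prodMk (hasDerivAt_id t)
  exact ((hφ.differentiable (by simp) (x, t)).hasFDerivAt).comp_hasDerivAt t h1

lemma isFiniteMeasure_restrict_of_isBounded {X : Type*} [PseudoMetricSpace X] [ProperSpace X]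
    [MeasurableSpace X] {μ : Measure X} [IsFiniteMeasureOnCompacts μ] {s : Set X}
    (hs : Bornology.IsBounded s) : IsFiniteMeasure (μ.restrict s) :=
  ⟨by simpa using hs.measure_lt_top⟩

lemma hasWeakDeriv_comp_fst (hb : Bornology.IsBounded Ω) {v₀ : Space d → ℝ}
    (hv : MemLp v₀ 2 (volume.restrict Ω)) :
    HasWeakDeriv (stCylinder Ω 0 T) (tDir d) (fun z => v₀ z.1) (fun _ => 0) := by
  have := isFiniteMeasure_restrict_of_isBounded (μ := (volume : Measure (Space d))) hb
  have hm : MemLp (fun z : SpaceTime d => v₀ z.1) 2 (volume.restrict (stCylinder Ω 0 T)) := by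
    rw [volume_stCylinder]
    exact hv.comp_fst _
  refine ⟨hm, MemLp.zero', fun φ h1 h2 h3 => ?_⟩
  have ht : IsTest (stCylinder Ω 0 T) φ := ⟨h1, h2, h3⟩
  have hi := hm.integrable_mul_two ((ht.fderiv_apply (tDir d)).memLp _)
  rw [volume_stCylinder] at hi ⊢
  rw [integral_prod _ hi]
  simp only [zero_mul, integral_zero, neg_zero]
  refine integral_eq_zero_of_ae (ae_of_all _ fun x => ?_)
  simp only [Pi.zero_apply, integral_const_mul]
  have hz : ∀ t ∉ Ioo 0 T, fderiv ℝ φ (x, t) (tDir d) = 0 := fun t ht' =>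
    (ht.fderiv_apply (tDir d)).eq_zero fun hm => ht' hm.2
  rw [setIntegral_eq_integral_of_forall_compl_eq_zero hz]
  have hcl : Topology.IsClosedEmbedding (fun t : ℝ => ((x, t) : SpaceTime d)) :=
    Topology.IsClosedEmbedding.of_continuous_injective_isClosedMap (by fun_prop)
      (fun a b h => (Prod.ext_iff.mp h).2) (isClosedMap_prodMk_left x)
  have c1 : Integrable (fun t => φ (x, t)) :=
    (ht.continuous.comp hcl.continuous).integrable_of_hasCompactSupport
      (ht.compact.comp_isClosedEmbedding hcl)
  have c2 : Integrable (fun t => fderiv ℝ φ (x, t) (tDir d)) :=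
    ((ht.fderiv_apply (tDir d)).continuous.comp hcl.continuous).integrable_of_hasCompactSupport
      ((ht.fderiv_apply (tDir d)).compact.comp_isClosedEmbedding hcl)
  rw [integral_eq_zero_of_hasDerivAt_of_integrable (fun t => hasDerivAt_time h1 x t) c2 c1, mul_zero]

lemma aestronglyMeasurable_slice {F : Type*} [TopologicalSpace F] {f : SpaceTime d → F}
    (hf : AEStronglyMeasurable f (volume.restrict (stCylinder Ω 0 T))) :
    ∀ᵐ t ∂(volume.restrict (Ioo 0 T)),
      AEStronglyMeasurable (fun x => f (x, t)) (volume.restrict Ω) := by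
  rw [volume_stCylinder] at hf
  exact hf.prod_swap.prodMk_left

/-- If `w(·, t) → 0` as `t → 0`, the definition of the weak time derivative also holds for test
functions that do not vanish near `t = 0`. -/
lemma HasWeakDeriv.integral_test_of_trace_zero {w wt : SpaceTime d → ℝ}
    (h : HasWeakDeriv (stCylinder Ω 0 T) (tDir d) w wt) (hΩ : IsOpen Ω)
    (hb : Bornology.IsBounded Ω) (hT : 0 < T)
    (htr : Tendsto (fun t => eLpNorm (fun x => w (x, t)) 2 (volume.restrict Ω))
      (ae (volume.restrict (Ioo 0 T)) ⊓ 𝓝 0) (𝓝 0))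
    {φ : SpaceTime d → ℝ} (hφ : IsTest (Ω ×ˢ Iio T) φ) :
    ∫ z in stCylinder Ω 0 T, w z * fderiv ℝ φ z (tDir d) =
      -∫ z in stCylinder Ω 0 T, wt z * φ z := by
  have hD := (isOpen_stCylinder hΩ 0 T).measurableSet
  have hfin := isFiniteMeasure_restrict_of_isBounded (μ := (volume : Measure (Space d))) hb
  let θ : ℕ → ℝ → ℝ := fun n t => Real.smoothTransition (n * t - 1)
  have hθ : ∀ n, ContDiff ℝ ∞ (θ n) := fun n => Real.smoothTransition.contDiff.comp (by fun_prop)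
  have hθ1 : ∀ n t, |θ n t| ≤ 1 := fun n t => by
    rw [abs_of_nonneg (Real.smoothTransition.nonneg _)]; exact Real.smoothTransition.le_one _
  have hθm : ∀ n, Monotone (θ n) := fun n s t hst =>
    Real.smoothTransition.monotone (by gcongr)
  have hev : ∀ δ : ℝ, 0 < δ → ∀ᶠ n : ℕ in atTop, ∀ t, δ ≤ t → 2 ≤ n * t := fun δ hδ => by
    filter_upwards [((tendsto_natCast_atTop_atTop (R := ℝ)).atTop_mul_const
      hδ).eventually_ge_atTop 2] with n hn t ht
    exact hn.trans (by gcongr)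
  have htest : ∀ n, IsTest (stCylinder Ω 0 T) (fun z => θ n z.2 * φ z) := fun n => by
    have h' := hφ.smooth_mul (ζ := fun z : SpaceTime d => θ n z.2) ((hθ n).comp contDiff_snd)
    refine ⟨h'.smooth, h'.compact, fun z hz => ⟨(h'.subset hz).1, ?_, (h'.subset hz).2⟩⟩
    have : tsupport (fun z : SpaceTime d => θ n z.2) ⊆ {z | 1 ≤ n * z.2} := by
      refine closure_minimal (fun z hz => ?_) (isClosed_le continuous_const (by fun_prop))
      by_contra hc
      simp only [mem_ofPred_eq, not_le] at hc
      exact hz (Real.smoothTransition.zero_of_nonpos (by linarith))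
    have h2 : 1 ≤ n * z.2 := this (tsupport_mul_subset_left hz)
    by_contra hc
    nlinarith [Nat.cast_nonneg (α := ℝ) n]
  have key : ∀ f φ : SpaceTime d → ℝ, MemLp f 2 (volume.restrict (stCylinder Ω 0 T)) →
      IsTest (Ω ×ˢ Iio T) φ → Tendsto (fun n : ℕ => ∫ z in stCylinder Ω 0 T,
        f z * (θ n z.2 * φ z)) atTop (𝓝 (∫ z in stCylinder Ω 0 T, f z * φ z)) := by
    intro f φ hf hφ
    refine tendsto_integral_of_dominated_convergence (fun z => ‖f z * φ z‖) (fun n => ?_)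
      (hf.integrable_mul_two (hφ.memLp _)).norm (fun n => ?_) ?_
    · exact hf.1.mul (((hθ n).continuous.comp
        continuous_snd).aestronglyMeasurable.mul (hφ.memLp _).1)
    · refine ae_of_all _ fun z => ?_
      rw [norm_mul, norm_mul, norm_mul]
      refine mul_le_mul_of_nonneg_left ?_ (norm_nonneg _)
      exact mul_le_of_le_one_left (norm_nonneg _) (hθ1 n z.2)
    · refine ae_restrict_of_forall_mem hD fun z hz => tendsto_const_nhds.congr' ?_
      filter_upwards [hev z.2 hz.2.1] with n hn
      simp only [θ]
      rw [Real.smoothTransition.one_of_one_le (by linarith [hn z.2 le_rfl]), one_mul]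
  obtain ⟨B, hB0, hB⟩ := hφ.exists_bound
  -- the derivative of the cutoff concentrates at `t = 0`, where `w` is small
  have hsmall : Tendsto (fun n : ℕ => ∫ z in stCylinder Ω 0 T, w z * (deriv (θ n) z.2 * φ z))
      atTop (𝓝 0) := by
    have hθ' : ∀ n t, 0 ≤ deriv (θ n) t := fun n t => (hθm n).deriv_nonneg
    have hθc : ∀ n, Continuous (deriv (θ n)) := fun n => (hθ n).continuous_deriv (by simp)
    have hd0 : ∀ δ : ℝ, 0 < δ → ∀ᶠ n : ℕ in atTop, ∀ t, δ ≤ t → deriv (θ n) t = 0 := by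
      intro δ hδ
      filter_upwards [hev (δ / 2) (by positivity)] with n hn t ht
      have : θ n =ᶠ[𝓝 t] fun _ => 1 := by
        filter_upwards [lt_mem_nhds (show δ / 2 < t by linarith)] with s hs
        exact Real.smoothTransition.one_of_one_le (by linarith [hn s hs.le])
      rw [this.deriv_eq]
      simp
    rw [Metric.tendsto_nhds]
    intro η hη
    let V : ℝ≥0∞ := volume.restrict Ω univ ^ (1 / (1 : ℝ≥0∞).toReal - 1 / (2 : ℝ≥0∞).toReal)
    have hV : V ≠ ⊤ := ENNReal.rpow_ne_top_of_nonneg (by norm_num) (measure_ne_top _ _)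
    have htr' : Tendsto (fun t => eLpNorm (fun x => w (x, t)) 2 (volume.restrict Ω) * V)
        (ae (volume.restrict (Ioo 0 T)) ⊓ 𝓝 0) (𝓝 0) := by
      simpa using ENNReal.Tendsto.mul_const htr (Or.inr hV)
    let η' := η / (2 * (B + 1))
    have hη' : 0 < η' := by positivity
    have hev2 := htr'.eventually_le_const (ENNReal.ofReal_pos.mpr hη')
    obtain ⟨s, hs, u, hu, hsu⟩ := Filter.mem_inf_iff_superset.mp hev2
    obtain ⟨δ, hδ, hδu⟩ := Metric.mem_nhds_iff.mp hu
    filter_upwards [hd0 δ hδ] with n hn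
    have hCn : ∃ C, ∀ z ∈ stCylinder Ω 0 T, ‖deriv (θ n) z.2‖ ≤ C := by
      obtain ⟨C, hC⟩ := isCompact_Icc.exists_bound_of_continuousOn (s := Icc 0 T)
        (hθc n).continuousOn
      exact ⟨C, fun z hz => hC _ (Ioo_subset_Icc_self hz.2)⟩
    obtain ⟨C, hC⟩ := hCn
    have hφm : MemLp (fun z => deriv (θ n) z.2 * φ z) 2 (volume.restrict (stCylinder Ω 0 T)) :=
      (hφ.memLp _).bdd_mul_two ((hθc n).comp continuous_snd).aestronglyMeasurable
        (ae_restrict_of_forall_mem hD hC)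
    have hint := h.memLp.integrable_mul_two hφm
    rw [dist_zero_right]
    have hslice := aestronglyMeasurable_slice h.memLp.1
    rw [volume_stCylinder] at hint ⊢
    rw [integral_prod_symm _ hint]
    have hbound : ∀ᵐ t ∂(volume.restrict (Ioo 0 T)),
        ‖∫ x in Ω, w (x, t) * (deriv (θ n) t * φ (x, t))‖ ≤ deriv (θ n) t * (B * η') := by
      filter_upwards [hs, hslice, ae_restrict_mem measurableSet_Ioo] with t hts hm htT
      rcases le_or_gt δ t with hδt | hδt
      · simp [hn t hδt]
      · have h1 : eLpNorm (fun x => w (x, t)) 2 (volume.restrict Ω) * V ≤ ENNReal.ofReal η' := by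
          refine hsu ⟨hts, hδu ?_⟩
          rw [Metric.mem_ball, dist_zero_right, Real.norm_of_nonneg htT.1.le]
          exact hδt
        have h2 : eLpNorm (fun x => w (x, t)) 1 (volume.restrict Ω) ≤ ENNReal.ofReal η' :=
          (eLpNorm_le_eLpNorm_mul_rpow_measure_univ (by norm_num) hm).trans h1
        have h3 : Integrable (fun x => w (x, t)) (volume.restrict Ω) :=
          memLp_one_iff_integrable.mp ⟨hm, h2.trans_lt ENNReal.ofReal_lt_top⟩
        have h4 : ∫ x in Ω, ‖w (x, t)‖ ≤ η' := by
          rw [integral_norm_eq_lintegral_enorm hm, ← eLpNorm_one_eq_lintegral_enorm]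
          exact ENNReal.toReal_le_of_le_ofReal hη'.le h2
        calc ‖∫ x in Ω, w (x, t) * (deriv (θ n) t * φ (x, t))‖
            ≤ ∫ x in Ω, ‖w (x, t)‖ * (deriv (θ n) t * B) := by
              refine norm_integral_le_of_norm_le (h3.norm.mul_const _) (ae_of_all _ fun x => ?_)
              rw [norm_mul, norm_mul, Real.norm_of_nonneg (hθ' n t)]
              exact mul_le_mul_of_nonneg_left (mul_le_mul_of_nonneg_left (hB _) (hθ' n t))
                (norm_nonneg _)
          _ = (∫ x in Ω, ‖w (x, t)‖) * (deriv (θ n) t * B) := integral_mul_const _ _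
          _ ≤ η' * (deriv (θ n) t * B) :=
              mul_le_mul_of_nonneg_right h4 (mul_nonneg (hθ' n t) hB0)
          _ = _ := by ring
    have hi : ∫ t in Ioo 0 T, deriv (θ n) t ≤ 1 := by
      rw [← integral_Ioc_eq_integral_Ioo, ← intervalIntegral.integral_of_le hT.le,
        intervalIntegral.integral_deriv_eq_sub
          (fun t _ => (hθ n).differentiable (by simp) t) ((hθc n).intervalIntegrable _ _)]
      have e0 : 0 ≤ θ n 0 := Real.smoothTransition.nonneg _
      have e1 : θ n T ≤ 1 := Real.smoothTransition.le_one _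
      linarith
    have hii : Integrable (deriv (θ n)) (volume.restrict (Ioo 0 T)) :=
      (((hθc n).intervalIntegrable (μ := volume) 0 T).1).mono_set Ioo_subset_Ioc_self
    calc ‖∫ t in Ioo 0 T, ∫ x in Ω, w (x, t) * (deriv (θ n) t * φ (x, t))‖
        ≤ ∫ t in Ioo 0 T, deriv (θ n) t * (B * η') :=
          norm_integral_le_of_norm_le (hii.mul_const _) hbound
      _ = (∫ t in Ioo 0 T, deriv (θ n) t) * (B * η') := integral_mul_const _ _
      _ ≤ 1 * (B * η') := mul_le_mul_of_nonneg_right hi (by positivity)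
      _ < η := by
        have : B * η' ≤ (B + 1) * η' := by gcongr; linarith
        have e : (B + 1) * η' = η / 2 := by simp only [η']; field_simp
        linarith
  have hlim := (key w _ h.memLp (hφ.fderiv_apply (tDir d))).add hsmall
  rw [add_zero] at hlim
  refine tendsto_nhds_unique hlim ((key wt φ h.memLp_deriv hφ).neg.congr fun n => ?_)
  rw [← h.integral_test (htest n)]
  have hθ2 : MemLp (fun z => deriv (θ n) z.2 * φ z) 2 (volume.restrict (stCylinder Ω 0 T)) := by
    have := hφ.smooth_mul (ζ := fun z : SpaceTime d => deriv (θ n) z.2)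
      (((contDiff_infty_iff_deriv.mp (hθ n)).2).comp contDiff_snd)
    exact this.memLp _
  have hθ3 : MemLp (fun z => θ n z.2 * fderiv ℝ φ z (tDir d)) 2
      (volume.restrict (stCylinder Ω 0 T)) :=
    ((hφ.fderiv_apply (tDir d)).smooth_mul (ζ := fun z : SpaceTime d => θ n z.2)
      ((hθ n).comp contDiff_snd)).memLp _
  rw [← integral_add (h.memLp.integrable_mul_two hθ3) (h.memLp.integrable_mul_two hθ2)]
  congr 1 with z
  rw [fderiv_mul_apply (φ := fun z : SpaceTime d => θ n z.2) ((hθ n).comp contDiff_snd) hφ.smooth,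
    fderiv_comp_snd_tDir (hθ n)]
  ring

/-- The primitive in time of `g`, for functions `g` that vanish for negative times. -/
noncomputable def timePrimitive (T : ℝ) (g : SpaceTime d → ℝ) (z : SpaceTime d) : ℝ :=
  ∫ σ in Ioc 0 T, g (z - σ • tDir d)

lemma isFiniteMeasure_stCylinder (hb : Bornology.IsBounded Ω) (a b : ℝ) :
    IsFiniteMeasure ((volume : Measure (SpaceTime d)).restrict (stCylinder Ω a b)) :=
  isFiniteMeasure_restrict_of_isBounded (hb.prod (Metric.isBounded_Ioo a b))

/-- A function with a weak time derivative in `L²` is the primitive of the derivative, started at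
the initial trace. -/
lemma ae_eq_timePrimitive {v vt : SpaceTime d → ℝ} {v₀ : Space d → ℝ}
    (h : HasWeakDeriv (stCylinder Ω 0 T) (tDir d) v vt) (hΩ : IsOpen Ω)
    (hb : Bornology.IsBounded Ω) (hT : 0 < T) (htr : HasTimeTrace Ω T v 0 v₀) :
    ∀ᵐ z ∂(volume.restrict (stCylinder Ω 0 T)),
      v z - v₀ z.1 = timePrimitive T ((stCylinder Ω 0 T).indicator vt) z := by
  have hD := isOpen_stCylinder hΩ 0 T
  have hfin := isFiniteMeasure_stCylinder hb 0 T
  have hw := h.sub (hasWeakDeriv_comp_fst hb htr.1)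
  simp only [sub_zero] at hw
  have hg : MemLp ((stCylinder Ω 0 T).indicator vt) 2 volume :=
    (memLp_indicator_iff_restrict hD.measurableSet).mpr h.memLp_deriv
  have hg1 : Integrable ((stCylinder Ω 0 T).indicator vt) :=
    (integrable_indicator_iff hD.measurableSet).mpr (h.memLp_deriv.integrable (by norm_num))
  have hs := integrable_shear (ν := volume.restrict (Ioc 0 T)) hg1 (measurable_smul_dir (tDir d))
  refine ae_eq_of_forall_test hD (hw.memLp.integrable (by norm_num))
    (hs.integral_prod_right.integrableOn) fun ψ hψ => ?_
  have hφ := isTest_testPrimitive hψ hT.le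
  have h1 := hw.integral_test_of_trace_zero hΩ hb hT htr.2 hφ
  have h2 : ∫ z in stCylinder Ω 0 T,
      (v z - v₀ z.1) * fderiv ℝ (testPrimitive T ψ) z (tDir d) =
      -∫ z in stCylinder Ω 0 T, (v z - v₀ z.1) * ψ z := by
    rw [← integral_neg]
    refine setIntegral_congr_fun hD.measurableSet fun z hz => ?_
    rw [fderiv_testPrimitive hψ hT.le hz.2.1.le, mul_neg]
  rw [h2, neg_inj] at h1
  rw [h1, hψ.setIntegral_mul, ← integral_indicator hD.measurableSet]
  have e1 : ∀ z, (stCylinder Ω 0 T).indicator (fun z => vt z * testPrimitive T ψ z) z =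
      ∫ σ in Ioc 0 T, (stCylinder Ω 0 T).indicator vt z * ψ (z + σ • tDir d) := by
    intro z
    rw [integral_const_mul, indicator_mul_left, testPrimitive,
      intervalIntegral.integral_of_le hT.le]
  have e2 : ∀ z, timePrimitive T ((stCylinder Ω 0 T).indicator vt) z * ψ z =
      ∫ σ in Ioc 0 T, ψ z * (stCylinder Ω 0 T).indicator vt (z - σ • tDir d) := by
    intro z
    rw [integral_const_mul, timePrimitive, mul_comm]
  simp_rw [e1, e2]
  have i1 := integrable_mul_shear (ν := volume.restrict (Ioc 0 T)) (hψ.memLp volume) hg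
    (measurable_smul_dir (tDir d))
  have i2 := integrable_mul_shear (ν := volume.restrict (Ioc 0 T)) hg (hψ.memLp volume)
    (measurable_smul_dir (-tDir d))
  simp only [smul_neg, sub_neg_eq_add] at i2
  refine (integral_integral_swap i2).symm.trans (Eq.trans ?_ (integral_integral_swap i1))
  refine integral_congr_ae (ae_of_all _ fun σ => ?_)
  simp only
  rw [← integral_sub_right_eq_self _ (σ • tDir d)]
  congr 1 with z
  rw [sub_add_cancel, mul_comm]

end

/-! ### The energy inequality at the initial time -/

section

variable {d : ℕ} {Ω : Set (Space d)} {T τ : ℝ}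

/-- The function `W` on the cylinder `Ω × (0, T)`, continued by the initial value `W₀` to negative
times and then delayed by `τ`. -/
noncomputable def delay {F : Type*} [AddCommGroup F] (Ω : Set (Space d)) (T τ : ℝ)
    (W₀ : Space d → F) (W : SpaceTime d → F) (z : SpaceTime d) : F :=
  (stCylinder Ω 0 T).indicator W (z - τ • tDir d) + if z.2 ≤ τ then W₀ z.1 else 0

lemma sub_smul_tDir_mem {z : SpaceTime d} :
    z - τ • tDir d ∈ stCylinder Ω 0 T ↔ z.1 ∈ Ω ∧ z.2 - τ ∈ Ioo 0 T := by
  simp [stCylinder, tDir, mem_prod]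

lemma sub_smul_tDir_notMem {z : SpaceTime d} (h : z.2 ≤ τ) :
    z - τ • tDir d ∉ stCylinder Ω 0 T := by
  rw [sub_smul_tDir_mem]
  rintro ⟨-, h1, -⟩
  linarith

lemma memLp_delay {F : Type*} [NormedAddCommGroup F] (hΩ : IsOpen Ω) {W₀ : Space d → F}
    {W : SpaceTime d → F} (hW : MemLp W 2 (volume.restrict (stCylinder Ω 0 T)))
    (hW₀ : MemLp W₀ 2 (volume.restrict Ω)) :
    MemLp (delay Ω T τ W₀ W) 2 (volume.restrict (stCylinder Ω 0 T)) := by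
  have hD := isOpen_stCylinder hΩ 0 T
  have h1 : MemLp ((stCylinder Ω 0 T).indicator W) 2 volume :=
    (memLp_indicator_iff_restrict hD.measurableSet).mpr hW
  have h2 := (h1.comp_measurePreserving
    (measurePreserving_sub_right volume (τ • tDir d))).restrict (stCylinder Ω 0 T)
  have h3 : MemLp (fun z : SpaceTime d => W₀ z.1) 2 (volume.restrict (stCylinder Ω 0 T)) := by
    rw [volume_stCylinder]
    exact hW₀.comp_fst _
  have h4 := h3.indicator (s := {z : SpaceTime d | z.2 ≤ τ})
    (measurableSet_le measurable_snd measurable_const)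
  refine (h2.add h4).congr_norm ?_ ?_
  · refine (h2.add h4).1.congr (ae_of_all _ fun z => ?_)
    simp [delay, indicator_apply]
  · refine ae_of_all _ fun z => ?_
    simp [delay, indicator_apply]

lemma norm_sq_delay {F : Type*} [NormedAddCommGroup F] (W₀ : Space d → F) (W : SpaceTime d → F)
    (z : SpaceTime d) : ‖delay Ω T τ W₀ W z‖ ^ 2 =
      (stCylinder Ω 0 T).indicator (fun z => ‖W z‖ ^ 2) (z - τ • tDir d) +
        (if z.2 ≤ τ then 1 else 0) * ‖W₀ z.1‖ ^ 2 := by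
  rw [delay]
  split_ifs with h
  · rw [indicator_of_notMem (sub_smul_tDir_notMem h), indicator_of_notMem (sub_smul_tDir_notMem h)]
    simp
  · by_cases hz : z - τ • tDir d ∈ stCylinder Ω 0 T
    · rw [indicator_of_mem hz, indicator_of_mem hz]; simp
    · rw [indicator_of_notMem hz, indicator_of_notMem hz]; simp

/-- The increment over a time step `τ` is the integral of the time derivative. -/
lemma ae_sub_delay {v vt : SpaceTime d → ℝ} {v₀ : Space d → ℝ}
    (h : HasWeakDeriv (stCylinder Ω 0 T) (tDir d) v vt) (hΩ : IsOpen Ω)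
    (hb : Bornology.IsBounded Ω) (htr : HasTimeTrace Ω T v 0 v₀) (hτ : τ ∈ Ioo 0 T) :
    ∀ᵐ z ∂(volume.restrict (stCylinder Ω 0 T)), v z - delay Ω T τ v₀ v z =
      timePrimitive τ ((stCylinder Ω 0 T).indicator vt) z := by
  have hT : 0 < T := hτ.1.trans hτ.2
  have hD := isOpen_stCylinder hΩ 0 T
  have hfin := isFiniteMeasure_stCylinder hb 0 T
  have h0 := ae_eq_timePrimitive h hΩ hb hT htr
  rw [ae_restrict_iff' hD.measurableSet] at h0 ⊢
  have hg1 : Integrable ((stCylinder Ω 0 T).indicator vt) :=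
    (integrable_indicator_iff hD.measurableSet).mpr (h.memLp_deriv.integrable (by norm_num))
  have hs := (integrable_shear (ν := volume.restrict (Ioc 0 (T + τ))) hg1
    (measurable_smul_dir (tDir d))).prod_left_ae
  have h0' := (measurePreserving_sub_right volume
    (τ • tDir d)).quasiMeasurePreserving.ae (p := fun z => z ∈ stCylinder Ω 0 T →
      v z - v₀ z.1 = timePrimitive T ((stCylinder Ω 0 T).indicator vt) z) h0
  filter_upwards [h0, h0', hs] with z h1 h2 h3 hz
  set g := (stCylinder Ω 0 T).indicator vt
  -- beyond the age of `z`, the extended time derivative vanishes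
  have hg0 : ∀ σ, z.2 ≤ σ → g (z - σ • tDir d) = 0 := fun σ hσ =>
    indicator_of_notMem (sub_smul_tDir_notMem hσ) _
  have hii : ∀ a b : ℝ, 0 ≤ a → a ≤ b → b ≤ T + τ →
      IntervalIntegrable (fun σ : ℝ => g (z - σ • tDir d)) volume a b := fun a b ha hab hb =>
    (intervalIntegrable_iff_integrableOn_Ioc_of_le hab).mpr
      (IntegrableOn.mono_set h3 (Ioc_subset_Ioc ha hb))
  have hTP : ∀ a, 0 ≤ a → timePrimitive a g z = ∫ σ in (0 : ℝ)..a, g (z - σ • tDir d) :=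
    fun a ha => by rw [timePrimitive, intervalIntegral.integral_of_le ha]
  have htail : ∀ a b, z.2 ≤ a → a ≤ b → ∫ σ in a..b, g (z - σ • tDir d) = 0 := fun a b ha hab => by
    rw [intervalIntegral.integral_of_le hab]
    exact setIntegral_eq_zero_of_forall_eq_zero fun σ hσ => hg0 σ (ha.trans hσ.1.le)
  have hzT : z.2 < T := hz.2.2
  have hτ0 := hτ.1
  have hτT := hτ.2
  have hsplit := intervalIntegral.integral_add_adjacent_intervals (hii 0 τ le_rfl hτ0.le
    (by linarith)) (hii τ T hτ0.le hτT.le (by linarith))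
  rw [delay]
  split_ifs with hc
  · rw [indicator_of_notMem (sub_smul_tDir_notMem hc), zero_add, h1 hz, hTP T hT.le, hTP τ hτ0.le,
      ← hsplit, htail τ T hc hτT.le, add_zero]
  · have hmem : z - τ • tDir d ∈ stCylinder Ω 0 T :=
      sub_smul_tDir_mem.mpr ⟨hz.1, by linarith [not_le.mp hc], by linarith⟩
    have e1 := h1 hz
    have e2 := h2 hmem
    rw [indicator_of_mem hmem, add_zero]
    have e3 : timePrimitive T g (z - τ • tDir d) = ∫ σ in τ..(T + τ), g (z - σ • tDir d) := by
      rw [timePrimitive, ← intervalIntegral.integral_of_le hT.le]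
      have := intervalIntegral.integral_comp_add_right (a := 0) (b := T)
        (fun σ : ℝ => g (z - σ • tDir d)) τ
      rw [zero_add] at this
      rw [← this]
      congr 1 with σ
      rw [add_comm σ τ, add_smul, sub_sub]
    have e4 := intervalIntegral.integral_add_adjacent_intervals (hii τ T hτ0.le hτT.le
      (by linarith)) (hii T (T + τ) hT.le (by linarith) le_rfl)
    rw [htail T (T + τ) hzT.le (by linarith), add_zero] at e4
    have e5 : (z - τ • tDir d).1 = z.1 := by simp [tDir]
    rw [e5, e3, ← e4] at e2
    rw [hTP T hT.le, ← hsplit] at e1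
    rw [hTP τ hτ0.le]
    linarith

lemma tendsto_average_right {k : ℝ → ℝ} (hk : Continuous k) :
    Tendsto (fun τ : ℝ => τ⁻¹ * ∫ σ in Ioc 0 τ, k σ) (𝓝[>] 0) (𝓝 (k 0)) := by
  have h1 : HasDerivAt (fun u : ℝ => ∫ σ in (0 : ℝ)..u, k σ) (k 0) 0 :=
    intervalIntegral.integral_hasDerivAt_right (hk.intervalIntegrable 0 0)
      hk.aestronglyMeasurable.stronglyMeasurableAtFilter hk.continuousAt
  have h2 := hasDerivAt_iff_tendsto_slope_zero.mp h1
  refine (h2.mono_left (nhdsWithin_mono _ fun x (hx : 0 < x) => hx.ne')).congr' ?_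
  filter_upwards [self_mem_nhdsWithin] with τ (hτ : 0 < τ)
  simp [intervalIntegral.integral_of_le hτ.le]

/-- Energy inequality for a quadratic energy `∫ ‖W(·, t)‖²` whose first variation in the direction of
past increments is represented by `G`. Since `W ↦ ‖W‖²` is convex, only backward increments are
needed, and the initial value enters through `W₀` alone: no continuity of `W` at time `0` has to be
known. -/
theorem energy_inequality {F : Type*} [NormedAddCommGroup F] [InnerProductSpace ℝ F]
    (hΩ : IsOpen Ω) (hb : Bornology.IsBounded Ω) (hT : 0 < T)
    {v vt : SpaceTime d → ℝ} {v₀ : Space d → ℝ}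
    (h : HasWeakDeriv (stCylinder Ω 0 T) (tDir d) v vt) (htr : HasTimeTrace Ω T v 0 v₀)
    {W₀ : Space d → F} {W : SpaceTime d → F} {G : SpaceTime d → ℝ} {χ : ℝ → ℝ}
    (hW : MemLp W 2 (volume.restrict (stCylinder Ω 0 T))) (hW₀ : MemLp W₀ 2 (volume.restrict Ω))
    (hG : MemLp G 2 (volume.restrict (stCylinder Ω 0 T)))
    (hχ : ContDiff ℝ ∞ χ) (hχ0 : ∀ t, 0 ≤ χ t)
    (H : ∀ τ ∈ Ioo 0 T, ∫ z in stCylinder Ω 0 T, χ z.2 * inner ℝ (W z) (W z - delay Ω T τ W₀ W z) =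
      ∫ z in stCylinder Ω 0 T, χ z.2 * G z * (v z - delay Ω T τ v₀ v z)) :
    -(∫ z in stCylinder Ω 0 T, deriv χ z.2 * ‖W z‖ ^ 2) - χ 0 * ∫ x in Ω, ‖W₀ x‖ ^ 2 ≤
      2 * ∫ z in stCylinder Ω 0 T, χ z.2 * G z * vt z := by
  have hD := isOpen_stCylinder hΩ 0 T
  have hfin := isFiniteMeasure_stCylinder hb 0 T
  have hχm : ∀ s, AEStronglyMeasurable (fun z : SpaceTime d => χ (z.2 + s))
      (volume.restrict (stCylinder Ω 0 T)) := fun s =>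
    (hχ.continuous.comp (by fun_prop : Continuous fun z : SpaceTime d =>
      z.2 + s)).aestronglyMeasurable
  obtain ⟨C, hC⟩ : ∃ C, ∀ t ∈ Icc 0 (T + T), |χ t| ≤ C :=
    isCompact_Icc.exists_bound_of_continuousOn hχ.continuous.continuousOn
  have hCb : ∀ s ∈ Icc 0 T, ∀ᵐ z ∂(volume.restrict (stCylinder Ω 0 T)), |χ (z.2 + s)| ≤ C :=
    fun s hs => ae_restrict_of_forall_mem hD.measurableSet fun z hz =>
      hC _ ⟨by linarith [hz.2.1, hs.1], by linarith [hz.2.2, hs.2]⟩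
  have hχm0 : AEStronglyMeasurable (fun z : SpaceTime d => χ z.2)
      (volume.restrict (stCylinder Ω 0 T)) := by simpa using hχm 0
  have hCb0 : ∀ᵐ z ∂(volume.restrict (stCylinder Ω 0 T)), |χ z.2| ≤ C := by
    simpa using hCb 0 ⟨le_rfl, hT.le⟩
  have hWs : Integrable (fun z => ‖W z‖ ^ 2) (volume.restrict (stCylinder Ω 0 T)) :=
    hW.integrable_norm_pow (by norm_num)
  have hχW : ∀ s ∈ Icc 0 T, Integrable (fun z => χ (z.2 + s) * ‖W z‖ ^ 2)
      (volume.restrict (stCylinder Ω 0 T)) := fun s hs => hWs.bdd_mul (c := C) (hχm s) (hCb s hs)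
  have hχW0 : Integrable (fun z => χ z.2 * ‖W z‖ ^ 2) (volume.restrict (stCylinder Ω 0 T)) := by
    simpa using hχW 0 ⟨le_rfl, hT.le⟩
  have hG' : MemLp ((stCylinder Ω 0 T).indicator fun z => χ z.2 * G z) 2 volume :=
    (memLp_indicator_iff_restrict hD.measurableSet).mpr (hG.bdd_mul_two hχm0 hCb0)
  have hg : MemLp ((stCylinder Ω 0 T).indicator vt) 2 volume :=
    (memLp_indicator_iff_restrict hD.measurableSet).mpr h.memLp_deriv
  -- the correlation of `χ G` with the delayed time derivative; its value at `0` is the right-hand side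
  let k : ℝ → ℝ := fun σ => ∫ z, (stCylinder Ω 0 T).indicator (fun z => χ z.2 * G z) z *
    (stCylinder Ω 0 T).indicator vt (z - σ • tDir d)
  have hk : Continuous k := (continuous_integral_mul_translate hG' hg).comp
    (by fun_prop : Continuous fun σ : ℝ => σ • tDir d)
  have hk0 : k 0 = ∫ z in stCylinder Ω 0 T, χ z.2 * G z * vt z := by
    rw [← integral_indicator hD.measurableSet]
    simp only [k]
    congr 1 with z
    rw [zero_smul, sub_zero]
    by_cases hz : z ∈ stCylinder Ω 0 T <;> simp [hz]
  -- the claim with difference quotients of step `τ` in place of the derivatives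
  have hkey : ∀ τ ∈ Ioo 0 T, -(∫ z in stCylinder Ω 0 T, τ⁻¹ * (χ (z.2 + τ) - χ z.2) * ‖W z‖ ^ 2) -
      (τ⁻¹ * ∫ t in Ioc 0 τ, χ t) * ∫ x in Ω, ‖W₀ x‖ ^ 2 ≤ 2 * (τ⁻¹ * ∫ σ in Ioc 0 τ, k σ) := by
    intro τ hτ
    have hdel : MemLp (delay Ω T τ W₀ W) 2 (volume.restrict (stCylinder Ω 0 T)) :=
      memLp_delay hΩ hW hW₀
    have hin : Integrable (fun z => χ z.2 * inner ℝ (W z) (W z - delay Ω T τ W₀ W z))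
        (volume.restrict (stCylinder Ω 0 T)) := by
      refine Integrable.bdd_mul (c := C) ?_ hχm0 hCb0
      have i1 := hW.norm.integrable_mul_two (hW.sub hdel).norm
      refine i1.mono' (hW.1.inner (hW.sub hdel).1) (ae_of_all _ fun z => ?_)
      exact norm_inner_le_norm _ _
    have hds : Integrable (fun z => χ z.2 * ‖delay Ω T τ W₀ W z‖ ^ 2)
        (volume.restrict (stCylinder Ω 0 T)) :=
      (hdel.integrable_norm_pow (by norm_num)).bdd_mul (c := C) hχm0 hCb0
    -- convexity: `‖a‖² - ‖b‖² ≤ 2 ⟪a, a - b⟫`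
    have a1 : (∫ z in stCylinder Ω 0 T, χ z.2 * ‖W z‖ ^ 2) -
        ∫ z in stCylinder Ω 0 T, χ z.2 * ‖delay Ω T τ W₀ W z‖ ^ 2 ≤
        2 * ∫ z in stCylinder Ω 0 T, χ z.2 * G z * (v z - delay Ω T τ v₀ v z) := by
      rw [← H τ hτ, ← integral_sub hχW0 hds, ← integral_const_mul]
      refine integral_mono (hχW0.sub hds) (hin.const_mul 2) fun z => ?_
      have : ‖W z‖ ^ 2 - ‖delay Ω T τ W₀ W z‖ ^ 2 ≤
          2 * inner ℝ (W z) (W z - delay Ω T τ W₀ W z) := by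
        rw [inner_sub_right, real_inner_self_eq_norm_sq]
        have := norm_sub_sq_real (W z) (delay Ω T τ W₀ W z)
        nlinarith [sq_nonneg ‖W z - delay Ω T τ W₀ W z‖]
      simp only
      nlinarith [hχ0 z.2]
    -- the delay is moved to the weight; times before `τ` see the initial value only
    have a2 : ∫ z in stCylinder Ω 0 T, χ z.2 * ‖delay Ω T τ W₀ W z‖ ^ 2 ≤
        (∫ z in stCylinder Ω 0 T, χ (z.2 + τ) * ‖W z‖ ^ 2) +
          (∫ t in Ioc 0 τ, χ t) * ∫ x in Ω, ‖W₀ x‖ ^ 2 := by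
      simp_rw [norm_sq_delay, mul_add]
      have hN : Integrable ((stCylinder Ω 0 T).indicator fun z => χ (z.2 + τ) * ‖W z‖ ^ 2) :=
        (integrable_indicator_iff hD.measurableSet).mpr (hχW τ ⟨hτ.1.le, hτ.2.le⟩)
      have hN2 := hN.comp_sub_right (τ • tDir d)
      have eN : ∀ z : SpaceTime d, (stCylinder Ω 0 T).indicator
          (fun z => χ (z.2 + τ) * ‖W z‖ ^ 2) (z - τ • tDir d) =
          χ z.2 * (stCylinder Ω 0 T).indicator (fun z => ‖W z‖ ^ 2) (z - τ • tDir d) := by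
        intro z
        rw [indicator_mul_right, Prod.snd_sub]
        simp [tDir]
      simp_rw [eN] at hN2
      have hI : Integrable (fun z : SpaceTime d =>
          χ z.2 * ((if z.2 ≤ τ then 1 else 0) * ‖W₀ z.1‖ ^ 2))
          (volume.restrict (stCylinder Ω 0 T)) := by
        refine Integrable.bdd_mul (c := C) ?_ hχm0 hCb0
        refine Integrable.bdd_mul (c := 1) ?_ ?_ ?_
        · rw [volume_stCylinder]
          exact (hW₀.integrable_norm_pow (by norm_num)).comp_fst _
        · exact (Measurable.ite (measurableSet_le measurable_snd measurable_const)
            measurable_const measurable_const).aestronglyMeasurable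
        · refine ae_of_all _ fun z => ?_
          split_ifs <;> simp
      rw [integral_add hN2.integrableOn hI]
      refine add_le_add ?_ (le_of_eq ?_)
      · calc _ ≤ ∫ z, χ z.2 * (stCylinder Ω 0 T).indicator (fun z => ‖W z‖ ^ 2)
              (z - τ • tDir d) := by
              refine setIntegral_le_integral hN2 (ae_of_all _ fun z => ?_)
              exact mul_nonneg (hχ0 _) (indicator_nonneg (fun _ _ => by positivity) _)
          _ = _ := by
              simp_rw [← eN]
              rw [integral_sub_right_eq_self, integral_indicator hD.measurableSet]
      · have e1 : ∀ z : SpaceTime d, χ z.2 * ((if z.2 ≤ τ then 1 else 0) * ‖W₀ z.1‖ ^ 2) =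
            ‖W₀ z.1‖ ^ 2 * (Iic τ).indicator χ z.2 := by
          intro z
          by_cases hc : z.2 ≤ τ <;> simp [hc, mul_comm]
        simp_rw [e1]
        rw [volume_stCylinder, integral_prod_mul (fun x => ‖W₀ x‖ ^ 2), mul_comm,
          setIntegral_indicator measurableSet_Iic]
        congr 3
        ext t
        simp only [mem_inter_iff, mem_Ioo, mem_Iic, mem_Ioc]
        exact ⟨fun h => ⟨h.1.1, h.2⟩, fun h => ⟨⟨h.1, h.2.trans_lt hτ.2⟩, h.2⟩⟩
    have a3 : ∫ z in stCylinder Ω 0 T, χ z.2 * G z * (v z - delay Ω T τ v₀ v z) =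
        ∫ σ in Ioc 0 τ, k σ := by
      have e1 : ∫ z in stCylinder Ω 0 T, χ z.2 * G z * (v z - delay Ω T τ v₀ v z) =
          ∫ z in stCylinder Ω 0 T, χ z.2 * G z *
            timePrimitive τ ((stCylinder Ω 0 T).indicator vt) z := by
        refine integral_congr_ae ?_
        filter_upwards [ae_sub_delay h hΩ hb htr hτ] with z hz
        rw [hz]
      rw [e1, ← integral_indicator hD.measurableSet]
      refine Eq.trans ?_ (integral_integral_swap (integrable_mul_shear
        (ν := volume.restrict (Ioc 0 τ)) hG' hg (measurable_smul_dir (tDir d)))).symm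
      congr 1 with z
      rw [integral_const_mul, indicator_mul_left, timePrimitive]
    have a4 : ∫ z in stCylinder Ω 0 T, τ⁻¹ * (χ (z.2 + τ) - χ z.2) * ‖W z‖ ^ 2 =
        τ⁻¹ * ((∫ z in stCylinder Ω 0 T, χ (z.2 + τ) * ‖W z‖ ^ 2) -
          ∫ z in stCylinder Ω 0 T, χ z.2 * ‖W z‖ ^ 2) := by
      rw [← integral_sub (hχW τ ⟨hτ.1.le, hτ.2.le⟩) hχW0, ← integral_const_mul]
      congr 1 with z
      ring
    rw [a4]
    rw [a3] at a1
    have hτi : 0 < τ⁻¹ := inv_pos.mpr hτ.1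
    nlinarith
  have hev : ∀ᶠ τ in 𝓝[>] (0 : ℝ), τ ∈ Ioo 0 T := Ioo_mem_nhdsGT hT
  have l1 : Tendsto (fun τ : ℝ => ∫ z in stCylinder Ω 0 T,
      τ⁻¹ * (χ (z.2 + τ) - χ z.2) * ‖W z‖ ^ 2) (𝓝[>] 0)
      (𝓝 (∫ z in stCylinder Ω 0 T, deriv χ z.2 * ‖W z‖ ^ 2)) := by
    obtain ⟨L, hL⟩ : ∃ L, ∀ t ∈ Icc 0 (T + T), ‖deriv χ t‖ ≤ L :=
      isCompact_Icc.exists_bound_of_continuousOn (hχ.continuous_deriv (by simp)).continuousOn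
    refine tendsto_integral_filter_of_dominated_convergence (fun z => L * ‖W z‖ ^ 2) ?_ ?_
      (hWs.const_mul L) ?_
    · refine Eventually.of_forall fun τ => ?_
      exact (((hχm τ).sub hχm0).const_mul _).mul hWs.1
    · filter_upwards [hev] with τ hτ
      refine ae_restrict_of_forall_mem hD.measurableSet fun z hz => ?_
      have := Convex.norm_image_sub_le_of_norm_deriv_le (𝕜 := ℝ) (f := χ) (s := Icc 0 (T + T))
        (x := z.2) (y := z.2 + τ) (fun t _ => hχ.differentiable (by simp) t) hL
        (convex_Icc _ _) ⟨hz.2.1.le, by linarith [hz.2.2]⟩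
        ⟨by linarith [hz.2.1, hτ.1], by linarith [hz.2.2, hτ.2]⟩
      rw [add_sub_cancel_left, Real.norm_of_nonneg hτ.1.le] at this
      rw [norm_mul, norm_mul, norm_pow, norm_norm, norm_inv, Real.norm_of_nonneg hτ.1.le]
      refine mul_le_mul_of_nonneg_right ?_ (by positivity)
      rw [inv_mul_le_iff₀ hτ.1, mul_comm τ]
      exact this
    · refine ae_of_all _ fun z => ?_
      have h1 := hasDerivAt_iff_tendsto_slope_zero.mp
        ((hχ.differentiable (by simp) z.2).hasDerivAt)
      have h2 := h1.mono_left (nhdsWithin_mono (0 : ℝ) (s := Ioi 0) fun x hx => ne_of_gt hx)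
      simpa [smul_eq_mul] using h2.mul_const (‖W z‖ ^ 2)
  have l2 := tendsto_average_right hχ.continuous
  have l3 := tendsto_average_right hk
  rw [← hk0]
  refine le_of_tendsto_of_tendsto (l1.neg.sub (l2.mul_const _)) (l3.const_mul 2) ?_
  filter_upwards [hev] with τ hτ
  exact hkey τ hτ

end

section

variable {d : ℕ} {Ω : Set (Space d)} {T τ : ℝ}

lemma HasWeakDeriv.aux_slice {i : Fin d} {v₀ dv₀ : Space d → ℝ}
    (h : HasWeakDeriv Ω (spaceDir i) v₀ dv₀) {φ : SpaceTime d → ℝ}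
    (hφ : IsTest (stCylinder Ω 0 T) φ) (t : ℝ) :
    ∫ x in Ω, v₀ x * fderiv ℝ φ (x, t) (xDir i) = -∫ x in Ω, dv₀ x * φ (x, t) := by
  have hcl : Topology.IsClosedEmbedding (fun x : Space d => ((x, t) : SpaceTime d)) :=
    Topology.IsClosedEmbedding.of_continuous_injective_isClosedMap (by fun_prop)
      (fun a b h => (Prod.ext_iff.mp h).1) (isClosedMap_prodMk_right t)
  have ht : IsTest Ω (fun x => φ (x, t)) := by
    refine ⟨hφ.smooth.comp (by fun_prop), hφ.compact.comp_isClosedEmbedding hcl, fun x hx => ?_⟩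
    have : tsupport (fun x => φ (x, t)) ⊆ (fun x : Space d => ((x, t) : SpaceTime d)) ⁻¹'
        tsupport φ := closure_minimal (fun x hx => subset_closure hx)
      ((isClosed_tsupport φ).preimage hcl.continuous)
    exact (hφ.subset (this hx)).1
  rw [← h.integral_test ht]
  congr 1 with x
  have h1 : HasFDerivAt (fun x : Space d => ((x, t) : SpaceTime d))
      (ContinuousLinearMap.inl ℝ (Space d) ℝ) x :=
    (hasFDerivAt_id x).prodMk (hasFDerivAt_const t x)
  have h2 := (hφ.smooth.differentiable (by simp) (x, t)).hasFDerivAt.comp x h1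
  have h3 : fderiv ℝ (fun x => φ (x, t)) x = (fderiv ℝ φ (x, t)).comp
      (ContinuousLinearMap.inl ℝ (Space d) ℝ) := h2.fderiv
  rw [h3]
  simp [xDir]

lemma HasWeakDeriv.delay {i : Fin d} {v₀ dv₀ : Space d → ℝ} {v dv : SpaceTime d → ℝ}
    (hΩ : IsOpen Ω) (h : HasWeakDeriv (stCylinder Ω 0 T) (xDir i) v dv)
    (h₀ : HasWeakDeriv Ω (spaceDir i) v₀ dv₀) :
    HasWeakDeriv (stCylinder Ω 0 T) (xDir i) (delay Ω T τ v₀ v) (delay Ω T τ dv₀ dv) := by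
  have hD := isOpen_stCylinder hΩ 0 T
  refine ⟨memLp_delay hΩ h.memLp h₀.memLp, memLp_delay hΩ h.memLp_deriv h₀.memLp_deriv,
    fun φ a b c => ?_⟩
  have hφ : IsTest (stCylinder Ω 0 T) φ := ⟨a, b, c⟩
  -- the part coming from positive times
  have p1 : ∀ (w ψ : SpaceTime d → ℝ), IsTest (stCylinder Ω 0 T) ψ →
      ∫ z in stCylinder Ω 0 T, (stCylinder Ω 0 T).indicator w (z - τ • tDir d) * ψ z =
        ∫ z in stCylinder Ω 0 T, w z * ψ (z + τ • tDir d) := by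
    intro w ψ hψ
    rw [hψ.setIntegral_mul, ← integral_indicator hD.measurableSet,
      ← integral_add_right_eq_self _ (τ • tDir d)]
    congr 1 with z
    rw [add_sub_cancel_right, indicator_mul_left]
  have hψ : IsTest (Ω ×ˢ univ) (fun z => φ (z + τ • tDir d)) := by
    refine ⟨a.comp (by fun_prop), b.comp_homeomorph (Homeomorph.addRight (τ • tDir d)),
      fun z hz => ⟨?_, trivial⟩⟩
    have : tsupport (fun z => φ (z + τ • tDir d)) ⊆ (fun z => z + τ • tDir d) ⁻¹' tsupport φ :=
      closure_minimal (fun x hx => subset_closure hx)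
        ((isClosed_tsupport φ).preimage (by fun_prop))
    simpa [tDir] using (c (this hz)).1
  have e1 := h.integral_test_cylinder hΩ hψ
  simp_rw [fderiv_comp_add_right] at e1
  -- the part coming from the initial value
  have m3 : ∀ {w : Space d → ℝ}, MemLp w 2 (volume.restrict Ω) →
      MemLp (fun z : SpaceTime d => if z.2 ≤ τ then w z.1 else 0) 2
        (volume.restrict (stCylinder Ω 0 T)) := by
    intro w hw
    have h3 : MemLp (fun z : SpaceTime d => w z.1) 2 (volume.restrict (stCylinder Ω 0 T)) := by
      rw [volume_stCylinder]
      exact hw.comp_fst _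
    exact h3.indicator (s := {z : SpaceTime d | z.2 ≤ τ})
      (measurableSet_le measurable_snd measurable_const)
  have m1 : ∀ {w : SpaceTime d → ℝ}, MemLp w 2 (volume.restrict (stCylinder Ω 0 T)) →
      MemLp (fun z => (stCylinder Ω 0 T).indicator w (z - τ • tDir d)) 2
        (volume.restrict (stCylinder Ω 0 T)) := fun hw =>
    (((memLp_indicator_iff_restrict hD.measurableSet).mpr hw).comp_measurePreserving
      (measurePreserving_sub_right volume (τ • tDir d))).restrict (stCylinder Ω 0 T)
  have e2 : ∫ z in stCylinder Ω 0 T, (if z.2 ≤ τ then v₀ z.1 else 0) * fderiv ℝ φ z (xDir i) =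
      -∫ z in stCylinder Ω 0 T, (if z.2 ≤ τ then dv₀ z.1 else 0) * φ z := by
    have i1 := (m3 h₀.memLp).integrable_mul_two ((hφ.fderiv_apply (xDir i)).memLp _)
    have i2 := (m3 h₀.memLp_deriv).integrable_mul_two (hφ.memLp _)
    rw [volume_stCylinder] at i1 i2 ⊢
    rw [integral_prod_symm _ i1, integral_prod_symm _ i2, ← integral_neg]
    congr 1 with t
    by_cases hc : t ≤ τ
    · simp only [hc, if_true]
      exact h₀.aux_slice hφ t
    · simp [hc]
  simp only [MFG.delay, add_mul]
  rw [integral_add ((m1 h.memLp).integrable_mul_two ((hφ.fderiv_apply (xDir i)).memLp _))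
      ((m3 h₀.memLp).integrable_mul_two ((hφ.fderiv_apply (xDir i)).memLp _)),
    integral_add ((m1 h.memLp_deriv).integrable_mul_two (hφ.memLp _))
      ((m3 h₀.memLp_deriv).integrable_mul_two (hφ.memLp _)), p1 _ _ (hφ.fderiv_apply (xDir i)),
    p1 _ _ hφ, e1, e2]
  ring

lemma delay_apply (W₀ : Space d → Space d) (W : SpaceTime d → Space d) (i : Fin d) (z : SpaceTime d) :
    delay Ω T τ W₀ W z i = delay Ω T τ (fun x => W₀ x i) (fun z => W z i) z := by
  simp only [delay]
  by_cases hz : z - τ • tDir d ∈ stCylinder Ω 0 T <;> by_cases hc : z.2 ≤ τ <;> simp [hz, hc]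

lemma memLp_space {α : Type*} {m : MeasurableSpace α} {μ : Measure α} {W : α → Space d}
    (h : ∀ i, MemLp (fun z => W z i) 2 μ) : MemLp W 2 μ :=
  MemLp.of_eval_piLp h

lemma IsH21.memLp_grad {D : Set (SpaceTime d)} {u ut : SpaceTime d → ℝ} {Du : SpaceTime d → Space d}
    {D2u : Fin d → Fin d → SpaceTime d → ℝ} (h : IsH21 D u ut Du D2u) :
    MemLp Du 2 (volume.restrict D) :=
  memLp_space fun i => (h.grad i).memLp_deriv

lemma IsH21.memLp_lap {D : Set (SpaceTime d)} {u ut : SpaceTime d → ℝ} {Du : SpaceTime d → Space d}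
    {D2u : Fin d → Fin d → SpaceTime d → ℝ} (h : IsH21 D u ut Du D2u) :
    MemLp (lap D2u) 2 (volume.restrict D) := by
  have := memLp_finsetSum (p := 2) (μ := volume.restrict D) Finset.univ
    (f := fun i z => D2u i i z) fun i _ => (h.hess i i).memLp_deriv
  exact this

lemma IsH1.memLp_grad {g : Space d → ℝ} {Dg : Space d → Space d} (h : IsH1 Ω g Dg) :
    MemLp Dg 2 (volume.restrict Ω) :=
  memLp_space fun i => (h.grad i).memLp_deriv

lemma real_inner_space (x y : Space d) : inner ℝ x y = ∑ i, x i * y i := by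
  rw [PiLp.inner_apply]
  exact Finset.sum_congr rfl fun i _ => by simp [mul_comm]

section Energy

variable {u ut : SpaceTime d → ℝ} {Du : SpaceTime d → Space d}
  {D2u : Fin d → Fin d → SpaceTime d → ℝ} {u₀ : Space d → ℝ} {χ : ℝ → ℝ}

/-- A bound for a smooth function of time and its space derivatives on a cylinder. -/
lemma exists_bound_comp_snd (hχ : ContDiff ℝ ∞ χ) (Ω : Set (Space d)) (a b : ℝ) :
    ∃ C, (∀ z ∈ stCylinder Ω a b, |χ z.2| ≤ C) ∧
      ∀ i, ∀ z ∈ stCylinder Ω a b, |fderiv ℝ (fun z : SpaceTime d => χ z.2) z (xDir i)| ≤ C := by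
  obtain ⟨C, hC⟩ : ∃ C, ∀ t ∈ Icc a b, ‖χ t‖ ≤ C :=
    isCompact_Icc.exists_bound_of_continuousOn hχ.continuous.continuousOn
  have h1 : ∀ z ∈ stCylinder Ω a b, |χ z.2| ≤ C := fun z hz => hC _ (Ioo_subset_Icc_self hz.2)
  refine ⟨C, h1, fun i z hz => ?_⟩
  rw [fderiv_comp_snd_xDir hχ, abs_zero]
  exact (abs_nonneg _).trans (h1 z hz)

/-- Testing the Neumann condition with `χ(t) w`. -/
lemma NeumannZero.integral_smooth_mul (hN : NeumannZero Ω T Du D2u) (hΩ : IsOpen Ω)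
    (hχ : ContDiff ℝ ∞ χ) {w : SpaceTime d → ℝ} {Dw : SpaceTime d → Space d}
    (hw : ∀ i, HasWeakDeriv (stCylinder Ω 0 T) (xDir i) w (fun z => Dw z i)) :
    ∫ z in stCylinder Ω 0 T, (χ z.2 * (lap D2u z * w z) + χ z.2 * inner ℝ (Du z) (Dw z)) = 0 := by
  obtain ⟨C, hC, hC'⟩ := exists_bound_comp_snd hχ Ω 0 T
  have := hN (fun z => χ z.2 * w z) (fun z => χ z.2 • Dw z) fun i => by
    have h1 := (hw i).smooth_mul (isOpen_stCylinder hΩ 0 T).measurableSet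
      (ζ := fun z : SpaceTime d => χ z.2) (hχ.comp contDiff_snd) hC (hC' i)
    simp only [fderiv_comp_snd_xDir hχ, zero_mul, add_zero] at h1
    simpa using h1
  refine Eq.trans ?_ this
  congr 1 with z
  rw [real_inner_space, Finset.mul_sum]
  congr 1
  · ring
  · refine Finset.sum_congr rfl fun i _ => ?_
    simp only [PiLp.smul_apply, smul_eq_mul]
    ring

lemma integrable_inner_two {α : Type*} {m : MeasurableSpace α} {μ : Measure α} {V W : α → Space d}
    (hV : MemLp V 2 μ) (hW : MemLp W 2 μ) : Integrable (fun z => inner ℝ (V z) (W z)) μ :=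
  (hV.norm.integrable_mul_two hW.norm).mono' (hV.1.inner hW.1)
    (ae_of_all _ fun _ => norm_inner_le_norm _ _)

lemma integrable_smooth_mul {f : SpaceTime d → ℝ} (hΩ : IsOpen Ω) (hχ : ContDiff ℝ ∞ χ)
    (hf : Integrable f (volume.restrict (stCylinder Ω 0 T))) :
    Integrable (fun z => χ z.2 * f z) (volume.restrict (stCylinder Ω 0 T)) := by
  obtain ⟨C, hC, -⟩ := exists_bound_comp_snd hχ Ω 0 T
  exact hf.bdd_mul (c := C) (hχ.continuous.comp continuous_snd).aestronglyMeasurable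
    (ae_restrict_of_forall_mem (isOpen_stCylinder hΩ 0 T).measurableSet hC)

lemma memLp_smooth_mul {f : SpaceTime d → ℝ} (hΩ : IsOpen Ω) (hχ : ContDiff ℝ ∞ χ)
    (hf : MemLp f 2 (volume.restrict (stCylinder Ω 0 T))) :
    MemLp (fun z => χ z.2 * f z) 2 (volume.restrict (stCylinder Ω 0 T)) := by
  obtain ⟨C, hC, -⟩ := exists_bound_comp_snd hχ Ω 0 T
  exact hf.bdd_mul_two (hχ.continuous.comp continuous_snd).aestronglyMeasurable
    (ae_restrict_of_forall_mem (isOpen_stCylinder hΩ 0 T).measurableSet hC)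

lemma NeumannZero.integral_lap_mul (hN : NeumannZero Ω T Du D2u) (hΩ : IsOpen Ω)
    (hu : IsH21 (stCylinder Ω 0 T) u ut Du D2u)
    (hχ : ContDiff ℝ ∞ χ) {w : SpaceTime d → ℝ} {Dw : SpaceTime d → Space d}
    (hw : ∀ i, HasWeakDeriv (stCylinder Ω 0 T) (xDir i) w (fun z => Dw z i))
    (hwm : MemLp w 2 (volume.restrict (stCylinder Ω 0 T))) :
    ∫ z in stCylinder Ω 0 T, χ z.2 * (lap D2u z * w z) =
      -∫ z in stCylinder Ω 0 T, χ z.2 * inner ℝ (Du z) (Dw z) := by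
  have h := hN.integral_smooth_mul hΩ hχ hw
  have hDw : MemLp Dw 2 (volume.restrict (stCylinder Ω 0 T)) :=
    memLp_space fun i => (hw i).memLp_deriv
  rw [integral_add] at h
  · linarith
  · exact integrable_smooth_mul hΩ hχ (hu.memLp_lap.integrable_mul_two hwm)
  · exact integrable_smooth_mul hΩ hχ (integrable_inner_two hu.memLp_grad hDw)

/-- Energy inequality for `‖u(·, t)‖²`. -/
theorem IsH21.energy_l2 (hu : IsH21 (stCylinder Ω 0 T) u ut Du D2u) (hΩ : IsOpen Ω)
    (hb : Bornology.IsBounded Ω) (hT : 0 < T) (htr : HasTimeTrace Ω T u 0 u₀)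
    (hχ : ContDiff ℝ ∞ χ) (hχ0 : ∀ t, 0 ≤ χ t) :
    -(∫ z in stCylinder Ω 0 T, deriv χ z.2 * u z ^ 2) - χ 0 * ∫ x in Ω, u₀ x ^ 2 ≤
      2 * ∫ z in stCylinder Ω 0 T, χ z.2 * (u z * ut z) := by
  have h := energy_inequality hΩ hb hT hu.time htr hu.time.memLp htr.1 hu.time.memLp hχ hχ0
    fun τ _ => by
      congr 1 with z
      simp only [RCLike.inner_apply, conj_trivial]
      ring
  simpa [mul_assoc] using h

/-- Energy inequality for `‖∇u(·, t)‖²` under the Neumann condition. -/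
theorem IsH21.energy_grad (hu : IsH21 (stCylinder Ω 0 T) u ut Du D2u)
    (hN : NeumannZero Ω T Du D2u) (hΩ : IsOpen Ω)
    (hb : Bornology.IsBounded Ω) (hT : 0 < T) (htr : HasTimeTrace Ω T u 0 u₀)
    {Du₀ : Space d → Space d} (hu₀ : IsH1 Ω u₀ Du₀)
    (hχ : ContDiff ℝ ∞ χ) (hχ0 : ∀ t, 0 ≤ χ t) :
    -(∫ z in stCylinder Ω 0 T, deriv χ z.2 * ‖Du z‖ ^ 2) - χ 0 * ∫ x in Ω, ‖Du₀ x‖ ^ 2 ≤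
      -(2 * ∫ z in stCylinder Ω 0 T, χ z.2 * (lap D2u z * ut z)) := by
  have h := energy_inequality hΩ hb hT hu.time htr hu.memLp_grad hu₀.memLp_grad
    hu.memLp_lap.neg hχ hχ0 fun τ _ => by
      have hd : ∀ i, HasWeakDeriv (stCylinder Ω 0 T) (xDir i)
          (fun z => u z - delay Ω T τ u₀ u z) (fun z => (Du z - delay Ω T τ Du₀ Du z) i) := by
        intro i
        have h1 := (hu.grad i).sub ((hu.grad i).delay (τ := τ) hΩ (hu₀.grad i))
        simpa [delay_apply] using h1
      have := hN.integral_lap_mul hΩ hu hχ hd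
        (hu.time.memLp.sub (memLp_delay hΩ hu.time.memLp htr.1))
      rw [← neg_eq_iff_eq_neg] at this
      rw [← this, ← integral_neg]
      congr 1 with z
      simp only [Pi.neg_apply]
      ring
  have e : ∫ z in stCylinder Ω 0 T, χ z.2 * (-lap D2u) z * ut z =
      -∫ z in stCylinder Ω 0 T, χ z.2 * (lap D2u z * ut z) := by
    rw [← integral_neg]
    congr 1 with z
    simp only [Pi.neg_apply]
    ring
  rw [e] at h
  linarith

end Energy

end

/-! ### Time reversal and the energy inequalities at the final time -/

section

variable {d : ℕ} {Ω : Set (Space d)} {T : ℝ}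

/-- The reflection `(x, t) ↦ (x, T - t)`. -/
def timeRev (T : ℝ) (z : SpaceTime d) : SpaceTime d := (z.1, T - z.2)

lemma timeRev_timeRev (z : SpaceTime d) : timeRev T (timeRev T z) = z := by
  simp [timeRev]

lemma contDiff_timeRev : ContDiff ℝ ∞ (timeRev T : SpaceTime d → SpaceTime d) := by
  unfold timeRev
  fun_prop

lemma timeRev_mem {z : SpaceTime d} : timeRev T z ∈ stCylinder Ω 0 T ↔ z ∈ stCylinder Ω 0 T := by
  simp only [timeRev, stCylinder, mem_prod, mem_Ioo]
  constructor <;> rintro ⟨h1, h2, h3⟩ <;> exact ⟨h1, by linarith, by linarith⟩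

lemma measurePreserving_timeRev :
    MeasurePreserving (timeRev T : SpaceTime d → SpaceTime d) volume volume :=
  (MeasurePreserving.id volume).prod (Measure.measurePreserving_sub_left volume T)

/-- The reflection in time as a homeomorphism. -/
def timeRevHomeomorph (T : ℝ) : SpaceTime d ≃ₜ SpaceTime d where
  toFun := timeRev T
  invFun := timeRev T
  left_inv := timeRev_timeRev
  right_inv := timeRev_timeRev
  continuous_toFun := contDiff_timeRev.continuous
  continuous_invFun := contDiff_timeRev.continuous

lemma measurePreserving_timeRev_restrict (hΩ : IsOpen Ω) :
    MeasurePreserving (timeRev T : SpaceTime d → SpaceTime d)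
      (volume.restrict (stCylinder Ω 0 T)) (volume.restrict (stCylinder Ω 0 T)) := by
  have h := (measurePreserving_timeRev (d := d) (T := T)).restrict_preimage
    (isOpen_stCylinder hΩ 0 T).measurableSet
  have e : timeRev T ⁻¹' stCylinder Ω 0 T = stCylinder Ω 0 T := by
    ext z
    exact timeRev_mem
  rwa [e] at h

lemma integral_timeRev (hΩ : IsOpen Ω) (f : SpaceTime d → ℝ) :
    ∫ z in stCylinder Ω 0 T, f (timeRev T z) = ∫ z in stCylinder Ω 0 T, f z :=
  (measurePreserving_timeRev_restrict hΩ).integral_comp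
    (timeRevHomeomorph T).measurableEmbedding f

lemma fderiv_comp_timeRev {φ : SpaceTime d → ℝ} (hφ : ContDiff ℝ ∞ φ) (z e : SpaceTime d) :
    fderiv ℝ (fun z => φ (timeRev T z)) z e = fderiv ℝ φ (timeRev T z) (e.1, -e.2) := by
  have h1 : HasFDerivAt (timeRev T : SpaceTime d → SpaceTime d)
      ((ContinuousLinearMap.fst ℝ (Space d) ℝ).prod
        (-(ContinuousLinearMap.snd ℝ (Space d) ℝ))) z :=
    hasFDerivAt_fst.prodMk (hasFDerivAt_snd.const_sub T)
  have h2 := (hφ.differentiable (by simp) (timeRev T z)).hasFDerivAt.comp z h1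
  have h3 : fderiv ℝ (fun z => φ (timeRev T z)) z = _ := h2.fderiv
  rw [h3]
  simp

lemma IsTest.timeRev {φ : SpaceTime d → ℝ} (h : IsTest (stCylinder Ω 0 T) φ) :
    IsTest (stCylinder Ω 0 T) (fun z => φ (timeRev T z)) := by
  refine ⟨h.smooth.comp contDiff_timeRev, h.compact.comp_homeomorph (timeRevHomeomorph T),
    fun z hz => ?_⟩
  have : tsupport (fun z => φ (MFG.timeRev T z)) ⊆ MFG.timeRev T ⁻¹' tsupport φ :=
    closure_minimal (fun x hx => subset_closure hx)
      ((isClosed_tsupport φ).preimage contDiff_timeRev.continuous)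
  exact timeRev_mem.mp (h.subset (this hz))

lemma HasWeakDeriv.timeRev {e : SpaceTime d} {f g : SpaceTime d → ℝ} (hΩ : IsOpen Ω)
    (h : HasWeakDeriv (stCylinder Ω 0 T) e f g) :
    HasWeakDeriv (stCylinder Ω 0 T) (e.1, -e.2) (fun z => f (timeRev T z))
      (fun z => g (timeRev T z)) := by
  have hp := measurePreserving_timeRev_restrict (T := T) hΩ
  refine ⟨h.memLp.comp_measurePreserving hp, h.memLp_deriv.comp_measurePreserving hp,
    fun φ a b c => ?_⟩
  have hφ : IsTest (stCylinder Ω 0 T) φ := ⟨a, b, c⟩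
  have h1 := h.integral_test hφ.timeRev
  rw [← integral_timeRev hΩ, ← integral_timeRev hΩ (fun z => g z * _)] at h1
  simp_rw [fderiv_comp_timeRev a, timeRev_timeRev] at h1
  exact h1

lemma HasWeakDeriv.timeRev_xDir {i : Fin d} {f g : SpaceTime d → ℝ} (hΩ : IsOpen Ω)
    (h : HasWeakDeriv (stCylinder Ω 0 T) (xDir i) f g) :
    HasWeakDeriv (stCylinder Ω 0 T) (xDir i) (fun z => f (MFG.timeRev T z))
      (fun z => g (MFG.timeRev T z)) := by
  have := h.timeRev hΩ
  simpa [xDir] using this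

lemma HasWeakDeriv.timeRev_tDir {f g : SpaceTime d → ℝ} (hΩ : IsOpen Ω)
    (h : HasWeakDeriv (stCylinder Ω 0 T) (tDir d) f g) :
    HasWeakDeriv (stCylinder Ω 0 T) (tDir d) (fun z => f (MFG.timeRev T z))
      (fun z => -g (MFG.timeRev T z)) := by
  have h1 := h.timeRev hΩ
  have e : ((tDir d).1, -(tDir d).2) = -tDir d := by simp [tDir]
  rw [e] at h1
  refine ⟨h1.memLp, h1.memLp_deriv.neg, fun φ a b c => ?_⟩
  have h2 := h1.integral_eq φ a b c
  simp only [map_neg, mul_neg, integral_neg] at h2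
  simp only [neg_mul, integral_neg]
  linarith

lemma IsH21.timeRev {u ut : SpaceTime d → ℝ} {Du : SpaceTime d → Space d}
    {D2u : Fin d → Fin d → SpaceTime d → ℝ} (hΩ : IsOpen Ω)
    (h : IsH21 (stCylinder Ω 0 T) u ut Du D2u) :
    IsH21 (stCylinder Ω 0 T) (fun z => u (MFG.timeRev T z)) (fun z => -ut (MFG.timeRev T z))
      (fun z => Du (MFG.timeRev T z)) (fun i j z => D2u i j (MFG.timeRev T z)) :=
  ⟨h.time.timeRev_tDir hΩ, fun i => (h.grad i).timeRev_xDir hΩ,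
    fun i j => (h.hess i j).timeRev_xDir hΩ⟩

lemma NeumannZero.timeRev {Du : SpaceTime d → Space d}
    {D2u : Fin d → Fin d → SpaceTime d → ℝ} (hΩ : IsOpen Ω) (h : NeumannZero Ω T Du D2u) :
    NeumannZero Ω T (fun z => Du (MFG.timeRev T z)) (fun i j z => D2u i j (MFG.timeRev T z)) := by
  intro φ Dφ hφ
  have h1 := h (fun z => φ (MFG.timeRev T z)) (fun z => Dφ (MFG.timeRev T z))
    fun i => (hφ i).timeRev_xDir hΩ
  rw [← integral_timeRev hΩ] at h1
  simp_rw [timeRev_timeRev] at h1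
  exact h1

lemma HasTimeTrace.timeRev {u : SpaceTime d → ℝ} {g : Space d → ℝ} (h : HasTimeTrace Ω T u T g) :
    HasTimeTrace Ω T (fun z => u (MFG.timeRev T z)) 0 g := by
  refine ⟨h.1, h.2.comp (x := ae (volume.restrict (Ioo 0 T)) ⊓ 𝓝 0) (f := fun t => T - t) ?_⟩
  have hp : MeasurePreserving (fun t : ℝ => T - t) (volume.restrict (Ioo 0 T))
      (volume.restrict (Ioo 0 T)) := by
    have h1 := (Measure.measurePreserving_sub_left (volume : Measure ℝ) T).restrict_preimage
      (measurableSet_Ioo (a := 0) (b := T))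
    rwa [preimage_const_sub_Ioo, sub_self, sub_zero] at h1
  refine Filter.Tendsto.inf hp.quasiMeasurePreserving.tendsto_ae ?_
  have : Tendsto (fun t : ℝ => T - t) (𝓝 0) (𝓝 (T - 0)) := (by fun_prop :
    Continuous fun t : ℝ => T - t).tendsto 0
  rwa [sub_zero] at this

variable {u ut : SpaceTime d → ℝ} {Du : SpaceTime d → Space d}
  {D2u : Fin d → Fin d → SpaceTime d → ℝ} {uT : Space d → ℝ} {χ : ℝ → ℝ}

lemma deriv_comp_const_sub_apply (χ : ℝ → ℝ) (T t : ℝ) :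
    deriv (fun t => χ (T - t)) t = -deriv χ (T - t) := deriv_comp_const_sub ..

theorem IsH21.energy_l2_final (hu : IsH21 (stCylinder Ω 0 T) u ut Du D2u) (hΩ : IsOpen Ω)
    (hb : Bornology.IsBounded Ω) (hT : 0 < T) (htr : HasTimeTrace Ω T u T uT)
    (hχ : ContDiff ℝ ∞ χ) (hχ0 : ∀ t, 0 ≤ χ t) :
    2 * (∫ z in stCylinder Ω 0 T, χ z.2 * (u z * ut z)) ≤
      χ T * (∫ x in Ω, uT x ^ 2) - ∫ z in stCylinder Ω 0 T, deriv χ z.2 * u z ^ 2 := by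
  have h := (hu.timeRev hΩ).energy_l2 hΩ hb hT htr.timeRev (χ := fun t => χ (T - t))
    (hχ.comp (by fun_prop)) (fun t => hχ0 _)
  have e1 := integral_timeRev (T := T) hΩ (fun z => χ z.2 * (u z * ut z))
  have e2 := integral_timeRev (T := T) hΩ (fun z => deriv χ z.2 * u z ^ 2)
  simp only [deriv_comp_const_sub_apply, neg_mul, mul_neg, integral_neg, sub_zero, neg_neg] at h
  simp only [MFG.timeRev] at e1 e2 h
  rw [e1, e2] at h
  linarith

theorem IsH21.energy_grad_final (hu : IsH21 (stCylinder Ω 0 T) u ut Du D2u)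
    (hN : NeumannZero Ω T Du D2u) (hΩ : IsOpen Ω)
    (hb : Bornology.IsBounded Ω) (hT : 0 < T) (htr : HasTimeTrace Ω T u T uT)
    {DuT : Space d → Space d} (huT : IsH1 Ω uT DuT)
    (hχ : ContDiff ℝ ∞ χ) (hχ0 : ∀ t, 0 ≤ χ t) :
    (∫ z in stCylinder Ω 0 T, deriv χ z.2 * ‖Du z‖ ^ 2) - χ T * (∫ x in Ω, ‖DuT x‖ ^ 2) ≤
      2 * ∫ z in stCylinder Ω 0 T, χ z.2 * (lap D2u z * ut z) := by
  have h := (hu.timeRev hΩ).energy_grad (hN.timeRev hΩ) hΩ hb hT htr.timeRev huT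
    (χ := fun t => χ (T - t)) (hχ.comp (by fun_prop)) (fun t => hχ0 _)
  have e1 := integral_timeRev (T := T) hΩ (fun z => χ z.2 * (lap D2u z * ut z))
  have e2 := integral_timeRev (T := T) hΩ (fun z => deriv χ z.2 * ‖Du z‖ ^ 2)
  have e3 : ∀ z, lap (fun i j z => D2u i j (MFG.timeRev T z)) z = lap D2u (MFG.timeRev T z) :=
    fun _ => rfl
  simp only [deriv_comp_const_sub_apply, neg_mul, mul_neg, integral_neg, sub_zero, neg_neg,
    e3] at h
  simp only [MFG.timeRev] at e1 e2 h
  rw [e1, e2] at h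
  linarith

end

/-! ### Tangential derivatives near the boundary -/

section

section

variable {X : Type*} [NormedAddCommGroup X] [NormedSpace ℝ X]

lemma fderiv_fderiv_comm {φ : X → ℝ} (hφ : ContDiff ℝ ∞ φ) (z e e' : X) :
    fderiv ℝ (fun z => fderiv ℝ φ z e) z e' = fderiv ℝ (fun z => fderiv ℝ φ z e') z e := by
  have hd : DifferentiableAt ℝ (fderiv ℝ φ) z :=
    (hφ.fderiv_right (m := ∞) (by simp)).differentiable (by simp) z
  have h1 : ∀ e e' : X, fderiv ℝ (fun z => fderiv ℝ φ z e) z e' =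
      fderiv ℝ (fderiv ℝ φ) z e' e := by
    intro e e'
    rw [fderiv_clm_apply hd (differentiableAt_const e)]
    simp
  rw [h1, h1]
  have h2 : ContDiff ℝ 2 φ := contDiff_infty.mp hφ 2
  exact (h2.contDiffAt.isSymmSndFDerivAt (by simp)) e' e

/-- A smooth function with values in `[0, 1]` of a defining function `R`, that vanishes where
`R > -1/n` and is `1` where `R < -2/n`. -/
noncomputable def defCutoff (R : X → ℝ) (n : ℕ) (z : X) : ℝ :=
  Real.smoothTransition (-(n * R z) - 1)

lemma contDiff_defCutoff {R : X → ℝ} (hR : ContDiff ℝ ∞ R) (n : ℕ) :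
    ContDiff ℝ ∞ (defCutoff R n) :=
  Real.smoothTransition.contDiff.comp ((contDiff_const.mul hR).neg.sub contDiff_const)

lemma fderiv_defCutoff {R : X → ℝ} (hR : ContDiff ℝ ∞ R) (n : ℕ) (z : X) :
    ∃ c : ℝ, ∀ e, fderiv ℝ (defCutoff R n) z e = c * fderiv ℝ R z e := by
  have h1 : HasFDerivAt (fun z => -(n * R z) - 1) (-((n : ℝ) • fderiv ℝ R z)) z :=
    (((hR.differentiable (by simp) z).hasFDerivAt.const_mul (n : ℝ)).neg).sub_const 1
  have h2 := ((Real.smoothTransition.contDiff (n := 1)).differentiable (by simp)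
    (-(n * R z) - 1)).hasFDerivAt.comp z h1
  have h3 : fderiv ℝ (defCutoff R n) z = _ := h2.fderiv
  refine ⟨-(n * deriv Real.smoothTransition (-(n * R z) - 1)), fun e => ?_⟩
  rw [h3]
  simp
  ring

variable {D U : Set X} {R : X → ℝ}

lemma IsTest.defCutoff_mul {ψ : X → ℝ} (hψ : IsTest U ψ) (hR : ContDiff ℝ ∞ R)
    (hU : ∀ z ∈ U, (z ∈ D ↔ R z < 0)) (n : ℕ) : IsTest D (fun z => defCutoff R n z * ψ z) := by
  have h := hψ.smooth_mul (contDiff_defCutoff hR n)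
  refine ⟨h.smooth, h.compact, fun z hz => ?_⟩
  have h1 : tsupport (defCutoff R n) ⊆ {z | n * R z ≤ -1} := by
    refine closure_minimal (fun z hz => ?_)
      (isClosed_le (continuous_const.mul hR.continuous) continuous_const)
    by_contra hc
    simp only [mem_ofPred_eq, not_le] at hc
    exact hz (Real.smoothTransition.zero_of_nonpos (by linarith))
  have h2 : n * R z ≤ -1 := h1 (tsupport_mul_subset_left hz)
  rw [hU z (h.subset hz)]
  by_contra hc
  nlinarith [Nat.cast_nonneg (α := ℝ) n]

variable [MeasureSpace X] [BorelSpace X] [(volume : Measure X).IsAddHaarMeasure]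

/-- Integration by parts for the vector field `N_a ∂_b - N_b ∂_a`, where `N` is the differential of a
defining function `R` of `D`. The field is divergence free and tangential to the level sets of
`R`, so that no boundary terms arise although `ψ` need not vanish on the boundary of `D`. -/
lemma integral_tangential {a b : X} {h ha hb : X → ℝ} (hD : IsOpen D)
    (wa : HasWeakDeriv D a h ha) (wb : HasWeakDeriv D b h hb) (hR : ContDiff ℝ ∞ R)
    (hU : ∀ z ∈ U, (z ∈ D ↔ R z < 0)) {ψ : X → ℝ} (hψ : IsTest U ψ) :
    ∫ z in D, h z * (fderiv ℝ R z a * fderiv ℝ ψ z b - fderiv ℝ R z b * fderiv ℝ ψ z a) =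
      -∫ z in D, (fderiv ℝ R z a * hb z - fderiv ℝ R z b * ha z) * ψ z := by
  have hNa := contDiff_fderiv_apply hR a
  have hNb := contDiff_fderiv_apply hR b
  have hψ' : IsTest univ ψ := hψ.mono (subset_univ U)
  -- truncated identity
  have trunc : ∀ n, ∫ z in D, h z * (defCutoff R n z *
      (fderiv ℝ R z a * fderiv ℝ ψ z b - fderiv ℝ R z b * fderiv ℝ ψ z a)) =
      -∫ z in D, (fderiv ℝ R z a * hb z - fderiv ℝ R z b * ha z) * (defCutoff R n z * ψ z) := by
    intro n
    have ht := hψ.defCutoff_mul hR hU n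
    have hκ := contDiff_defCutoff hR n
    have t1 := ht.smooth_mul hNa
    have t2 := ht.smooth_mul hNb
    have e1 := wb.integral_test t1
    have e2 := wa.integral_test t2
    have i1 := wb.memLp.integrable_mul_two ((t1.fderiv_apply b).memLp (volume.restrict D))
    have i2 := wa.memLp.integrable_mul_two ((t2.fderiv_apply a).memLp (volume.restrict D))
    have i3 := wb.memLp_deriv.integrable_mul_two (t1.memLp (volume.restrict D))
    have i4 := wa.memLp_deriv.integrable_mul_two (t2.memLp (volume.restrict D))
    have e3 : ∫ z in D, h z * (defCutoff R n z *
        (fderiv ℝ R z a * fderiv ℝ ψ z b - fderiv ℝ R z b * fderiv ℝ ψ z a)) =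
        ∫ z in D, (h z * fderiv ℝ (fun z => fderiv ℝ R z a * (defCutoff R n z * ψ z)) z b -
          h z * fderiv ℝ (fun z => fderiv ℝ R z b * (defCutoff R n z * ψ z)) z a) := by
      congr 1 with z
      rw [fderiv_mul_apply hNa ht.smooth, fderiv_mul_apply hNb ht.smooth,
        fderiv_mul_apply hκ hψ.smooth, fderiv_mul_apply hκ hψ.smooth, fderiv_fderiv_comm hR z a b]
      obtain ⟨c, hc⟩ := fderiv_defCutoff hR n z
      rw [hc, hc]
      ring
    have e4 : ∫ z in D, (fderiv ℝ R z a * hb z - fderiv ℝ R z b * ha z) *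
        (defCutoff R n z * ψ z) =
        ∫ z in D, (hb z * (fderiv ℝ R z a * (defCutoff R n z * ψ z)) -
          ha z * (fderiv ℝ R z b * (defCutoff R n z * ψ z))) := by
      congr 1 with z
      ring
    rw [e3, e4, integral_sub i1 i2, integral_sub i3 i4, e1, e2]
    ring
  -- removal of the truncation
  have lim : ∀ f : X → ℝ, Integrable f (volume.restrict D) → (∀ z ∉ U, f z = 0) →
      Tendsto (fun n => ∫ z in D, defCutoff R n z * f z) atTop (𝓝 (∫ z in D, f z)) := by
    intro f hf hf0
    refine tendsto_integral_of_dominated_convergence (fun z => ‖f z‖) (fun n => ?_) hf.norm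
      (fun n => ae_of_all _ fun z => ?_) (ae_restrict_of_forall_mem hD.measurableSet fun z hz => ?_)
    · exact (contDiff_defCutoff hR n).continuous.aestronglyMeasurable.mul hf.1
    · rw [norm_mul, defCutoff, Real.norm_of_nonneg (Real.smoothTransition.nonneg _)]
      exact mul_le_of_le_one_left (norm_nonneg _) (Real.smoothTransition.le_one _)
    · by_cases hzU : z ∈ U
      · have hneg := (hU z hzU).mp hz
        refine tendsto_const_nhds.congr' ?_
        filter_upwards [((tendsto_natCast_atTop_atTop (R := ℝ)).atTop_mul_const
          (neg_pos.mpr hneg)).eventually_ge_atTop 2] with n hn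
        rw [defCutoff, Real.smoothTransition.one_of_one_le (by linarith), one_mul]
      · simp [hf0 z hzU]
  have tX : IsTest U fun z =>
      fderiv ℝ R z a * fderiv ℝ ψ z b - fderiv ℝ R z b * fderiv ℝ ψ z a :=
    ((hψ.fderiv_apply b).smooth_mul hNa).sub ((hψ.fderiv_apply a).smooth_mul hNb)
  have j1 := wa.memLp.integrable_mul_two (tX.memLp (volume.restrict D))
  have j2 : Integrable (fun z => (fderiv ℝ R z a * hb z - fderiv ℝ R z b * ha z) * ψ z)
      (volume.restrict D) := by
    have k1 := wb.memLp_deriv.integrable_mul_two ((hψ.smooth_mul hNa).memLp (volume.restrict D))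
    have k2 := wa.memLp_deriv.integrable_mul_two ((hψ.smooth_mul hNb).memLp (volume.restrict D))
    refine (k1.sub k2).congr (ae_of_all _ fun z => ?_)
    simp only [Pi.sub_apply]
    ring
  refine tendsto_nhds_unique (lim _ j1 fun z hz => by rw [tX.eq_zero hz, mul_zero])
    ((lim _ j2 fun z hz => by rw [hψ.eq_zero hz, mul_zero]).neg.congr fun n => ?_)
  have := trunc n
  calc _ = -∫ z in D, (fderiv ℝ R z a * hb z - fderiv ℝ R z b * ha z) *
        (defCutoff R n z * ψ z) := by
        congr 2 with z
        ring
    _ = _ := by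
        rw [← trunc n]
        congr 1 with z
        ring

end

variable {d : ℕ} {Ω : Set (Space d)} {T : ℝ} {U : Set (SpaceTime d)} {R : SpaceTime d → ℝ}
  {u ut : SpaceTime d → ℝ} {Du : SpaceTime d → Space d} {D2u : Fin d → Fin d → SpaceTime d → ℝ}

/-- The components `∂_i R` of the spatial differential of `R`. -/
noncomputable def nrm (R : SpaceTime d → ℝ) (i : Fin d) (z : SpaceTime d) : ℝ :=
  fderiv ℝ R z (xDir i)

/-- The tangential derivative `N_i ∂_j - N_j ∂_i`, with `N` the differential of `R`, of the `k`-th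
component of the gradient. -/
noncomputable def tang (R : SpaceTime d → ℝ) (D2u : Fin d → Fin d → SpaceTime d → ℝ)
    (i j k : Fin d) (z : SpaceTime d) : ℝ :=
  nrm R i z * D2u j k z - nrm R j z * D2u i k z

/-- The lower order term `Δu N_i + ∇u · ∇N_i` arising from commuting a tangential derivative
with the gradient. -/
noncomputable def comm (R : SpaceTime d → ℝ) (Du : SpaceTime d → Space d)
    (D2u : Fin d → Fin d → SpaceTime d → ℝ) (i : Fin d) (z : SpaceTime d) : ℝ :=
  lap D2u z * nrm R i z + ∑ l, Du z l * fderiv ℝ (nrm R i) z (xDir l)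

lemma contDiff_nrm (hR : ContDiff ℝ ∞ R) (i : Fin d) : ContDiff ℝ ∞ (nrm R i) :=
  contDiff_fderiv_apply hR _

/-- The Neumann problem differentiated in a tangential direction. -/
lemma NeumannZero.integral_tang (hN : NeumannZero Ω T Du D2u) (hΩ : IsOpen Ω)
    (hu : IsH21 (stCylinder Ω 0 T) u ut Du D2u) (hR : ContDiff ℝ ∞ R)
    (hU : ∀ z ∈ U, (z ∈ stCylinder Ω 0 T ↔ R z < 0)) (i j : Fin d) {ψ : SpaceTime d → ℝ}
    (hψ : IsTest U ψ) :
    ∫ z in stCylinder Ω 0 T, ((∑ k, tang R D2u i j k z * fderiv ℝ ψ z (xDir k)) -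
      (comm R Du D2u i z * fderiv ℝ ψ z (xDir j) - comm R Du D2u j z * fderiv ℝ ψ z (xDir i))) =
      0 := by
  have hD := isOpen_stCylinder hΩ 0 T
  set Q := stCylinder Ω 0 T
  have hψu : IsTest univ ψ := hψ.mono (subset_univ U)
  have hNi := contDiff_nrm hR i
  have hNj := contDiff_nrm hR j
  have tψ : ∀ k, IsTest U (fun z => fderiv ℝ ψ z (xDir k)) := fun k => hψ.fderiv_apply _
  -- the test function is the tangential derivative of `ψ`
  let φ : SpaceTime d → ℝ := fun z =>
    nrm R i z * fderiv ℝ ψ z (xDir j) - nrm R j z * fderiv ℝ ψ z (xDir i)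
  have hφ : IsTest univ φ :=
    (((tψ j).smooth_mul hNi).sub ((tψ i).smooth_mul hNj)).mono (subset_univ U)
  have h0 := hN φ (fun z => WithLp.toLp 2 fun k => fderiv ℝ φ z (xDir k))
    fun k => hφ.hasWeakDeriv _ _
  have hk : ∀ k z, fderiv ℝ φ z (xDir k) =
      (nrm R i z * fderiv ℝ (fun z => fderiv ℝ ψ z (xDir k)) z (xDir j) -
        nrm R j z * fderiv ℝ (fun z => fderiv ℝ ψ z (xDir k)) z (xDir i)) +
      (fderiv ℝ (nrm R i) z (xDir k) * fderiv ℝ ψ z (xDir j) -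
        fderiv ℝ (nrm R j) z (xDir k) * fderiv ℝ ψ z (xDir i)) := by
    intro k z
    have d1 : DifferentiableAt ℝ (fun z => nrm R i z * fderiv ℝ ψ z (xDir j)) z :=
      (hNi.mul (tψ j).smooth).differentiable (by simp) z
    have d2 : DifferentiableAt ℝ (fun z => nrm R j z * fderiv ℝ ψ z (xDir i)) z :=
      (hNj.mul (tψ i).smooth).differentiable (by simp) z
    simp only [φ]
    rw [fderiv_fun_sub d1 d2, sub_apply, fderiv_mul_apply hNi (tψ j).smooth,
      fderiv_mul_apply hNj (tψ i).smooth, fderiv_fderiv_comm hψ.smooth z (xDir j) (xDir k),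
      fderiv_fderiv_comm hψ.smooth z (xDir i) (xDir k)]
    ring
  have hT : ∀ k, ∫ z in Q, Du z k *
      (nrm R i z * fderiv ℝ (fun z => fderiv ℝ ψ z (xDir k)) z (xDir j) -
        nrm R j z * fderiv ℝ (fun z => fderiv ℝ ψ z (xDir k)) z (xDir i)) =
      -∫ z in Q, tang R D2u i j k z * fderiv ℝ ψ z (xDir k) := fun k =>
    integral_tangential hD (hu.hess i k) (hu.hess j k) hR hU (tψ k)
  have mtest : ∀ {f : SpaceTime d → ℝ}, IsTest U f → MemLp f 2 (volume.restrict Q) :=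
    fun hf => hf.memLp _
  have iT : ∀ k, Integrable (fun z => tang R D2u i j k z * fderiv ℝ ψ z (xDir k))
      (volume.restrict Q) := by
    intro k
    have k1 := (hu.hess j k).memLp_deriv.integrable_mul_two (mtest ((tψ k).smooth_mul hNi))
    have k2 := (hu.hess i k).memLp_deriv.integrable_mul_two (mtest ((tψ k).smooth_mul hNj))
    refine (k1.sub k2).congr (ae_of_all _ fun z => ?_)
    simp only [Pi.sub_apply, tang]
    ring
  have iF : ∀ k, Integrable (fun z => Du z k *
      (nrm R i z * fderiv ℝ (fun z => fderiv ℝ ψ z (xDir k)) z (xDir j) -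
        nrm R j z * fderiv ℝ (fun z => fderiv ℝ ψ z (xDir k)) z (xDir i))) (volume.restrict Q) :=
    fun k => (hu.grad k).memLp_deriv.integrable_mul_two (mtest
      ((((tψ k).fderiv_apply _).smooth_mul hNi).sub (((tψ k).fderiv_apply _).smooth_mul hNj)))
  have hNi' := fun k => contDiff_fderiv_apply hNi (xDir k)
  have hNj' := fun k => contDiff_fderiv_apply hNj (xDir k)
  have iG : ∀ k, Integrable (fun z => Du z k *
      (fderiv ℝ (nrm R i) z (xDir k) * fderiv ℝ ψ z (xDir j) -
        fderiv ℝ (nrm R j) z (xDir k) * fderiv ℝ ψ z (xDir i))) (volume.restrict Q) :=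
    fun k => (hu.grad k).memLp_deriv.integrable_mul_two (mtest
      (((tψ j).smooth_mul (hNi' k)).sub ((tψ i).smooth_mul (hNj' k))))
  have iL : Integrable (fun z => lap D2u z * φ z) (volume.restrict Q) :=
    hu.memLp_lap.integrable_mul_two (hφ.memLp _)
  have e0 : ∫ z in Q, ((lap D2u z * φ z + ∑ k, Du z k *
      (fderiv ℝ (nrm R i) z (xDir k) * fderiv ℝ ψ z (xDir j) -
        fderiv ℝ (nrm R j) z (xDir k) * fderiv ℝ ψ z (xDir i))) + ∑ k, Du z k *
      (nrm R i z * fderiv ℝ (fun z => fderiv ℝ ψ z (xDir k)) z (xDir j) -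
        nrm R j z * fderiv ℝ (fun z => fderiv ℝ ψ z (xDir k)) z (xDir i))) = 0 := by
    rw [← h0]
    congr 1 with z
    simp only [hk]
    rw [add_assoc, ← Finset.sum_add_distrib]
    congr 1
    refine Finset.sum_congr rfl fun k _ => ?_
    ring
  have iLG : Integrable (fun z => lap D2u z * φ z + ∑ k, Du z k *
      (fderiv ℝ (nrm R i) z (xDir k) * fderiv ℝ ψ z (xDir j) -
        fderiv ℝ (nrm R j) z (xDir k) * fderiv ℝ ψ z (xDir i))) (volume.restrict Q) :=
    iL.add (integrable_finsetSum _ fun k _ => iG k)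
  rw [integral_add iLG (integrable_finsetSum _ fun k _ => iF k),
    integral_finsetSum _ fun k _ => iF k] at e0
  simp_rw [hT] at e0
  rw [Finset.sum_neg_distrib, ← integral_finsetSum _ fun k _ => iT k] at e0
  rw [add_neg_eq_zero] at e0
  have e1 : ∀ z, comm R Du D2u i z * fderiv ℝ ψ z (xDir j) -
      comm R Du D2u j z * fderiv ℝ ψ z (xDir i) = lap D2u z * φ z + ∑ k, Du z k *
      (fderiv ℝ (nrm R i) z (xDir k) * fderiv ℝ ψ z (xDir j) -
        fderiv ℝ (nrm R j) z (xDir k) * fderiv ℝ ψ z (xDir i)) := by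
    intro z
    simp only [comm, φ, add_mul, Finset.sum_mul, mul_sub, Finset.sum_sub_distrib]
    have s1 : ∀ m l : Fin d, ∑ k, Du z k * fderiv ℝ (nrm R m) z (xDir k) * fderiv ℝ ψ z (xDir l) =
        ∑ k, Du z k * (fderiv ℝ (nrm R m) z (xDir k) * fderiv ℝ ψ z (xDir l)) := fun m l =>
      Finset.sum_congr rfl fun k _ => by ring
    rw [s1, s1]
    ring
  simp_rw [e1]
  rw [integral_sub (integrable_finsetSum _ fun k _ => iT k) iLG, ← e0, sub_self]

end

/-! ### Mollification with transversal shifts -/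

section

variable {d : ℕ} {Ω : Set (Space d)} {T : ℝ} {U : Set (SpaceTime d)}

/-- The space derivatives of a mollification of the zero extension of `Ψ` are mollifications of the
weak derivatives at those points where the mollification only sees values of `Ψ` inside the
cylinder. -/
lemma fderiv_mollify {k : Fin d} {Ψ Ψk κ : SpaceTime d → ℝ} (hΩ : IsOpen Ω)
    (hΨ : HasWeakDeriv (stCylinder Ω 0 T) (xDir k) Ψ Ψk) (hκ : IsTest univ κ) {z : SpaceTime d}
    (hz : ∀ w ∈ tsupport κ, (z - w).1 ∈ Ω) :
    ∫ y in stCylinder Ω 0 T, Ψ y * fderiv ℝ κ (z - y) (xDir k) =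
      ∫ y in stCylinder Ω 0 T, Ψk y * κ (z - y) := by
  have ht : IsTest (Ω ×ˢ univ) (fun y => κ (z - y)) := by
    refine ⟨hκ.smooth.comp (by fun_prop), hκ.compact.comp_homeomorph (Homeomorph.subLeft z),
      fun y hy => ⟨?_, trivial⟩⟩
    have : tsupport (fun y => κ (z - y)) ⊆ (fun y => z - y) ⁻¹' tsupport κ :=
      closure_minimal (fun x hx => subset_closure hx)
        ((isClosed_tsupport κ).preimage (by fun_prop))
    simpa using hz _ (this hy)
  have h1 := hΨ.integral_test_cylinder hΩ ht
  have h2 : ∀ y, fderiv ℝ (fun y => κ (z - y)) y (xDir k) = -fderiv ℝ κ (z - y) (xDir k) := by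
    intro y
    have h3 := (hκ.smooth.differentiable (by simp) (z - y)).hasFDerivAt.comp y
      ((hasFDerivAt_id y).const_sub z)
    have h4 : fderiv ℝ (fun y => κ (z - y)) y = _ := h3.fderiv
    rw [h4]
    simp
  simp_rw [h2, mul_neg, integral_neg, neg_inj] at h1
  exact h1

/-- If arbitrarily small shifts move `Q ∩ U` into the cylinder, an identity
`∫_Q ∑ A_k ∂_k ψ = 0` for all test functions `ψ` on `U` extends to functions with weak derivatives
in `L²(Q)` and support in a compact subset of `U`. -/
theorem integral_eq_zero_of_transversal (hΩ : IsOpen Ω) (hU : IsOpen U)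
    {A Ψk : Fin d → SpaceTime d → ℝ} {Ψ : SpaceTime d → ℝ} {K : Set (SpaceTime d)}
    (hA : ∀ k, MemLp (A k) 2 (volume.restrict (stCylinder Ω 0 T)))
    (hΨ : ∀ k, HasWeakDeriv (stCylinder Ω 0 T) (xDir k) Ψ (Ψk k))
    (hK : IsCompact K) (hKU : K ⊆ U) (hΨ0 : ∀ z ∉ K, Ψ z = 0) (hΨk0 : ∀ k, ∀ z ∉ K, Ψk k z = 0)
    (htr : ∀ δ > 0, ∃ (y : SpaceTime d) (r : ℝ), 0 < r ∧ Metric.closedBall y r ⊆ Metric.ball 0 δ ∧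
      ∀ z ∈ stCylinder Ω 0 T ∩ U, ∀ w ∈ Metric.closedBall y r, (z - w).1 ∈ Ω)
    (H : ∀ ψ, IsTest U ψ →
      ∫ z in stCylinder Ω 0 T, ∑ k, A k z * fderiv ℝ ψ z (xDir k) = 0) :
    ∫ z in stCylinder Ω 0 T, ∑ k, A k z * Ψk k z = 0 := by
  have hD := isOpen_stCylinder hΩ 0 T
  set Q := stCylinder Ω 0 T with hQ
  have hA0 : ∀ k, MemLp (Q.indicator (A k)) 2 volume := fun k =>
    (memLp_indicator_iff_restrict hD.measurableSet).mpr (hA k)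
  have hΨk0' : ∀ k, MemLp (Q.indicator (Ψk k)) 2 volume := fun k =>
    (memLp_indicator_iff_restrict hD.measurableSet).mpr (hΨ k).memLp_deriv
  -- the left-hand side with `Ψ` translated by `y`: continuous in `y`, and its averages over small
  -- balls of admissible shifts vanish
  let S : SpaceTime d → ℝ := fun y =>
    ∑ k, ∫ z, Q.indicator (A k) z * Q.indicator (Ψk k) (z - y)
  have hS : Continuous S := continuous_finsetSum _ fun k _ =>
    continuous_integral_mul_translate (hA0 k) (hΨk0' k)
  have hS0 : S 0 = ∫ z in Q, ∑ k, A k z * Ψk k z := by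
    rw [integral_finsetSum _ fun k _ => (hA k).integrable_mul_two (hΨ k).memLp_deriv]
    refine Finset.sum_congr rfl fun k _ => ?_
    rw [← integral_indicator hD.measurableSet]
    congr 1 with z
    rw [sub_zero]
    by_cases hz : z ∈ Q <;> simp [hz]
  rw [← hS0]
  by_contra hne
  have hpos : 0 < |S 0| / 2 := by positivity
  obtain ⟨δ₁, hδ₁, hSδ⟩ := Metric.continuousAt_iff.mp hS.continuousAt _ hpos
  obtain ⟨δ₂, hδ₂, hKδ⟩ := hK.exists_cthickening_subset_open hU hKU
  obtain ⟨y, r, hr, hyr, htr⟩ := htr (min δ₁ δ₂) (lt_min hδ₁ hδ₂)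
  let f : ContDiffBump y := ⟨r / 2, r, by positivity, by linarith⟩
  set κ := f.normed volume with hκdef
  have hκs : tsupport κ = Metric.closedBall y r := f.tsupport_normed_eq
  have hκ : IsTest univ κ := ⟨f.contDiff_normed, f.hasCompactSupport_normed, subset_univ _⟩
  have hκ0 : ∀ w ∉ Metric.closedBall y r, κ w = 0 := fun w hw =>
    image_eq_zero_of_notMem_tsupport (by rwa [hκs])
  have hKU' : ∀ z w, z - w ∈ K → w ∈ Metric.closedBall y r → z ∈ U := by
    intro z w hzw hw
    refine hKδ (Metric.mem_cthickening_of_dist_le z (z - w) δ₂ K hzw ?_)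
    have := mem_ball_zero_iff.mp (hyr hw)
    rw [dist_eq_norm, sub_sub_cancel]
    exact (this.trans_le (min_le_right _ _)).le
  have hΨ0' : MemLp (Q.indicator Ψ) 2 volume :=
    (memLp_indicator_iff_restrict hD.measurableSet).mpr (by
      rcases isEmpty_or_nonempty (Fin d) with he | ⟨⟨k⟩⟩
      · exact absurd (by simp [S]) hne
      · exact (hΨ k).memLp)
  have hloc : LocallyIntegrable (Q.indicator Ψ) volume := hΨ0'.locallyIntegrable (by norm_num)
  -- the mollified function is an admissible test function
  let ψ : SpaceTime d → ℝ := convolution (Q.indicator Ψ) κ (ContinuousLinearMap.mul ℝ ℝ) volume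
  let K' : Set (SpaceTime d) := (fun p : SpaceTime d × SpaceTime d => p.1 + p.2) ''
    (K ×ˢ Metric.closedBall y r)
  have hK' : IsCompact K' := (hK.prod (isCompact_closedBall y r)).image (by fun_prop)
  have hψs : tsupport ψ ⊆ K' := by
    refine closure_minimal (fun z hz => ?_) hK'.isClosed
    by_contra hc
    refine hz ?_
    simp only [ψ, convolution_def]
    refine integral_eq_zero_of_ae (ae_of_all _ fun w => ?_)
    simp only [ContinuousLinearMap.mul_apply', Pi.zero_apply]
    by_cases hw : w ∈ K
    · rw [hκ0 _ fun hm => hc ⟨(w, z - w), ⟨hw, hm⟩, by simp⟩, mul_zero]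
    · rw [indicator_apply_eq_zero.mpr fun _ => hΨ0 w hw, zero_mul]
  have hψ : IsTest U ψ := by
    refine ⟨hκ.compact.contDiff_convolution_right (n := ⊤) _ hloc hκ.smooth,
      hK'.of_isClosed_subset (isClosed_tsupport _) hψs,
      hψs.trans ?_⟩
    rintro _ ⟨⟨a, w⟩, ⟨ha, hw⟩, rfl⟩
    exact hKU' _ w (by simpa using ha) hw
  have hfd : ∀ k, ∀ z ∈ Q, fderiv ℝ ψ z (xDir k) =
      ∫ w in Metric.closedBall y r, κ w * Q.indicator (Ψk k) (z - w) := by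
    intro k z hz
    have h1 : fderiv ℝ ψ z = _ := (hκ.compact.hasFDerivAt_convolution_right
      (ContinuousLinearMap.mul ℝ ℝ) hloc (contDiff_infty.mp hκ.smooth 1) z).fderiv
    rw [h1, convolution_precompR_apply _ hloc (hκ.compact.fderiv ℝ)
      (hκ.smooth.continuous_fderiv (by simp))]
    simp only [convolution_def, ContinuousLinearMap.mul_apply']
    have h2 : ∀ (g l : SpaceTime d → ℝ), ∫ w, Q.indicator g w * l (z - w) =
        ∫ w in Q, g w * l (z - w) := by
      intro g l
      rw [← integral_indicator hD.measurableSet]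
      congr 1 with w
      rw [indicator_mul_left]
    rw [setIntegral_eq_integral_of_forall_compl_eq_zero
      (fun w hw => by rw [hκ0 w hw, zero_mul]), h2 Ψ fun w => fderiv ℝ κ w (xDir k)]
    have h3 : ∫ w, κ w * Q.indicator (Ψk k) (z - w) = ∫ w in Q, Ψk k w * κ (z - w) := by
      rw [← h2, ← integral_sub_left_eq_self _ volume z]
      congr 1 with w
      rw [sub_sub_cancel, mul_comm]
    rw [h3]
    by_cases hc : ∃ w ∈ Metric.closedBall y r, z - w ∈ K
    · obtain ⟨w, hw, hzw⟩ := hc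
      refine fderiv_mollify hΩ (hΨ k) hκ fun w' hw' => ?_
      exact htr z ⟨hz, hKU' z w hzw hw⟩ w' (by rwa [hκs] at hw')
    · push Not at hc
      have hkd : ∀ w ∈ K, κ (z - w) = 0 ∧ fderiv ℝ κ (z - w) (xDir k) = 0 := by
        intro w hw
        have hn : z - w ∉ tsupport κ := by
          rw [hκs]
          intro hm
          exact hc _ hm (by simpa using hw)
        refine ⟨image_eq_zero_of_notMem_tsupport hn, ?_⟩
        exact image_eq_zero_of_notMem_tsupport (f := fun z => fderiv ℝ κ z (xDir k))
          (fun hm => hn (tsupport_fderiv_apply_subset κ (xDir k) hm))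
      rw [integral_eq_zero_of_ae, integral_eq_zero_of_ae]
      · refine ae_of_all _ fun w => ?_
        by_cases hw : w ∈ K
        · simp [(hkd w hw).1]
        · simp [hΨk0 k w hw]
      · refine ae_of_all _ fun w => ?_
        by_cases hw : w ∈ K
        · simp [(hkd w hw).2]
        · simp [hΨ0 w hw]
  obtain ⟨B, -, hB⟩ := hκ.exists_bound
  have hfinB : IsFiniteMeasure ((volume : Measure (SpaceTime d)).restrict
      (Metric.closedBall y r)) :=
    isFiniteMeasure_restrict_of_isBounded Metric.isBounded_closedBall
  have hI : ∀ k, Integrable (fun p : SpaceTime d × SpaceTime d =>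
      κ p.1 * (Q.indicator (A k) p.2 * Q.indicator (Ψk k) (p.2 - p.1)))
      ((volume.restrict (Metric.closedBall y r)).prod volume) := fun k =>
    (integrable_mul_shear (s := id) (hA0 k) (hΨk0' k) measurable_id).bdd_mul (c := B)
      (hκ.continuous.comp continuous_fst).aestronglyMeasurable (ae_of_all _ fun p => hB p.1)
  -- the tested identity is an average of `S`
  have havg : ∫ w in Metric.closedBall y r, κ w * S w = 0 := by
    rw [← H ψ hψ, integral_finsetSum _ fun k _ =>
      (hA k).integrable_mul_two ((hψ.fderiv_apply _).memLp _)]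
    simp only [S, Finset.mul_sum, ← integral_const_mul]
    rw [integral_finsetSum _ fun k _ => (hI k).integral_prod_left]
    refine Finset.sum_congr rfl fun k _ => ?_
    rw [integral_integral_swap (hI k), ← integral_indicator hD.measurableSet]
    congr 1 with z
    by_cases hz : z ∈ Q
    · simp only [indicator_of_mem hz]
      rw [hfd k z hz, ← integral_const_mul]
      congr 1 with w
      ring
    · simp [hz]
  have hκi : ∫ w in Metric.closedBall y r, κ w = 1 := by
    rw [setIntegral_eq_integral_of_forall_compl_eq_zero hκ0]
    exact f.integral_normed
  have hle : ‖∫ w in Metric.closedBall y r, κ w * (S w - S 0)‖ ≤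
      ∫ w in Metric.closedBall y r, κ w * (|S 0| / 2) := by
    have hint : Integrable (fun w => κ w * (|S 0| / 2))
        (volume.restrict (Metric.closedBall y r)) :=
      (f.integrable_normed.integrableOn).mul_const _
    refine norm_integral_le_of_norm_le hint
      (ae_restrict_of_forall_mem measurableSet_closedBall fun w hw => ?_)
    have hk0 : 0 ≤ κ w := f.nonneg_normed w
    rw [norm_mul, Real.norm_of_nonneg hk0]
    refine mul_le_mul_of_nonneg_left ?_ hk0
    have h1 := mem_ball_zero_iff.mp (hyr hw)
    have := hSδ (x := w) (by rw [dist_zero_right]; exact h1.trans_le (min_le_left _ _))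
    exact this.le
  have hsub : ∫ w in Metric.closedBall y r, κ w * (S w - S 0) = -S 0 := by
    have i1 : Integrable (fun w => κ w * S w) (volume.restrict (Metric.closedBall y r)) :=
      ((hκ.continuous.mul hS).continuousOn.integrableOn_compact (isCompact_closedBall y r))
    have i2 : Integrable (fun w => κ w * S 0) (volume.restrict (Metric.closedBall y r)) :=
      (f.integrable_normed.integrableOn).mul_const _
    simp_rw [mul_sub]
    rw [integral_sub i1 i2, havg, integral_mul_const, hκi]
    ring
  rw [hsub, integral_mul_const, hκi, norm_neg, one_mul, Real.norm_eq_abs] at hle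
  linarith

end

/-! ### Boundary charts and pointwise algebra -/

section

variable {d : ℕ} {Ω : Set (Space d)}

/-- A defining function for `Ω` near a point of the closure. The last clause
says that `Ω` is moved into itself by small shifts in the directions of a cone. -/
structure IsChart (Ω : Set (Space d)) (p : Space d) (ρ : Space d → ℝ) (r c : ℝ) : Prop where
  test : IsTest univ ρ
  r_pos : 0 < r
  c_pos : 0 < c
  mem_iff : ∀ x ∈ Metric.ball p r, (x ∈ Ω ↔ ρ x < 0)
  le_sum_sq : ∀ x ∈ Metric.ball p r, c ≤ ∑ i, fderiv ℝ ρ x (spaceDir i) ^ 2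
  shift : ∀ δ > 0, ∃ (y : Space d) (s : ℝ), 0 < s ∧ Metric.closedBall y s ⊆ Metric.ball 0 δ ∧
    ∀ x ∈ Ω ∩ Metric.ball p r, ∀ w ∈ Metric.closedBall y s, x - w ∈ Ω

lemma exists_spaceDir_ne_zero {L : Space d →L[ℝ] ℝ} (hL : L ≠ 0) : ∃ i, L (spaceDir i) ≠ 0 := by
  by_contra hc
  push Not at hc
  refine hL (ContinuousLinearMap.coe_injective
    ((EuclideanSpace.basisFun (Fin d) ℝ).toBasis.ext fun i => ?_))
  simpa [spaceDir] using hc i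

lemma exists_isChart_of_defining {p : Space d} {ρ₀ : Space d → ℝ} (h₀ : ContDiff ℝ ∞ ρ₀)
    (h₁ : fderiv ℝ ρ₀ p ≠ 0) (h₂ : ∀ᶠ x in 𝓝 p, (x ∈ Ω ↔ ρ₀ x < 0)) :
    ∃ ρ r c, IsChart Ω p ρ r c := by
  let f : ContDiffBump p := ⟨1, 2, by norm_num, by norm_num⟩
  let ρ : Space d → ℝ := fun x => f x * ρ₀ x
  have heq : ρ =ᶠ[𝓝 p] ρ₀ := by
    filter_upwards [f.eventuallyEq_one] with x hx
    simp [ρ, hx]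
  have hρs : ContDiff ℝ ∞ ρ := f.contDiff.mul h₀
  have hρ : IsTest univ ρ := ⟨hρs, f.hasCompactSupport.mul_right, subset_univ _⟩
  have hf : fderiv ℝ ρ p ≠ 0 := by rwa [heq.fderiv_eq]
  have hc : Continuous (fderiv ℝ ρ) := hρs.continuous_fderiv (by simp)
  obtain ⟨i, hi⟩ := exists_spaceDir_ne_zero hf
  -- a direction in which `ρ` increases
  obtain ⟨e, he⟩ : ∃ e, 0 < fderiv ℝ ρ p e := by
    rcases lt_or_gt_of_ne hi with h | h
    · exact ⟨-spaceDir i, by rw [map_neg]; linarith⟩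
    · exact ⟨spaceDir i, h⟩
  set m := fderiv ℝ ρ p e with hm
  obtain ⟨L, hL⟩ := (hρ.compact.fderiv ℝ).exists_bound_of_continuous hc
  have hL0 : 0 ≤ L := (norm_nonneg _).trans (hL p)
  set c := fderiv ℝ ρ p (spaceDir i) ^ 2 / 2 with hcdef
  have hc0 : 0 < c := by positivity
  have ev1 : ∀ᶠ x in 𝓝 p, (x ∈ Ω ↔ ρ x < 0) := by
    filter_upwards [h₂, heq] with x hx hx'
    rw [hx, hx']
  have ev2 : ∀ᶠ x in 𝓝 p, c ≤ fderiv ℝ ρ x (spaceDir i) ^ 2 := by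
    have : ContinuousAt (fun x => fderiv ℝ ρ x (spaceDir i) ^ 2) p := by fun_prop
    exact this.eventually_const_le (by
      have : 0 < fderiv ℝ ρ p (spaceDir i) ^ 2 := by positivity
      rw [hcdef]; linarith)
  have ev3 : ∀ᶠ x in 𝓝 p, m / 2 ≤ fderiv ℝ ρ x e := by
    have : ContinuousAt (fun x => fderiv ℝ ρ x e) p := by fun_prop
    exact this.eventually_const_le (half_lt_self he)
  obtain ⟨R, hR, hball⟩ := Metric.eventually_nhds_iff_ball.mp (ev1.and (ev2.and ev3))
  have hsub : Metric.ball p (R / 2) ⊆ Metric.ball p R := Metric.ball_subset_ball (by linarith)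
  refine ⟨ρ, R / 2, c, hρ, by positivity, hc0, fun x hx => (hball x (hsub hx)).1,
    fun x hx => (hball x (hsub hx)).2.1.trans ?_, fun δ hδ => ?_⟩
  · exact Finset.single_le_sum (f := fun i => fderiv ℝ ρ x (spaceDir i) ^ 2)
      (fun j _ => sq_nonneg _) (Finset.mem_univ i)
  · -- the cone around `e` of opening `a`
    set a := m / (2 * (L + 1)) with ha
    have ha0 : 0 < a := by positivity
    set N := ‖e‖ + a with hN
    have hN0 : 0 < N := by positivity
    set s := min (δ / 2) (R / 4) / N with hs
    have hs0 : 0 < s := by positivity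
    have hsN : s * N = min (δ / 2) (R / 4) := div_mul_cancel₀ _ hN0.ne'
    have hw : ∀ w ∈ Metric.closedBall (s • e) (s * a), ‖w‖ ≤ s * N := by
      intro w hw
      rw [mem_closedBall_iff_norm] at hw
      calc ‖w‖ = ‖s • e + (w - s • e)‖ := by rw [add_sub_cancel]
        _ ≤ ‖s • e‖ + ‖w - s • e‖ := norm_add_le _ _
        _ ≤ s * ‖e‖ + s * a := by
          rw [norm_smul, Real.norm_of_nonneg hs0.le]
          linarith
        _ = s * N := by rw [hN]; ring
    refine ⟨s • e, s * a, by positivity, fun w hw' => ?_, fun x hx w hw' => ?_⟩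
    · rw [mem_ball_zero_iff]
      have := hw w hw'
      have h2 := min_le_left (δ / 2) (R / 4)
      linarith
    · have hwn := hw w hw'
      have h2 := min_le_right (δ / 2) (R / 4)
      have hseg : ∀ θ ∈ Icc (0 : ℝ) 1, x - θ • w ∈ Metric.ball p R := by
        intro θ hθ
        have h3 : dist x p < R / 2 := hx.2
        have h4 : ‖θ • w‖ ≤ ‖w‖ := by
          rw [norm_smul, Real.norm_of_nonneg hθ.1]
          exact mul_le_of_le_one_left (norm_nonneg _) hθ.2
        have h5 : dist (x - θ • w) p ≤ dist x p + ‖θ • w‖ := by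
          rw [dist_eq_norm, dist_eq_norm, sub_right_comm]
          exact norm_sub_le _ _
        rw [Metric.mem_ball]
        linarith
      have hx1 : x ∈ Metric.ball p R := hsub hx.2
      have hd : ∀ θ : ℝ, HasDerivAt (fun θ : ℝ => ρ (x - θ • w))
          (fderiv ℝ ρ (x - θ • w) (-w)) θ := by
        intro θ
        have g1 : HasDerivAt (fun θ : ℝ => x - θ • w) (-w) θ := by
          simpa using ((hasDerivAt_id θ).smul_const w).const_sub x
        exact ((hρs.differentiable (by simp) _).hasFDerivAt).comp_hasDerivAt θ g1
      have hanti : AntitoneOn (fun θ : ℝ => ρ (x - θ • w)) (Icc 0 1) := by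
        refine antitoneOn_of_deriv_nonpos (convex_Icc 0 1)
          (fun θ _ => (hd θ).continuousAt.continuousWithinAt)
          (fun θ _ => (hd θ).differentiableAt.differentiableWithinAt) fun θ hθ => ?_
        rw [interior_Icc] at hθ
        rw [(hd θ).deriv]
        have k1 := (hball _ (hseg θ (Ioo_subset_Icc_self hθ))).2.2
        have k2 : |fderiv ℝ ρ (x - θ • w) (w - s • e)| ≤ L * (s * a) := by
          rw [mem_closedBall_iff_norm] at hw'
          exact ((fderiv ℝ ρ (x - θ • w)).le_opNorm (w - s • e)).trans
            (mul_le_mul (hL _) hw' (norm_nonneg _) hL0)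
        have k3 : fderiv ℝ ρ (x - θ • w) (-w) =
            -(s * fderiv ℝ ρ (x - θ • w) e) - fderiv ℝ ρ (x - θ • w) (w - s • e) := by
          rw [map_neg, map_sub, map_smul, smul_eq_mul]
          ring
        rw [k3]
        have k4 : L * a ≤ m / 2 := by
          rw [ha, ← mul_div_assoc, div_le_div_iff₀ (by positivity) (by norm_num)]
          nlinarith
        have k5 := (abs_le.mp k2).1
        nlinarith
      have hle := hanti (left_mem_Icc.mpr zero_le_one) (right_mem_Icc.mpr zero_le_one) zero_le_one
      simp only [one_smul, zero_smul, sub_zero] at hle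
      have hend := hseg 1 (right_mem_Icc.mpr zero_le_one)
      rw [one_smul] at hend
      rw [(hball _ hend).1]
      exact hle.trans_lt ((hball x hx1).1.mp hx.1)

lemma IsSmoothBoundedDomain.exists_isChart (hd : 0 < d) (hΩ : IsSmoothBoundedDomain Ω)
    {p : Space d} (hp : p ∈ closure Ω) : ∃ ρ r c, IsChart Ω p ρ r c := by
  by_cases hpΩ : p ∈ Ω
  · -- near an interior point, an affine function serves as defining function
    let L : Space d →L[ℝ] ℝ := EuclideanSpace.proj ⟨0, hd⟩
    have hfd : HasFDerivAt (fun x => L x - L p - 1) L p :=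
      ((L.hasFDerivAt (x := p)).sub_const (L p)).sub_const 1
    refine exists_isChart_of_defining (ρ₀ := fun x => L x - L p - 1)
      ((L.contDiff.sub contDiff_const).sub contDiff_const) ?_ ?_
    · rw [hfd.fderiv]
      intro h0
      have := congrArg (fun M : Space d →L[ℝ] ℝ => M (spaceDir ⟨0, hd⟩)) h0
      simp [L, spaceDir] at this
    · have hcont : ContinuousAt (fun x => L x - L p - 1) p := hfd.continuousAt
      have hneg : (fun x => L x - L p - 1) p < 0 := by simp
      filter_upwards [hΩ.isOpen.mem_nhds hpΩ, hcont.eventually_lt_const hneg] with x h1 h2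
      exact ⟨fun _ => h2, fun _ => h1⟩
  · obtain ⟨ρ₀, h1, h2, h3⟩ := hΩ.smooth_boundary p
      ⟨hp, fun hi => hpΩ (interior_subset hi)⟩
    exact exists_isChart_of_defining h1 h2 h3

lemma sq_le_of_forall_abs_le {x a : ℝ} (h : |x| ≤ a) : x ^ 2 ≤ a ^ 2 := by
  rw [← sq_abs]
  exact pow_le_pow_left₀ (abs_nonneg _) h 2

/-- A symmetric matrix is controlled by its trace and the components `N_i D_jk - N_j D_ik`. -/
lemma sq_le_of_tangential {N : Fin d → ℝ} {D : Fin d → Fin d → ℝ} {c M β : ℝ} (hc : 0 < c)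
    (hM : 0 ≤ M) (hN : c ≤ ∑ i, N i ^ 2) (hNM : ∀ i, |N i| ≤ M) (hD : ∀ i j, D i j = D j i)
    (htr : |∑ i, D i i| ≤ β) (hT : ∀ i j k, |N i * D j k - N j * D i k| ≤ β) (j k : Fin d) :
    |D j k| ≤ (d * M / c + M ^ 2 / c + d ^ 2 * M ^ 3 / c ^ 2 + M ^ 3 * d ^ 2 / c ^ 2) * β := by
  set s := ∑ i, N i ^ 2 with hs
  have hs0 : 0 < s := hc.trans_le hN
  have hβ : 0 ≤ β := (abs_nonneg _).trans htr
  set G : Fin d → ℝ := fun k => ∑ i, N i * D i k with hG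
  set q := ∑ k, N k * G k with hq
  have hNT : ∀ (j k : Fin d), |∑ i, N i * (N i * D j k - N j * D i k)| ≤ d * (M * β) := by
    intro j k
    refine (Finset.abs_sum_le_sum_abs _ _).trans ?_
    refine (Finset.sum_le_card_nsmul _ _ (M * β) fun i _ => ?_).trans (by simp)
    rw [abs_mul]
    exact mul_le_mul (hNM i) (hT i j k) (abs_nonneg _) hM
  have e1 : ∀ j k, ∑ i, N i * (N i * D j k - N j * D i k) = s * D j k - N j * G k := by
    intro j k
    simp only [hs, hG, mul_sub, Finset.sum_sub_distrib, Finset.sum_mul, Finset.mul_sum]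
    congr 1
    · exact Finset.sum_congr rfl fun i _ => by ring
    · exact Finset.sum_congr rfl fun i _ => by ring
  have b1 : ∀ j k, |s * D j k - N j * G k| ≤ d * (M * β) := fun j k => by rw [← e1]; exact hNT j k
  have bsum : ∀ {f : Fin d → ℝ} {b : ℝ}, (∀ i, |f i| ≤ b) → |∑ i, f i| ≤ d * b := by
    intro f b hf
    refine (Finset.abs_sum_le_sum_abs _ _).trans ?_
    exact (Finset.sum_le_card_nsmul _ _ b fun i _ => hf i).trans (by simp)
  -- double contraction
  have e2' : ∀ j, |s * G j - N j * q| ≤ d * (M * (d * (M * β))) := by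
    intro j
    have e2 : ∑ k, N k * (s * D j k - N j * G k) = s * G j - N j * q := by
      simp only [mul_sub, Finset.sum_sub_distrib, hq, Finset.mul_sum, hG]
      congr 1
      · exact Finset.sum_congr rfl fun i _ => by rw [hD j i]; ring
      · refine Finset.sum_congr rfl fun i _ => Finset.sum_congr rfl fun l _ => by ring
    rw [← e2]
    refine bsum fun k => ?_
    rw [abs_mul]
    exact mul_le_mul (hNM k) (b1 j k) (abs_nonneg _) hM
  -- trace
  have e3 : |s * ∑ i, D i i - q| ≤ d * (d * (M * β)) := by
    have : s * ∑ i, D i i - q = ∑ l, (s * D l l - N l * G l) := by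
      rw [Finset.sum_sub_distrib, Finset.mul_sum]
    rw [this]
    exact bsum fun l => b1 l l
  have hq' : |q| ≤ s * β + d * (d * (M * β)) := by
    have h1 : q = s * ∑ i, D i i - (s * ∑ i, D i i - q) := by ring
    rw [h1]
    refine (abs_sub _ _).trans (add_le_add ?_ e3)
    rw [abs_mul, abs_of_pos hs0]
    exact mul_le_mul_of_nonneg_left htr hs0.le
  have hG' : |s * G k| ≤ M * (s * β + d * (d * (M * β))) + d * (M * (d * (M * β))) := by
    have h1 : s * G k = N k * q + (s * G k - N k * q) := by ring
    rw [h1]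
    refine (abs_add_le _ _).trans (add_le_add ?_ (e2' k))
    rw [abs_mul]
    exact mul_le_mul (hNM k) hq' (abs_nonneg _) hM
  have hfin : |s ^ 2 * D j k| ≤ s * (d * (M * β)) +
      M * (M * (s * β + d * (d * (M * β))) + d * (M * (d * (M * β)))) := by
    have h1 : s ^ 2 * D j k = s * (s * D j k - N j * G k) + N j * (s * G k) := by ring
    rw [h1]
    refine (abs_add_le _ _).trans (add_le_add ?_ ?_)
    · rw [abs_mul, abs_of_pos hs0]
      exact mul_le_mul_of_nonneg_left (b1 j k) hs0.le
    · rw [abs_mul]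
      exact mul_le_mul (hNM j) hG' (abs_nonneg _) hM
  rw [abs_mul, abs_of_pos (by positivity : 0 < s ^ 2)] at hfin
  have hfin2 : |D j k| ≤ (s * (d * (M * β)) +
      M * (M * (s * β + d * (d * (M * β))) + d * (M * (d * (M * β))))) / s ^ 2 := by
    rw [le_div_iff₀ (by positivity)]
    linarith
  refine hfin2.trans ?_
  have e4 : (s * (d * (M * β)) +
      M * (M * (s * β + d * (d * (M * β))) + d * (M * (d * (M * β))))) / s ^ 2 =
      (d * M / s + M ^ 2 / s + d ^ 2 * M ^ 3 / s ^ 2 + M ^ 3 * d ^ 2 / s ^ 2) * β := by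
    field_simp
    ring
  rw [e4]
  gcongr

/-- Cauchy-Schwarz bookkeeping for the tested tangential identity. -/
lemma tangential_absorb {ζ χ L t c₁ c₂ ci cj : ℝ} {τ E : Fin d → ℝ} (i j : Fin d)
    (hζ : ζ ^ 2 ≤ χ ^ 2) (hE : ∀ k, |E k| ≤ c₁ * |χ| * t) (hci : |ci| ≤ c₂ * (L + t))
    (hcj : |cj| ≤ c₂ * (L + t)) :
    1 / 2 * (ζ ^ 2 * ∑ k, τ k ^ 2) ≤ (∑ k, τ k * (ζ ^ 2 * τ k + ζ * E k)) -
      ci * (ζ ^ 2 * τ j + ζ * E j) + cj * (ζ ^ 2 * τ i + ζ * E i) +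
      ((d + 1) * c₁ ^ 2 + 10 * c₂ ^ 2) * (χ ^ 2 * (L ^ 2 + t ^ 2)) := by
  have hE2 : ∀ k, E k ^ 2 ≤ c₁ ^ 2 * (χ ^ 2 * t ^ 2) := by
    intro k
    refine (sq_le_of_forall_abs_le (hE k)).trans (le_of_eq ?_)
    rw [mul_pow, mul_pow, sq_abs]
    ring
  have hc2 : ∀ x, |x| ≤ c₂ * (L + t) → ζ ^ 2 * x ^ 2 ≤ 2 * c₂ ^ 2 * (χ ^ 2 * (L ^ 2 + t ^ 2)) := by
    intro x hx
    have h1 : x ^ 2 ≤ c₂ ^ 2 * (2 * (L ^ 2 + t ^ 2)) := by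
      refine (sq_le_of_forall_abs_le hx).trans ?_
      rw [mul_pow]
      gcongr
      nlinarith [sq_nonneg (L - t)]
    calc ζ ^ 2 * x ^ 2 ≤ χ ^ 2 * (c₂ ^ 2 * (2 * (L ^ 2 + t ^ 2))) := by gcongr
      _ = _ := by ring
  have s1 : ∀ k, τ k ^ 2 ≤ ∑ k, τ k ^ 2 := fun k =>
    Finset.single_le_sum (f := fun k => τ k ^ 2) (fun _ _ => sq_nonneg _) (Finset.mem_univ k)
  have s2 : ζ ^ 2 * ∑ k, τ k ^ 2 - ∑ k, τ k * (ζ ^ 2 * τ k + ζ * E k) ≤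
      1 / 4 * (ζ ^ 2 * ∑ k, τ k ^ 2) + d * (c₁ ^ 2 * (χ ^ 2 * t ^ 2)) := by
    have h1 : ζ ^ 2 * ∑ k, τ k ^ 2 - ∑ k, τ k * (ζ ^ 2 * τ k + ζ * E k) =
        ∑ k, -(ζ * τ k * E k) := by
      rw [Finset.mul_sum, ← Finset.sum_sub_distrib]
      exact Finset.sum_congr rfl fun k _ => by ring
    have h2 : 1 / 4 * (ζ ^ 2 * ∑ k, τ k ^ 2) + d * (c₁ ^ 2 * (χ ^ 2 * t ^ 2)) =
        ∑ k : Fin d, (1 / 4 * (ζ ^ 2 * τ k ^ 2) + c₁ ^ 2 * (χ ^ 2 * t ^ 2)) := by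
      rw [Finset.sum_add_distrib, Finset.mul_sum, Finset.mul_sum]
      simp
    rw [h1, h2]
    refine Finset.sum_le_sum fun k _ => ?_
    nlinarith [sq_nonneg (1 / 2 * (ζ * τ k) + E k), hE2 k]
  have hχt : c₁ ^ 2 * (χ ^ 2 * t ^ 2) ≤ c₁ ^ 2 * (χ ^ 2 * (L ^ 2 + t ^ 2)) := by
    gcongr
    nlinarith [sq_nonneg L]
  have s3 : ∀ x l, |x| ≤ c₂ * (L + t) → |x * (ζ ^ 2 * τ l + ζ * E l)| ≤
      1 / 8 * (ζ ^ 2 * ∑ k, τ k ^ 2) + 5 * c₂ ^ 2 * (χ ^ 2 * (L ^ 2 + t ^ 2)) +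
        1 / 2 * (c₁ ^ 2 * (χ ^ 2 * t ^ 2)) := by
    intro x l hx
    have h1 := hc2 x hx
    have h2 := hE2 l
    have h3 : ζ ^ 2 * τ l ^ 2 ≤ ζ ^ 2 * ∑ k, τ k ^ 2 := by
      gcongr
      exact s1 l
    have q1 := sq_nonneg (ζ * τ l - 4 * (ζ * x))
    have q2 := sq_nonneg (ζ * τ l + 4 * (ζ * x))
    have q3 := sq_nonneg (ζ * x - E l)
    have q4 := sq_nonneg (ζ * x + E l)
    rw [abs_le]
    constructor <;> linarith
  have hi := (abs_le.mp (s3 cj i hcj)).1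
  have hj := (abs_le.mp (s3 ci j hci)).2
  have hd0 : d * (c₁ ^ 2 * (χ ^ 2 * t ^ 2)) ≤ d * (c₁ ^ 2 * (χ ^ 2 * (L ^ 2 + t ^ 2))) :=
    mul_le_mul_of_nonneg_left hχt (Nat.cast_nonneg d)
  nlinarith

end

/-! ### The `H²` estimate under the Neumann condition -/

section

variable {d : ℕ} {Ω : Set (Space d)}

lemma exists_common_bound {ι X : Type*} [Fintype ι] {f : ι → X → ℝ}
    (h : ∀ i, ∃ C : ℝ, 0 ≤ C ∧ ∀ x, |f i x| ≤ C) : ∃ C : ℝ, 0 ≤ C ∧ ∀ i x, |f i x| ≤ C := by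
  choose C hC0 hC using h
  exact ⟨∑ i, C i, Finset.sum_nonneg fun i _ => hC0 i, fun i x => (hC i x).trans
    (Finset.single_le_sum (f := C) (fun i _ => hC0 i) (Finset.mem_univ i))⟩

lemma fderiv_comp_fst_xDir {a : Space d → ℝ} (ha : ContDiff ℝ ∞ a) (z : SpaceTime d) (i : Fin d) :
    fderiv ℝ (fun z : SpaceTime d => a z.1) z (xDir i) = fderiv ℝ a z.1 (spaceDir i) := by
  have h : HasFDerivAt (fun z : SpaceTime d => a z.1)
      ((fderiv ℝ a z.1).comp (ContinuousLinearMap.fst ℝ (Space d) ℝ)) z :=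
    ((ha.differentiable (by simp) z.1).hasFDerivAt).comp z hasFDerivAt_fst
  rw [h.fderiv]
  simp [xDir]

lemma nrm_comp_fst {ρ : Space d → ℝ} (hρ : ContDiff ℝ ∞ ρ) (i : Fin d) (z : SpaceTime d) :
    nrm (fun z => ρ z.1) i z = fderiv ℝ ρ z.1 (spaceDir i) :=
  fderiv_comp_fst_xDir hρ z i

lemma fderiv_nrm_comp_fst {ρ : Space d → ℝ} (hρ : ContDiff ℝ ∞ ρ) (i k : Fin d)
    (z : SpaceTime d) : fderiv ℝ (nrm (fun z => ρ z.1) i) z (xDir k) =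
      fderiv ℝ (fun x => fderiv ℝ ρ x (spaceDir i)) z.1 (spaceDir k) := by
  have : nrm (fun z : SpaceTime d => ρ z.1) i = fun z => fderiv ℝ ρ z.1 (spaceDir i) := by
    ext z
    exact nrm_comp_fst hρ i z
  rw [this]
  exact fderiv_comp_fst_xDir (contDiff_fderiv_apply hρ _) z k

/-- The weak Hessian is symmetric. -/
lemma IsH21.hess_symm {D : Set (SpaceTime d)} {u ut : SpaceTime d → ℝ} {Du : SpaceTime d → Space d}
    {D2u : Fin d → Fin d → SpaceTime d → ℝ} (hD : IsOpen D)
    [IsFiniteMeasure ((volume : Measure (SpaceTime d)).restrict D)]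
    (h : IsH21 D u ut Du D2u) (i j : Fin d) :
    D2u i j =ᵐ[volume.restrict D] D2u j i := by
  refine ae_eq_of_forall_test hD ((h.hess i j).memLp_deriv.integrable (by norm_num))
    ((h.hess j i).memLp_deriv.integrable (by norm_num)) fun φ hφ => ?_
  have key : ∀ i j, ∫ z in D, D2u i j z * φ z =
      ∫ z in D, u z * fderiv ℝ (fun z => fderiv ℝ φ z (xDir i)) z (xDir j) := by
    intro i j
    have h1 := (h.hess i j).integral_test hφ
    have h2 := (h.grad j).integral_test (hφ.fderiv_apply (xDir i))
    linarith
  rw [key, key]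
  congr 1 with z
  rw [fderiv_fderiv_comm hφ.smooth]

section Local

variable {p : Space d} {ρ η : Space d → ℝ} {r c : ℝ}

lemma abs_apply_le_norm (x : Space d) (i : Fin d) : |x i| ≤ ‖x‖ := PiLp.norm_apply_le x i

/-- Near a point of the closure, the tangential derivatives of the gradient are controlled by the
Laplacian and the gradient. -/
lemma IsChart.exists_tang_estimate (h : IsChart Ω p ρ r c) (hΩ : IsOpen Ω)
    (hb : Bornology.IsBounded Ω) (hη : IsTest (Metric.ball p r) η) (hη1 : ∀ x, |η x| ≤ 1) :
    ∃ C : ℝ, 0 ≤ C ∧ ∀ (T : ℝ) (u ut : SpaceTime d → ℝ) (Du : SpaceTime d → Space d)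
      (D2u : Fin d → Fin d → SpaceTime d → ℝ), IsH21 (stCylinder Ω 0 T) u ut Du D2u →
      NeumannZero Ω T Du D2u → ∀ χ : ℝ → ℝ, IsTest (Ioo 0 T) χ → ∀ i j,
      ∫ z in stCylinder Ω 0 T, (η z.1 * χ z.2) ^ 2 *
        ∑ k, tang (fun z => ρ z.1) D2u i j k z ^ 2 ≤
      C * ∫ z in stCylinder Ω 0 T, χ z.2 ^ 2 * (lap D2u z ^ 2 + ‖Du z‖ ^ 2) := by
  have hρ := h.test.smooth
  obtain ⟨M₁, hM₁, hN⟩ := exists_common_bound (f := fun (i : Fin d) x => fderiv ℝ ρ x (spaceDir i))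
    fun i => (h.test.fderiv_apply _).exists_bound
  obtain ⟨M₂, hM₂, hN'⟩ := exists_common_bound (f := fun (q : Fin d × Fin d) x =>
    fderiv ℝ (fun x => fderiv ℝ ρ x (spaceDir q.1)) x (spaceDir q.2))
    fun q => ((h.test.fderiv_apply _).fderiv_apply _).exists_bound
  obtain ⟨M₃, hM₃, hη'⟩ := exists_common_bound (f := fun (i : Fin d) x => fderiv ℝ η x (spaceDir i))
    fun i => (hη.fderiv_apply _).exists_bound
  set M := M₁ + M₂ + M₃ with hM
  have hM0 : 0 ≤ M := by positivity
  set R : SpaceTime d → ℝ := fun z => ρ z.1 with hRdef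
  have hR : ContDiff ℝ ∞ R := hρ.comp contDiff_fst
  have bN : ∀ i z, |nrm R i z| ≤ M := fun i z => by
    rw [nrm_comp_fst hρ]
    exact (hN i z.1).trans (by linarith)
  have bN' : ∀ i k z, |fderiv ℝ (nrm R i) z (xDir k)| ≤ M := fun i k z => by
    rw [fderiv_nrm_comp_fst hρ]
    exact (hN' (i, k) z.1).trans (by linarith)
  have bη : ∀ k x, |fderiv ℝ η x (spaceDir k)| ≤ M := fun k x =>
    (hη' k x).trans (by linarith)
  set c₁ := 4 * M ^ 2 + 2 * M with hc₁
  set c₂ := M * (d + 1) with hc₂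
  refine ⟨2 * ((d + 1) * c₁ ^ 2 + 10 * c₂ ^ 2), by positivity,
    fun T u ut Du D2u hu hNz χ hχ i j => ?_⟩
  have hD := isOpen_stCylinder hΩ 0 T
  have hfin := isFiniteMeasure_stCylinder hb 0 T
  set Q := stCylinder Ω 0 T with hQ
  let U : Set (SpaceTime d) := Metric.ball p r ×ˢ Ioo 0 T
  have hU : IsOpen U := Metric.isOpen_ball.prod isOpen_Ioo
  have hUQ : ∀ z ∈ U, (z ∈ Q ↔ R z < 0) := fun z hz => by
    rw [← h.mem_iff z.1 hz.1]
    exact ⟨fun h' => h'.1, fun h' => ⟨h', hz.2⟩⟩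
  -- the space-time cutoff
  let ζ : SpaceTime d → ℝ := fun z => η z.1 * χ z.2
  have hζs : ContDiff ℝ ∞ ζ := (hη.smooth.comp contDiff_fst).mul (hχ.smooth.comp contDiff_snd)
  have hζsub : tsupport ζ ⊆ tsupport η ×ˢ tsupport χ := by
    refine closure_minimal (fun z hz => ?_) ((isClosed_tsupport η).prod (isClosed_tsupport χ))
    refine ⟨subset_closure fun h0 => hz ?_, subset_closure fun h0 => hz ?_⟩
    · simp [ζ, h0]
    · simp [ζ, h0]
  have hζ : IsTest U ζ := ⟨hζs, (hη.compact.isCompact.prod hχ.compact.isCompact).of_isClosed_subset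
    (isClosed_tsupport ζ) hζsub, hζsub.trans (prod_mono hη.subset hχ.subset)⟩
  have hζχ : ∀ z, |ζ z| ≤ |χ z.2| := fun z => by
    rw [abs_mul]
    exact mul_le_of_le_one_left (abs_nonneg _) (hη1 _)
  have hζ' : ∀ k z, fderiv ℝ ζ z (xDir k) = fderiv ℝ η z.1 (spaceDir k) * χ z.2 := by
    intro k z
    have := fderiv_mul_apply (φ := fun z : SpaceTime d => η z.1)
      (ψ := fun z : SpaceTime d => χ z.2) (hη.smooth.comp contDiff_fst)
      (hχ.smooth.comp contDiff_snd) z (xDir k)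
    rw [fderiv_comp_snd_xDir hχ.smooth, fderiv_comp_fst_xDir hη.smooth] at this
    simpa using this
  -- the function `ζ² (N_i ∂_j u - N_j ∂_i u)`
  have ta : ∀ i, IsTest U (fun z => ζ z * nrm R i z * ζ z) := fun i =>
    hζ.smooth_mul (hζs.mul (contDiff_nrm hR i))
  have hw : ∀ i j k, HasWeakDeriv Q (xDir k) (fun z => ζ z * nrm R i z * ζ z * Du z j)
      (fun z => ζ z * nrm R i z * ζ z * D2u k j z +
        fderiv ℝ (fun z => ζ z * nrm R i z * ζ z) z (xDir k) * Du z j) := by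
    intro i j k
    obtain ⟨B₁, -, hB₁⟩ := (ta i).exists_bound
    obtain ⟨B₂, -, hB₂⟩ := ((ta i).fderiv_apply (xDir k)).exists_bound
    exact (hu.hess k j).smooth_mul hD.measurableSet (ta i).smooth (C := max B₁ B₂)
      (fun z _ => (hB₁ z).trans (le_max_left _ _)) (fun z _ => (hB₂ z).trans (le_max_right _ _))
  let Ψ : SpaceTime d → ℝ := fun z =>
    ζ z * nrm R i z * ζ z * Du z j - ζ z * nrm R j z * ζ z * Du z i
  let Ψk : Fin d → SpaceTime d → ℝ := fun k z =>
    (ζ z * nrm R i z * ζ z * D2u k j z +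
      fderiv ℝ (fun z => ζ z * nrm R i z * ζ z) z (xDir k) * Du z j) -
    (ζ z * nrm R j z * ζ z * D2u k i z +
      fderiv ℝ (fun z => ζ z * nrm R j z * ζ z) z (xDir k) * Du z i)
  have hΨ : ∀ k, HasWeakDeriv Q (xDir k) Ψ (Ψk k) := fun k => (hw i j k).sub (hw j i k)
  have hz0 : ∀ z ∉ tsupport ζ, ζ z = 0 := fun z hz => image_eq_zero_of_notMem_tsupport hz
  have hz1 : ∀ i k, ∀ z ∉ tsupport ζ, fderiv ℝ (fun z => ζ z * nrm R i z * ζ z) z (xDir k) = 0 := by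
    intro i k z hz
    refine image_eq_zero_of_notMem_tsupport
      (f := fun z => fderiv ℝ (fun z => ζ z * nrm R i z * ζ z) z (xDir k)) fun hm => hz ?_
    exact tsupport_mul_subset_right (tsupport_fderiv_apply_subset _ _ hm)
  -- the coefficients of the tested identity
  have mN : ∀ {f : SpaceTime d → ℝ} (i : Fin d), MemLp f 2 (volume.restrict Q) →
      MemLp (fun z => nrm R i z * f z) 2 (volume.restrict Q) := fun i hf =>
    hf.bdd_mul_two (contDiff_nrm hR i).continuous.aestronglyMeasurable (ae_of_all _ (bN i))
  have mT : ∀ k, MemLp (tang R D2u i j k) 2 (volume.restrict Q) := fun k =>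
    (mN i (hu.hess j k).memLp_deriv).sub (mN j (hu.hess i k).memLp_deriv)
  have mC : ∀ i, MemLp (comm R Du D2u i) 2 (volume.restrict Q) := by
    intro i
    have h1 : MemLp (fun z => lap D2u z * nrm R i z) 2 (volume.restrict Q) := by
      simpa only [mul_comm] using mN i hu.memLp_lap
    have h2 : MemLp (fun z => ∑ l, Du z l * fderiv ℝ (nrm R i) z (xDir l)) 2
        (volume.restrict Q) := by
      refine memLp_finsetSum _ fun l _ => ?_
      have := (hu.grad l).memLp_deriv.bdd_mul_two
        (contDiff_fderiv_apply (contDiff_nrm hR i) (xDir l)).continuous.aestronglyMeasurable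
        (ae_of_all _ (bN' i l))
      simpa only [mul_comm] using this
    exact h1.add h2
  let A : Fin d → SpaceTime d → ℝ := fun k z => tang R D2u i j k z -
    (if k = j then comm R Du D2u i z else 0) + (if k = i then comm R Du D2u j z else 0)
  have hA : ∀ k, MemLp (A k) 2 (volume.restrict Q) := by
    intro k
    refine ((mT k).sub ?_).add ?_
    · split_ifs
      · exact mC i
      · exact MemLp.zero'
    · split_ifs
      · exact mC j
      · exact MemLp.zero'
  have hAsum : ∀ (f : Fin d → ℝ) z, ∑ k, A k z * f k = (∑ k, tang R D2u i j k z * f k) -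
      comm R Du D2u i z * f j + comm R Du D2u j z * f i := by
    intro f z
    simp only [A, add_mul, sub_mul, Finset.sum_add_distrib, Finset.sum_sub_distrib, ite_mul,
      zero_mul, Finset.sum_ite_eq', Finset.mem_univ, if_true]
  have key := integral_eq_zero_of_transversal hΩ hU hA hΨ hζ.compact.isCompact hζ.subset
    (fun z hz => by simp [Ψ, hz0 z hz])
    (fun k z hz => by simp [Ψk, hz0 z hz, hz1 i k z hz, hz1 j k z hz])
    (fun δ hδ => by
      obtain ⟨y, s, hs, hys, hsh⟩ := h.shift δ hδ
      refine ⟨(y, 0), min s (δ / 2), by positivity, fun w hw' => ?_, fun z hz w hw' => ?_⟩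
      · rw [← closedBall_prod_same] at hw'
        have h1 : w.1 ∈ Metric.ball 0 δ :=
          hys (Metric.closedBall_subset_closedBall (min_le_left _ _) hw'.1)
        have h2 : |w.2| ≤ min s (δ / 2) := by simpa [Real.dist_eq] using hw'.2
        have h3 := min_le_right s (δ / 2)
        rw [mem_ball_zero_iff] at h1 ⊢
        rw [Prod.norm_def, Real.norm_eq_abs]
        exact max_lt h1 (by linarith)
      · rw [← closedBall_prod_same] at hw'
        exact hsh z.1 ⟨hz.1.1, hz.2.1⟩ w.1
          (Metric.closedBall_subset_closedBall (min_le_left _ _) hw'.1))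
    (fun ψ hψ => by
      refine Eq.trans (integral_congr_ae (ae_of_all _ fun z => ?_))
        (hNz.integral_tang hΩ hu hR hUQ i j hψ)
      have := hAsum (fun k => fderiv ℝ ψ z (xDir k)) z
      dsimp only at this ⊢
      rw [this]
      ring)
  -- absorption
  let E : Fin d → SpaceTime d → ℝ := fun k z =>
    2 * fderiv ℝ ζ z (xDir k) * (nrm R i z * Du z j - nrm R j z * Du z i) +
      ζ z * (fderiv ℝ (nrm R i) z (xDir k) * Du z j - fderiv ℝ (nrm R j) z (xDir k) * Du z i)
  have hder : ∀ i k z, fderiv ℝ (fun z => ζ z * nrm R i z * ζ z) z (xDir k) =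
      ζ z * (2 * fderiv ℝ ζ z (xDir k) * nrm R i z + ζ z * fderiv ℝ (nrm R i) z (xDir k)) := by
    intro i k z
    rw [fderiv_mul_apply (hζs.mul (contDiff_nrm hR i)) hζs,
      fderiv_mul_apply hζs (contDiff_nrm hR i)]
    ring
  have hsymm : ∀ᵐ z ∂(volume.restrict Q), ∀ i j, D2u i j z = D2u j i z := by
    rw [ae_all_iff]
    intro i
    rw [ae_all_iff]
    exact fun j => hu.hess_symm hD i j
  have hEb : ∀ z k, |E k z| ≤ c₁ * |χ z.2| * ‖Du z‖ := by
    intro z k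
    have d1 : ∀ (a b : ℝ) (i j : Fin d), |a| ≤ M → |b| ≤ M →
        |a * Du z j - b * Du z i| ≤ 2 * M * ‖Du z‖ := by
      intro a b i j ha hb
      refine (abs_sub _ _).trans ?_
      rw [abs_mul, abs_mul]
      have := mul_le_mul ha (abs_apply_le_norm (Du z) j) (abs_nonneg _) hM0
      have := mul_le_mul hb (abs_apply_le_norm (Du z) i) (abs_nonneg _) hM0
      linarith
    have d2 : |fderiv ℝ ζ z (xDir k)| ≤ M * |χ z.2| := by
      rw [hζ', abs_mul]
      exact mul_le_mul_of_nonneg_right (bη k z.1) (abs_nonneg _)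
    refine (abs_add_le _ _).trans ?_
    rw [abs_mul, abs_mul, abs_mul, abs_two]
    have e1 := mul_le_mul d2 (d1 _ _ i j (bN i z) (bN j z)) (abs_nonneg _) (by positivity)
    have e2 := mul_le_mul (hζχ z) (d1 _ _ i j (bN' i k z) (bN' j k z)) (abs_nonneg _)
      (by positivity)
    rw [hc₁]
    linarith
  have hCb : ∀ z i, |comm R Du D2u i z| ≤ c₂ * (|lap D2u z| + ‖Du z‖) := by
    intro z i
    refine (abs_add_le _ _).trans ?_
    have e1 : |lap D2u z * nrm R i z| ≤ |lap D2u z| * M := by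
      rw [abs_mul]
      exact mul_le_mul_of_nonneg_left (bN i z) (abs_nonneg _)
    have e2 : |∑ l, Du z l * fderiv ℝ (nrm R i) z (xDir l)| ≤ d * (‖Du z‖ * M) := by
      refine (Finset.abs_sum_le_sum_abs _ _).trans ?_
      refine (Finset.sum_le_card_nsmul _ _ (‖Du z‖ * M) fun l _ => ?_).trans (by simp)
      rw [abs_mul]
      exact mul_le_mul (abs_apply_le_norm _ _) (bN' i l z) (abs_nonneg _) (norm_nonneg _)
    have e3 : 0 ≤ d * (|lap D2u z| * M) := by positivity
    have e4 : 0 ≤ ‖Du z‖ * M := by positivity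
    rw [hc₂]
    linarith
  obtain ⟨B, -, hB⟩ := hχ.exists_bound
  have hχm : AEStronglyMeasurable (fun z : SpaceTime d => χ z.2 ^ 2) (volume.restrict Q) :=
    ((hχ.continuous.comp continuous_snd).pow 2).aestronglyMeasurable
  have hχb : ∀ z : SpaceTime d, ‖χ z.2 ^ 2‖ ≤ B ^ 2 := fun z => by
    rw [norm_pow]
    exact pow_le_pow_left₀ (norm_nonneg _) (hB _) 2
  have iR : Integrable (fun z => χ z.2 ^ 2 * (lap D2u z ^ 2 + ‖Du z‖ ^ 2)) (volume.restrict Q) :=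
    (hu.memLp_lap.integrable_sq.add (hu.memLp_grad.integrable_norm_pow (by norm_num))).bdd_mul
      (c := B ^ 2) hχm (ae_of_all _ hχb)
  have iL : Integrable (fun z => (η z.1 * χ z.2) ^ 2 * ∑ k, tang R D2u i j k z ^ 2)
      (volume.restrict Q) := by
    refine (integrable_finsetSum _ fun k _ => (mT k).integrable_sq).bdd_mul (c := B ^ 2)
      (hζs.continuous.pow 2).aestronglyMeasurable (ae_of_all _ fun z => ?_)
    rw [norm_pow]
    exact pow_le_pow_left₀ (norm_nonneg _) ((hζχ z).trans (hB _)) 2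
  have iA : Integrable (fun z => ∑ k, A k z * Ψk k z) (volume.restrict Q) :=
    integrable_finsetSum _ fun k _ => (hA k).integrable_mul_two (hΨ k).memLp_deriv
  have hpt : ∀ᵐ z ∂(volume.restrict Q), (η z.1 * χ z.2) ^ 2 * ∑ k, tang R D2u i j k z ^ 2 ≤
      2 * (∑ k, A k z * Ψk k z) + 2 * ((d + 1) * c₁ ^ 2 + 10 * c₂ ^ 2) *
        (χ z.2 ^ 2 * (lap D2u z ^ 2 + ‖Du z‖ ^ 2)) := by
    filter_upwards [hsymm] with z hz
    have e1 : ∀ k, Ψk k z = ζ z ^ 2 * tang R D2u i j k z + ζ z * E k z := by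
      intro k
      simp only [Ψk, E, tang, hder, hz k j, hz k i]
      ring
    have e2 := tangential_absorb (ζ := ζ z) (χ := χ z.2) (L := |lap D2u z|) (t := ‖Du z‖)
      (τ := fun k => tang R D2u i j k z) (E := fun k => E k z) i j
      (sq_le_sq.mpr (hζχ z))
      (hEb z) (hCb z i) (hCb z j)
    rw [hAsum fun k => Ψk k z]
    simp only [e1]
    rw [sq_abs] at e2
    simp only [ζ] at e2 ⊢
    linarith
  calc _ ≤ ∫ z in Q, (2 * (∑ k, A k z * Ψk k z) + 2 * ((d + 1) * c₁ ^ 2 + 10 * c₂ ^ 2) *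
        (χ z.2 ^ 2 * (lap D2u z ^ 2 + ‖Du z‖ ^ 2))) :=
        integral_mono_ae iL ((iA.const_mul 2).add (iR.const_mul _)) hpt
    _ = _ := by
        rw [integral_add (iA.const_mul 2) (iR.const_mul _), integral_const_mul, key,
          integral_const_mul]
        ring

end Local

end

section

variable {d : ℕ} {Ω : Set (Space d)}

lemma exists_sq_le_of_tangential {c M : ℝ} (hc : 0 < c) (hM : 0 ≤ M) :
    ∃ A : ℝ, ∀ (N : Fin d → ℝ) (D : Fin d → Fin d → ℝ), c ≤ ∑ i, N i ^ 2 → (∀ i, |N i| ≤ M) →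
      (∀ i j, D i j = D j i) → ∀ j k, D j k ^ 2 ≤ A ^ 2 * ((∑ i, D i i) ^ 2 +
        ∑ i, ∑ j, ∑ k, (N i * D j k - N j * D i k) ^ 2) := by
  refine ⟨d * M / c + M ^ 2 / c + d ^ 2 * M ^ 3 / c ^ 2 + M ^ 3 * d ^ 2 / c ^ 2,
    fun N D hN hNM hD j k => ?_⟩
  set τ := ∑ i, ∑ j, ∑ k, (N i * D j k - N j * D i k) ^ 2 with hτ
  have hτ0 : 0 ≤ τ := by positivity
  have hτi : ∀ i j k, (N i * D j k - N j * D i k) ^ 2 ≤ τ := by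
    intro i j k
    have h1 := Finset.single_le_sum (f := fun k => (N i * D j k - N j * D i k) ^ 2)
      (fun _ _ => sq_nonneg _) (Finset.mem_univ k)
    have h2 := Finset.single_le_sum (f := fun j => ∑ k, (N i * D j k - N j * D i k) ^ 2)
      (fun _ _ => Finset.sum_nonneg fun _ _ => sq_nonneg _) (Finset.mem_univ j)
    have h3 := Finset.single_le_sum (f := fun i => ∑ j, ∑ k, (N i * D j k - N j * D i k) ^ 2)
      (fun _ _ => Finset.sum_nonneg fun _ _ => Finset.sum_nonneg fun _ _ => sq_nonneg _)
      (Finset.mem_univ i)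
    exact h1.trans (h2.trans h3)
  have hbd : ∀ x : ℝ, x ^ 2 ≤ (∑ i, D i i) ^ 2 + τ → |x| ≤ √((∑ i, D i i) ^ 2 + τ) :=
    fun x hx => Real.abs_le_sqrt hx
  have hsq := sq_le_of_forall_abs_le (sq_le_of_tangential hc hM hN hNM hD
    (hbd _ (le_add_of_nonneg_right hτ0))
    (fun i j k => hbd _ ((hτi i j k).trans (le_add_of_nonneg_left (sq_nonneg _)))) j k)
  rwa [mul_pow, Real.sq_sqrt (by positivity)] at hsq

/-- The Hessian is controlled by the Laplacian and the gradient near each point of the closure. -/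
lemma IsChart.exists_hess_estimate {p : Space d} {ρ : Space d → ℝ} {r c : ℝ}
    (h : IsChart Ω p ρ r c) (hΩ : IsOpen Ω) (hb : Bornology.IsBounded Ω) :
    ∃ C : ℝ, 0 ≤ C ∧ ∀ (T : ℝ) (u ut : SpaceTime d → ℝ) (Du : SpaceTime d → Space d)
      (D2u : Fin d → Fin d → SpaceTime d → ℝ), IsH21 (stCylinder Ω 0 T) u ut Du D2u →
      NeumannZero Ω T Du D2u → ∀ χ : ℝ → ℝ, IsTest (Ioo 0 T) χ → ∀ j k,
      ∫ z in stCylinder Ω 0 T, (Metric.ball p (r / 2)).indicator 1 z.1 *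
        (χ z.2 ^ 2 * D2u j k z ^ 2) ≤
      C * ∫ z in stCylinder Ω 0 T, χ z.2 ^ 2 * (lap D2u z ^ 2 + ‖Du z‖ ^ 2) := by
  have hr := h.r_pos
  let η : ContDiffBump p := ⟨r / 2, 3 * r / 4, by positivity, by linarith⟩
  have hη : IsTest (Metric.ball p r) η := by
    refine ⟨η.contDiff, η.hasCompactSupport, ?_⟩
    rw [η.tsupport_eq]
    exact Metric.closedBall_subset_ball (by simp only [η]; linarith)
  have hη1 : ∀ x, |η x| ≤ 1 := fun x => by
    rw [abs_of_nonneg η.nonneg]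
    exact η.le_one
  obtain ⟨C, hC0, hC⟩ := h.exists_tang_estimate hΩ hb hη hη1
  obtain ⟨M, hM, hN⟩ := exists_common_bound (f := fun (i : Fin d) x => fderiv ℝ ρ x (spaceDir i))
    fun i => (h.test.fderiv_apply _).exists_bound
  obtain ⟨A, hA⟩ := exists_sq_le_of_tangential (d := d) h.c_pos hM
  refine ⟨A ^ 2 * (1 + d * (d * C)), by positivity, fun T u ut Du D2u hu hNz χ hχ j k => ?_⟩
  have hD := isOpen_stCylinder hΩ 0 T
  have hfin := isFiniteMeasure_stCylinder hb 0 T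
  set Q := stCylinder Ω 0 T with hQ
  set R : SpaceTime d → ℝ := fun z => ρ z.1 with hRdef
  have hρ := h.test.smooth
  have hR : ContDiff ℝ ∞ R := hρ.comp contDiff_fst
  have hsymm : ∀ᵐ z ∂(volume.restrict Q), ∀ i j, D2u i j z = D2u j i z := by
    rw [ae_all_iff]
    intro i
    rw [ae_all_iff]
    exact fun j => hu.hess_symm hD i j
  have bN : ∀ i z, |nrm R i z| ≤ M := fun i z => by
    rw [nrm_comp_fst hρ]
    exact hN i z.1
  have mN : ∀ {f : SpaceTime d → ℝ} (i : Fin d), MemLp f 2 (volume.restrict Q) →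
      MemLp (fun z => nrm R i z * f z) 2 (volume.restrict Q) := fun i hf =>
    hf.bdd_mul_two (contDiff_nrm hR i).continuous.aestronglyMeasurable (ae_of_all _ (bN i))
  have mT : ∀ i j k, MemLp (tang R D2u i j k) 2 (volume.restrict Q) := fun i j k =>
    (mN i (hu.hess j k).memLp_deriv).sub (mN j (hu.hess i k).memLp_deriv)
  obtain ⟨B, -, hB⟩ := hχ.exists_bound
  have hχc := hχ.continuous
  have bχ : ∀ {f : SpaceTime d → ℝ}, Integrable f (volume.restrict Q) →
      Integrable (fun z => χ z.2 ^ 2 * f z) (volume.restrict Q) := fun hf => by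
    refine hf.bdd_mul (c := B ^ 2) (by fun_prop) (ae_of_all _ fun z => ?_)
    rw [norm_pow]
    exact pow_le_pow_left₀ (norm_nonneg _) (hB _) 2
  have iL := bχ hu.memLp_lap.integrable_sq
  have iD := bχ (hu.memLp_grad.integrable_norm_pow (p := 2) (by norm_num))
  have iLD : Integrable (fun z => χ z.2 ^ 2 * (lap D2u z ^ 2 + ‖Du z‖ ^ 2)) (volume.restrict Q) := by
    simp only [mul_add]
    exact iL.add iD
  have iT : ∀ i j, Integrable (fun z => (η z.1 * χ z.2) ^ 2 * ∑ k, tang R D2u i j k z ^ 2)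
      (volume.restrict Q) := by
    intro i j
    refine (integrable_finsetSum _ fun k _ => (mT i j k).integrable_sq).bdd_mul (c := B ^ 2)
      ?_ (ae_of_all _ fun z => ?_)
    · exact (((η.contDiff (n := 0)).continuous.comp continuous_fst).mul
        (hχc.comp continuous_snd)).pow 2 |>.aestronglyMeasurable
    · rw [norm_pow, norm_mul]
      refine pow_le_pow_left₀ (by positivity) ?_ 2
      exact (mul_le_of_le_one_left (norm_nonneg _) (hη1 _)).trans (hB _)
  have iH : Integrable (fun z : SpaceTime d => (Metric.ball p (r / 2)).indicator 1 z.1 *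
      (χ z.2 ^ 2 * D2u j k z ^ 2)) (volume.restrict Q) := by
    refine (bχ (hu.hess j k).memLp_deriv.integrable_sq).bdd_mul (c := 1) ?_ (ae_of_all _ fun z => ?_)
    · exact ((measurable_one.indicator measurableSet_ball).comp
        measurable_fst).aestronglyMeasurable
    · refine (norm_indicator_le_norm_self _ _).trans (by simp)
  have hpt : ∀ᵐ z ∂(volume.restrict Q), (Metric.ball p (r / 2)).indicator 1 z.1 *
      (χ z.2 ^ 2 * D2u j k z ^ 2) ≤ A ^ 2 * (χ z.2 ^ 2 * (lap D2u z ^ 2 + ‖Du z‖ ^ 2) +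
        ∑ i, ∑ j, (η z.1 * χ z.2) ^ 2 * ∑ k, tang R D2u i j k z ^ 2) := by
    filter_upwards [hsymm] with z hz
    by_cases hzb : z.1 ∈ Metric.ball p (r / 2)
    · have hη' : η z.1 = 1 := η.one_of_mem_closedBall (Metric.ball_subset_closedBall hzb)
      rw [indicator_of_mem hzb, Pi.one_apply, one_mul, hη', one_mul]
      have hsq : D2u j k z ^ 2 ≤ A ^ 2 * (lap D2u z ^ 2 +
          ∑ i, ∑ j, ∑ k, tang R D2u i j k z ^ 2) := by
        refine hA (fun i => nrm R i z) (fun i j => D2u i j z) ?_ (fun i => bN i z) hz j k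
        simp only [hRdef, nrm_comp_fst hρ]
        exact h.le_sum_sq z.1 (Metric.ball_subset_ball (by linarith) hzb)
      set τ := ∑ i, ∑ j, ∑ k, tang R D2u i j k z ^ 2 with hτ
      simp only [← Finset.mul_sum]
      rw [← hτ, ← mul_add]
      calc χ z.2 ^ 2 * D2u j k z ^ 2 ≤ χ z.2 ^ 2 * (A ^ 2 * (lap D2u z ^ 2 + τ)) :=
            mul_le_mul_of_nonneg_left hsq (sq_nonneg _)
        _ = A ^ 2 * (χ z.2 ^ 2 * (lap D2u z ^ 2 + τ)) := by ring
        _ ≤ A ^ 2 * (χ z.2 ^ 2 * (lap D2u z ^ 2 + ‖Du z‖ ^ 2 + τ)) := by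
            gcongr
            exact le_add_of_nonneg_right (sq_nonneg _)
    · rw [indicator_of_notMem hzb, zero_mul]
      positivity
  set X := ∫ z in Q, χ z.2 ^ 2 * (lap D2u z ^ 2 + ‖Du z‖ ^ 2) with hX
  have iS : Integrable (fun z => ∑ i, ∑ j, (η z.1 * χ z.2) ^ 2 * ∑ k, tang R D2u i j k z ^ 2)
      (volume.restrict Q) :=
    integrable_finsetSum _ fun i _ => integrable_finsetSum _ fun j _ => iT i j
  have hS : ∫ z in Q, ∑ i, ∑ j, (η z.1 * χ z.2) ^ 2 * ∑ k, tang R D2u i j k z ^ 2 ≤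
      d * (d * (C * X)) := by
    rw [integral_finsetSum _ fun i _ => integrable_finsetSum _ fun j _ => iT i j]
    refine (Finset.sum_le_card_nsmul _ _ (d * (C * X)) fun i _ => ?_).trans (by simp)
    rw [integral_finsetSum _ fun j _ => iT i j]
    exact (Finset.sum_le_card_nsmul _ _ (C * X) fun j _ => hC T u ut Du D2u hu hNz χ hχ i j).trans
      (by simp)
  refine (integral_mono_ae iH ((iLD.add iS).const_mul (A ^ 2)) hpt).trans ?_
  simp only [Pi.add_apply]
  rw [integral_const_mul, integral_add iLD iS, mul_assoc]
  refine mul_le_mul_of_nonneg_left ?_ (sq_nonneg A)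
  rw [add_mul, one_mul]
  refine add_le_add_right (hS.trans (le_of_eq (by ring))) X |>.trans_eq' ?_
  rfl

/-- The global `L²` estimate of the Hessian on time slabs. -/
lemma IsSmoothBoundedDomain.exists_hess_estimate (hd : 0 < d) (hΩ : IsSmoothBoundedDomain Ω) :
    ∃ C : ℝ, 0 ≤ C ∧ ∀ (T : ℝ) (u ut : SpaceTime d → ℝ) (Du : SpaceTime d → Space d)
      (D2u : Fin d → Fin d → SpaceTime d → ℝ), IsH21 (stCylinder Ω 0 T) u ut Du D2u →
      NeumannZero Ω T Du D2u → ∀ χ : ℝ → ℝ, IsTest (Ioo 0 T) χ → ∀ j k,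
      ∫ z in stCylinder Ω 0 T, χ z.2 ^ 2 * D2u j k z ^ 2 ≤
      C * ∫ z in stCylinder Ω 0 T, χ z.2 ^ 2 * (lap D2u z ^ 2 + ‖Du z‖ ^ 2) := by
  have hloc : ∀ p : Space d, ∃ (r C : ℝ), 0 < r ∧ 0 ≤ C ∧ (p ∈ closure Ω →
      ∀ (T : ℝ) (u ut : SpaceTime d → ℝ) (Du : SpaceTime d → Space d)
      (D2u : Fin d → Fin d → SpaceTime d → ℝ), IsH21 (stCylinder Ω 0 T) u ut Du D2u →
      NeumannZero Ω T Du D2u → ∀ χ : ℝ → ℝ, IsTest (Ioo 0 T) χ → ∀ j k,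
      ∫ z in stCylinder Ω 0 T, (Metric.ball p r).indicator 1 z.1 * (χ z.2 ^ 2 * D2u j k z ^ 2) ≤
      C * ∫ z in stCylinder Ω 0 T, χ z.2 ^ 2 * (lap D2u z ^ 2 + ‖Du z‖ ^ 2)) := by
    intro p
    by_cases hp : p ∈ closure Ω
    · obtain ⟨ρ, r, c, h⟩ := hΩ.exists_isChart hd hp
      obtain ⟨C, hC0, hC⟩ := h.exists_hess_estimate hΩ.isOpen hΩ.isBounded
      exact ⟨r / 2, C, half_pos h.r_pos, hC0, fun _ => hC⟩
    · exact ⟨1, 0, one_pos, le_rfl, fun h => absurd h hp⟩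
  choose r C hr hC0 hC using hloc
  obtain ⟨t, ht, hcov⟩ := hΩ.isBounded.isCompact_closure.elim_nhds_subcover
    (fun p => Metric.ball p (r p)) fun p _ => Metric.ball_mem_nhds p (hr p)
  refine ⟨∑ p ∈ t, C p, Finset.sum_nonneg fun p _ => hC0 p,
    fun T u ut Du D2u hu hNz χ hχ j k => ?_⟩
  have hD := isOpen_stCylinder hΩ.isOpen 0 T
  obtain ⟨B, -, hB⟩ := hχ.exists_bound
  have hχc := hχ.continuous
  have iH : Integrable (fun z : SpaceTime d => χ z.2 ^ 2 * D2u j k z ^ 2)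
      (volume.restrict (stCylinder Ω 0 T)) := by
    refine (hu.hess j k).memLp_deriv.integrable_sq.bdd_mul (c := B ^ 2) (by fun_prop)
      (ae_of_all _ fun z => ?_)
    rw [norm_pow]
    exact pow_le_pow_left₀ (norm_nonneg _) (hB _) 2
  have iHp : ∀ p, Integrable (fun z : SpaceTime d => (Metric.ball p (r p)).indicator 1 z.1 *
      (χ z.2 ^ 2 * D2u j k z ^ 2)) (volume.restrict (stCylinder Ω 0 T)) := by
    intro p
    refine iH.bdd_mul (c := 1) ?_ (ae_of_all _ fun z => ?_)
    · exact ((measurable_one.indicator measurableSet_ball).comp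
        measurable_fst).aestronglyMeasurable
    · refine (norm_indicator_le_norm_self _ _).trans (by simp)
  calc ∫ z in stCylinder Ω 0 T, χ z.2 ^ 2 * D2u j k z ^ 2
      ≤ ∫ z in stCylinder Ω 0 T, ∑ p ∈ t, (Metric.ball p (r p)).indicator 1 z.1 *
        (χ z.2 ^ 2 * D2u j k z ^ 2) := by
        refine setIntegral_mono_on iH (integrable_finsetSum _ fun p _ => iHp p) hD.measurableSet
          fun z hz => ?_
        obtain ⟨p, hp, hzp⟩ := mem_iUnion₂.mp (hcov (subset_closure hz.1))
        have h0 : ∀ q ∈ t, (0 : ℝ) ≤ (Metric.ball q (r q)).indicator 1 z.1 *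
            (χ z.2 ^ 2 * D2u j k z ^ 2) := fun q _ =>
          mul_nonneg (indicator_nonneg (fun _ _ => zero_le_one) _) (by positivity)
        refine le_trans ?_ (Finset.single_le_sum h0 hp)
        rw [indicator_of_mem hzp, Pi.one_apply, one_mul]
    _ ≤ _ := by
        rw [integral_finsetSum _ fun p _ => iHp p, Finset.sum_mul]
        exact Finset.sum_le_sum fun p hp => hC p (ht p hp) T u ut Du D2u hu hNz χ hχ j k

/-- The estimate of `exists_hess_estimate` with the sharp cutoff in time. -/
lemma IsSmoothBoundedDomain.exists_hess_estimate_slab (hd : 0 < d) (hΩ : IsSmoothBoundedDomain Ω) :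
    ∃ C : ℝ, 0 ≤ C ∧ ∀ (T ε : ℝ) (u ut : SpaceTime d → ℝ) (Du : SpaceTime d → Space d)
      (D2u : Fin d → Fin d → SpaceTime d → ℝ), 0 ≤ ε → IsH21 (stCylinder Ω 0 T) u ut Du D2u →
      NeumannZero Ω T Du D2u → ∀ j k, ∫ z in stCylinder Ω ε T, D2u j k z ^ 2 ≤
      C * ∫ z in stCylinder Ω ε T, (lap D2u z ^ 2 + ‖Du z‖ ^ 2) := by
  obtain ⟨C, hC0, hC⟩ := hΩ.exists_hess_estimate hd
  refine ⟨C, hC0, fun T ε u ut Du D2u hε hu hNz j k => ?_⟩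
  have hD := isOpen_stCylinder hΩ.isOpen 0 T
  have hDε := isOpen_stCylinder hΩ.isOpen ε T
  have hsub : stCylinder Ω ε T ⊆ stCylinder Ω 0 T :=
    prod_mono_right (Ioo_subset_Ioo_left hε)
  have iH := (hu.hess j k).memLp_deriv.integrable_sq
  have iHε := iH.mono_measure (Measure.restrict_mono_set volume hsub)
  have iLD : Integrable (fun z => lap D2u z ^ 2 + ‖Du z‖ ^ 2)
      (volume.restrict (stCylinder Ω 0 T)) :=
    hu.memLp_lap.integrable_sq.add (hu.memLp_grad.integrable_norm_pow (p := 2) (by norm_num))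
  have hχ : ∀ n, IsTest (Ioo 0 T) (timeCutoff ε T n) := fun n =>
    ⟨contDiff_timeCutoff ε T n, isCompact_Icc.of_isClosed_subset (isClosed_tsupport _)
      (tsupport_timeCutoff_subset.trans Ioo_subset_Icc_self),
      tsupport_timeCutoff_subset.trans (Ioo_subset_Ioo_left hε)⟩
  have hχ1 : ∀ n t, timeCutoff ε T n t ^ 2 ≤ 1 := fun n t =>
    pow_le_one₀ timeCutoff_nonneg timeCutoff_le_one
  have hχn : ∀ n t, ‖timeCutoff ε T n t ^ 2‖ ≤ 1 := fun n t => by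
    rw [Real.norm_of_nonneg (sq_nonneg _)]
    exact hχ1 n t
  have hχc : ∀ n, Continuous fun z : SpaceTime d => timeCutoff ε T n z.2 ^ 2 := fun n =>
    ((hχ n).continuous.comp continuous_snd).pow 2
  have hlim : Tendsto (fun n : ℕ => ∫ z in stCylinder Ω ε T, timeCutoff ε T n z.2 ^ 2 *
      D2u j k z ^ 2) atTop (𝓝 (∫ z in stCylinder Ω ε T, D2u j k z ^ 2)) := by
    refine tendsto_integral_of_dominated_convergence (fun z => D2u j k z ^ 2)
      (fun n => (hχc n).aestronglyMeasurable.mul iHε.1) iHε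
      (fun n => ae_of_all _ fun z => ?_) (ae_restrict_of_forall_mem hDε.measurableSet
        fun z hz => ?_)
    · rw [norm_mul, Real.norm_of_nonneg (sq_nonneg (D2u j k z))]
      exact mul_le_of_le_one_left (sq_nonneg _) (hχn n _)
    · simpa using ((tendsto_timeCutoff hz.2).pow 2).mul_const (D2u j k z ^ 2)
  refine le_of_tendsto hlim (Eventually.of_forall fun n => ?_)
  have i1 : Integrable (fun z => timeCutoff ε T n z.2 ^ 2 * D2u j k z ^ 2)
      (volume.restrict (stCylinder Ω 0 T)) :=
    iH.bdd_mul (c := 1) (hχc n).aestronglyMeasurable (ae_of_all _ fun z => hχn n _)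
  have i2 : Integrable (fun z => timeCutoff ε T n z.2 ^ 2 * (lap D2u z ^ 2 + ‖Du z‖ ^ 2))
      (volume.restrict (stCylinder Ω 0 T)) :=
    iLD.bdd_mul (c := 1) (hχc n).aestronglyMeasurable (ae_of_all _ fun z => hχn n _)
  calc ∫ z in stCylinder Ω ε T, timeCutoff ε T n z.2 ^ 2 * D2u j k z ^ 2
      ≤ ∫ z in stCylinder Ω 0 T, timeCutoff ε T n z.2 ^ 2 * D2u j k z ^ 2 :=
        setIntegral_mono_set i1 (ae_of_all _ fun z => by positivity) hsub.eventuallyLE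
    _ ≤ C * ∫ z in stCylinder Ω 0 T, timeCutoff ε T n z.2 ^ 2 * (lap D2u z ^ 2 + ‖Du z‖ ^ 2) :=
        hC T u ut Du D2u hu hNz _ (hχ n) j k
    _ ≤ _ := by
        refine mul_le_mul_of_nonneg_left ?_ hC0
        rw [setIntegral_eq_of_subset_of_forall_sdiff_eq_zero hD.measurableSet hsub fun z hz => ?_]
        · refine integral_mono (i2.mono_measure (Measure.restrict_mono_set volume hsub))
            (iLD.mono_measure (Measure.restrict_mono_set volume hsub)) fun z => ?_
          exact mul_le_of_le_one_left (by positivity) (hχ1 n _)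
        · have : timeCutoff ε T n z.2 = 0 := by
            refine image_eq_zero_of_notMem_tsupport fun hm => hz.2 ⟨hz.1.1, ?_⟩
            exact tsupport_timeCutoff_subset hm
          simp [this]

end

/-! ### Carleman estimates -/

section

lemma integral_linear_combination {ι X : Type*} [Fintype ι] {m : MeasurableSpace X} {μ : Measure X}
    {F : X → ℝ} (c : ι → ℝ) {f : ι → X → ℝ} (hf : ∀ i, Integrable (f i) μ)
    (h : ∀ z, F z = ∑ i, c i * f i z) : ∫ z, F z ∂μ = ∑ i, c i * ∫ z, f i z ∂μ := by
  simp only [h]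
  rw [integral_finsetSum _ fun i _ => (hf i).const_mul (c i)]
  simp only [integral_const_mul]

variable {d : ℕ} {Ω : Set (Space d)} {T lam : ℝ} {E P : ℝ → ℝ}

/-- A weight `E = exp (2 s e^{λ t})` together with its rate `P = s λ e^{λ t}`, through the
differential equations they satisfy. -/
structure IsCarlemanWeight (lam : ℝ) (E P : ℝ → ℝ) : Prop where
  smooth : ContDiff ℝ ∞ E
  smooth_rate : ContDiff ℝ ∞ P
  nonneg : ∀ t, 0 ≤ E t
  rate_nonneg : ∀ t, 0 ≤ P t
  deriv_eq : ∀ t, deriv E t = 2 * (P t * E t)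
  deriv_mul : ∀ t, deriv (fun t => P t * E t) t = lam * (P t * E t) + 2 * (P t ^ 2 * E t)

lemma isCarlemanWeight_exp {s : ℝ} (hs : 0 ≤ s) (hlam : 0 ≤ lam) :
    IsCarlemanWeight lam (fun t => Real.exp (2 * s * Real.exp (lam * t)))
      (fun t => s * lam * Real.exp (lam * t)) := by
  have h1 : ∀ t, HasDerivAt (fun t => Real.exp (lam * t)) (Real.exp (lam * t) * lam) t := fun t => by
    simpa using ((hasDerivAt_id t).const_mul lam).exp
  have h2 : ∀ t, HasDerivAt (fun t => Real.exp (2 * s * Real.exp (lam * t)))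
      (2 * (s * lam * Real.exp (lam * t) * Real.exp (2 * s * Real.exp (lam * t)))) t := fun t => by
    convert ((h1 t).const_mul (2 * s)).exp using 1
    ring
  refine ⟨by fun_prop, by fun_prop, fun t => (Real.exp_pos _).le, fun t => by positivity,
    fun t => (h2 t).deriv, fun t => ?_⟩
  refine (((h1 t).const_mul (s * lam)).mul (h2 t)).deriv.trans ?_
  ring

variable {u ut L : SpaceTime d → ℝ} {Du : SpaceTime d → Space d}
  {D2u : Fin d → Fin d → SpaceTime d → ℝ} {uT u₀ : Space d → ℝ}

/-- The common part of the two Carleman estimates: the square of `∂_t u - L` is expanded after the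
splitting `(∂_t u + P u) - (L + P u)`. -/
lemma IsH21.carleman_split (hu : IsH21 (stCylinder Ω 0 T) u ut Du D2u) (hΩ : IsOpen Ω)
    (hb : Bornology.IsBounded Ω) (hT : 0 < T) (htr : HasTimeTrace Ω T u T uT)
    (hw : IsCarlemanWeight lam E P) (hL : MemLp L 2 (volume.restrict (stCylinder Ω 0 T))) {b : ℝ}
    (hLb : 2 * (∫ z in stCylinder Ω 0 T, E z.2 * (L z * ut z)) +
      2 * (∫ z in stCylinder Ω 0 T, P z.2 * E z.2 * (L z * u z)) ≤ b) :
    (∫ z in stCylinder Ω 0 T, E z.2 * (L z + P z.2 * u z) ^ 2) +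
      lam * (∫ z in stCylinder Ω 0 T, P z.2 * E z.2 * u z ^ 2) ≤
    (∫ z in stCylinder Ω 0 T, E z.2 * (ut z - L z) ^ 2) + b + P T * E T * ∫ x in Ω, uT x ^ 2 := by
  have hE := hw.smooth
  have hP := hw.smooth_rate
  have hPE : ContDiff ℝ ∞ fun t => P t * E t := hP.mul hE
  have hPPE : ContDiff ℝ ∞ fun t => P t ^ 2 * E t := (hP.pow 2).mul hE
  have mu := hu.time.memLp
  have mt := hu.time.memLp_deriv
  have mPu : MemLp (fun z => P z.2 * u z) 2 (volume.restrict (stCylinder Ω 0 T)) :=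
    memLp_smooth_mul hΩ hP mu
  have i0 := integrable_smooth_mul hΩ hE (mt.add mPu).integrable_sq
  have i1 := integrable_smooth_mul hΩ hE (hL.add mPu).integrable_sq
  have i2 := integrable_smooth_mul hΩ hE (hL.integrable_mul_two mt)
  have i3 := integrable_smooth_mul hΩ hPE (mu.integrable_mul_two mt)
  have i4 := integrable_smooth_mul hΩ hPE (hL.integrable_mul_two mu)
  have i5 := integrable_smooth_mul hΩ hPPE mu.integrable_sq
  have i6 := integrable_smooth_mul hΩ hPE mu.integrable_sq
  simp only [Pi.add_apply] at i0 i1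
  have hsplit := integral_linear_combination (F := fun z => E z.2 * (ut z - L z) ^ 2)
    ![1, 1, -2, -2, -2, -2] (f := ![_, _, _, _, _, _])
    (by simp only [Fin.forall_fin_succ]; exact ⟨i0, i1, i2, i3, i4, i5, fun i => i.elim0⟩)
    fun z => by
      simp [Fin.sum_univ_succ]
      ring
  have hderiv := integral_linear_combination
    (F := fun z => deriv (fun t => P t * E t) z.2 * u z ^ 2) ![lam, 2] (f := ![_, _])
    (by simp only [Fin.forall_fin_succ]; exact ⟨i6, i5, fun i => i.elim0⟩)
    fun z => by
      simp [Fin.sum_univ_succ, hw.deriv_mul]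
      ring
  have hen := hu.energy_l2_final hΩ hb hT htr hPE fun t => mul_nonneg (hw.rate_nonneg t) (hw.nonneg t)
  rw [hderiv] at hen
  simp [Fin.sum_univ_succ] at hsplit hen
  have h0 : 0 ≤ ∫ z in stCylinder Ω 0 T, E z.2 * (ut z + P z.2 * u z) ^ 2 :=
    integral_nonneg fun z => mul_nonneg (hw.nonneg _) (sq_nonneg _)
  rw [hsplit]
  linarith

/-- The Carleman estimate for the forward heat operator. -/
lemma IsH21.carleman_forward (hu : IsH21 (stCylinder Ω 0 T) u ut Du D2u)
    (hN : NeumannZero Ω T Du D2u) (hΩ : IsOpen Ω) (hb : Bornology.IsBounded Ω) (hT : 0 < T)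
    (htr : HasTimeTrace Ω T u T uT) (htr₀ : HasTimeTrace Ω T u 0 u₀) {Du₀ : Space d → Space d}
    (hu₀ : IsH1 Ω u₀ Du₀) (hw : IsCarlemanWeight lam E P) :
    (∫ z in stCylinder Ω 0 T, E z.2 * (lap D2u z + P z.2 * u z) ^ 2) +
      lam * (∫ z in stCylinder Ω 0 T, P z.2 * E z.2 * u z ^ 2) ≤
    (∫ z in stCylinder Ω 0 T, E z.2 * (ut z - lap D2u z) ^ 2) +
      E 0 * (∫ x in Ω, ‖Du₀ x‖ ^ 2) + P T * E T * ∫ x in Ω, uT x ^ 2 := by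
  have hPE : ContDiff ℝ ∞ fun t => P t * E t := hw.smooth_rate.mul hw.smooth
  refine hu.carleman_split hΩ hb hT htr hw hu.memLp_lap ?_
  have h1 := hu.energy_grad hN hΩ hb hT htr₀ hu₀ hw.smooth hw.nonneg
  have h2 := hN.integral_lap_mul hΩ hu hPE hu.grad hu.time.memLp
  simp only [hw.deriv_eq, mul_assoc, integral_const_mul, real_inner_self_eq_norm_sq] at h1 h2 ⊢
  linarith

/-- The Carleman estimate for the backward heat operator. -/
lemma IsH21.carleman_backward (hu : IsH21 (stCylinder Ω 0 T) u ut Du D2u)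
    (hN : NeumannZero Ω T Du D2u) (hΩ : IsOpen Ω) (hb : Bornology.IsBounded Ω) (hT : 0 < T)
    (htr : HasTimeTrace Ω T u T uT) {DuT : Space d → Space d}
    (huT : IsH1 Ω uT DuT) (hlam : 0 ≤ lam) (hw : IsCarlemanWeight lam E P) :
    (∫ z in stCylinder Ω 0 T, E z.2 * lap D2u z ^ 2) +
      2 * (∫ z in stCylinder Ω 0 T, P z.2 * E z.2 * ‖Du z‖ ^ 2) +
      (∫ z in stCylinder Ω 0 T, P z.2 ^ 2 * E z.2 * u z ^ 2) ≤
    (∫ z in stCylinder Ω 0 T, E z.2 * (ut z + lap D2u z) ^ 2) +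
      E T * (∫ x in Ω, ‖DuT x‖ ^ 2) + P T * E T * ∫ x in Ω, uT x ^ 2 := by
  have hPE : ContDiff ℝ ∞ fun t => P t * E t := hw.smooth_rate.mul hw.smooth
  have hPPE : ContDiff ℝ ∞ fun t => P t ^ 2 * E t := (hw.smooth_rate.pow 2).mul hw.smooth
  have h1 := hu.energy_grad_final hN hΩ hb hT htr huT hw.smooth hw.nonneg
  have h2 := hN.integral_lap_mul hΩ hu hPE hu.grad hu.time.memLp
  have hs := hu.carleman_split hΩ hb hT htr hw hu.memLp_lap.neg
    (b := E T * ∫ x in Ω, ‖DuT x‖ ^ 2) (by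
      simp only [hw.deriv_eq, mul_assoc, integral_const_mul, real_inner_self_eq_norm_sq,
        Pi.neg_apply, neg_mul, mul_neg, integral_neg] at h1 h2 ⊢
      linarith)
  have i1 := integrable_smooth_mul hΩ hw.smooth hu.memLp_lap.integrable_sq
  have i2 := integrable_smooth_mul hΩ hPE (hu.memLp_lap.integrable_mul_two hu.time.memLp)
  have i3 := integrable_smooth_mul hΩ hPPE hu.time.memLp.integrable_sq
  have hsplit := integral_linear_combination
    (F := fun z => E z.2 * ((-lap D2u) z + P z.2 * u z) ^ 2) ![1, -2, 1] (f := ![_, _, _])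
    (by simp only [Fin.forall_fin_succ]; exact ⟨i1, i2, i3, fun i => i.elim0⟩)
    fun z => by
      simp [Fin.sum_univ_succ]
      ring
  have h0 : 0 ≤ ∫ z in stCylinder Ω 0 T, P z.2 * E z.2 * u z ^ 2 := integral_nonneg fun z =>
    mul_nonneg (mul_nonneg (hw.rate_nonneg _) (hw.nonneg _)) (sq_nonneg _)
  have h3 := mul_nonneg hlam h0
  rw [hsplit] at hs
  simp only [real_inner_self_eq_norm_sq] at h2
  simp [Fin.sum_univ_succ, h2] at hs
  linarith

end

/-! ### Absorption of the lower-order terms -/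

section

lemma eLpNorm_two_sq {X F : Type*} {m : MeasurableSpace X} {μ : Measure X} [NormedAddCommGroup F]
    (f : X → F) : eLpNorm f 2 μ ^ 2 = ∫⁻ x, ‖f x‖ₑ ^ 2 ∂μ := by
  have h := eLpNorm_nnreal_pow_eq_lintegral (f := f) (μ := μ) (p := 2) two_ne_zero
  simpa only [ENNReal.coe_ofNat, NNReal.coe_ofNat, ENNReal.rpow_two] using h

lemma eLpNorm_two_sq_eq_ofReal {X F : Type*} {m : MeasurableSpace X} {μ : Measure X}
    [NormedAddCommGroup F] {f : X → F} (hf : MemLp f 2 μ) :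
    eLpNorm f 2 μ ^ 2 = ENNReal.ofReal (∫ x, ‖f x‖ ^ 2 ∂μ) := by
  rw [eLpNorm_two_sq, ofReal_integral_eq_lintegral_ofReal (hf.integrable_norm_pow (by norm_num))
    (ae_of_all _ fun x => by positivity)]
  refine lintegral_congr fun x => ?_
  rw [ENNReal.ofReal_pow (norm_nonneg _), ofReal_norm]

variable {d : ℕ} {Ω : Set (Space d)} {T lam : ℝ} {E P : ℝ → ℝ}

/-- Both the pointwise and the nonlocal bound on `w` in terms of `v` give a bound in every `L²`
space with a weight depending on time only. -/
lemma lintegral_weight_le {v w : SpaceTime d → ℝ} {K : ℝ} (hK : 0 ≤ K)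
    (hw : AEStronglyMeasurable w (volume.restrict (stCylinder Ω 0 T)))
    (hv : AEStronglyMeasurable v (volume.restrict (stCylinder Ω 0 T)))
    (h : (∀ᵐ z ∂(volume.restrict (stCylinder Ω 0 T)), |w z| ≤ K * |v z|) ∨
      (∀ᵐ t ∂(volume.restrict (Ioo 0 T)), eLpNorm (fun x => w (x, t)) 2 (volume.restrict Ω) ≤
        ENNReal.ofReal K * eLpNorm (fun x => v (x, t)) 2 (volume.restrict Ω)))
    (hE : Continuous E) :
    ∫⁻ z in stCylinder Ω 0 T, ENNReal.ofReal (E z.2) * ‖w z‖ₑ ^ 2 ≤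
      ENNReal.ofReal K ^ 2 *
        ∫⁻ z in stCylinder Ω 0 T, ENNReal.ofReal (E z.2) * ‖v z‖ₑ ^ 2 := by
  have hEm : Measurable fun t => ENNReal.ofReal (E t) := hE.measurable.ennreal_ofReal
  rw [← lintegral_const_mul' _ _ (by finiteness)]
  rcases h with h | h
  · refine lintegral_mono_ae ?_
    filter_upwards [h] with z hz
    have : ‖w z‖ₑ ≤ ENNReal.ofReal K * ‖v z‖ₑ := by
      rw [← ofReal_norm, ← ofReal_norm, ← ENNReal.ofReal_mul hK]
      exact ENNReal.ofReal_le_ofReal hz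
    calc ENNReal.ofReal (E z.2) * ‖w z‖ₑ ^ 2
        ≤ ENNReal.ofReal (E z.2) * (ENNReal.ofReal K * ‖v z‖ₑ) ^ 2 := by gcongr
      _ = _ := by ring
  · have hm : ∀ {f : SpaceTime d → ℝ},
        AEStronglyMeasurable f (volume.restrict (stCylinder Ω 0 T)) →
        AEMeasurable (fun z => ENNReal.ofReal (E z.2) * ‖f z‖ₑ ^ 2)
          (volume.restrict (stCylinder Ω 0 T)) := fun hf =>
      (hEm.comp measurable_snd).aemeasurable.mul (hf.enorm.pow_const 2)
    have h1 := hm hw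
    have h2 := (hm hv).const_mul (ENNReal.ofReal K ^ 2)
    rw [volume_stCylinder] at h1 h2 ⊢
    rw [lintegral_prod_symm _ h1, lintegral_prod_symm _ h2]
    refine lintegral_mono_ae ?_
    filter_upwards [h] with t ht
    rw [lintegral_const_mul' _ _ (by finiteness), lintegral_const_mul' _ _ (by finiteness),
      lintegral_const_mul' _ _ (by finiteness), ← eLpNorm_two_sq, ← eLpNorm_two_sq]
    calc _ ≤ ENNReal.ofReal (E t) * (ENNReal.ofReal K *
          eLpNorm (fun x => v (x, t)) 2 (volume.restrict Ω)) ^ 2 := by gcongr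
      _ = _ := by ring

lemma integrable_sq_and_integral_weight_le {v w : SpaceTime d → ℝ} {K : ℝ} (hK : 0 ≤ K)
    (hΩ : IsOpen Ω)
    (hw : AEStronglyMeasurable w (volume.restrict (stCylinder Ω 0 T)))
    (hv : MemLp v 2 (volume.restrict (stCylinder Ω 0 T)))
    (h : (∀ᵐ z ∂(volume.restrict (stCylinder Ω 0 T)), |w z| ≤ K * |v z|) ∨
      (∀ᵐ t ∂(volume.restrict (Ioo 0 T)), eLpNorm (fun x => w (x, t)) 2 (volume.restrict Ω) ≤
        ENNReal.ofReal K * eLpNorm (fun x => v (x, t)) 2 (volume.restrict Ω)))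
    (hE : ContDiff ℝ ∞ E) (hE0 : ∀ t, 0 ≤ E t) :
    MemLp w 2 (volume.restrict (stCylinder Ω 0 T)) ∧
      ∫ z in stCylinder Ω 0 T, E z.2 * w z ^ 2 ≤
        K ^ 2 * ∫ z in stCylinder Ω 0 T, E z.2 * v z ^ 2 := by
  have hwm : MemLp w 2 (volume.restrict (stCylinder Ω 0 T)) := by
    have h1 := lintegral_weight_le hK hw hv.1 h (E := fun _ => 1) continuous_const
    simp only [ENNReal.ofReal_one, one_mul, ← eLpNorm_two_sq] at h1
    refine ⟨hw, lt_top_iff_ne_top.mpr fun ht => ?_⟩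
    rw [ht] at h1
    have := hv.eLpNorm_ne_top
    exact absurd h1 (not_le.mpr (by simp; finiteness))
  refine ⟨hwm, ?_⟩
  have e : ∀ {f : SpaceTime d → ℝ}, MemLp f 2 (volume.restrict (stCylinder Ω 0 T)) →
      ∫⁻ z in stCylinder Ω 0 T, ENNReal.ofReal (E z.2) * ‖f z‖ₑ ^ 2 =
        ENNReal.ofReal (∫ z in stCylinder Ω 0 T, E z.2 * f z ^ 2) := by
    intro f hf
    rw [ofReal_integral_eq_lintegral_ofReal (integrable_smooth_mul hΩ hE hf.integrable_sq)
      (ae_of_all _ fun z => mul_nonneg (hE0 _) (sq_nonneg _))]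
    refine lintegral_congr fun z => ?_
    rw [ENNReal.ofReal_mul (hE0 _), ← sq_abs, ENNReal.ofReal_pow (abs_nonneg _),
      ← Real.norm_eq_abs, ofReal_norm]
  have h1 := lintegral_weight_le hK hw hv.1 h hE.continuous
  rw [e hwm, e hv, ← ENNReal.ofReal_pow hK, ← ENNReal.ofReal_mul (by positivity)] at h1
  have h0 : 0 ≤ ∫ z in stCylinder Ω 0 T, E z.2 * v z ^ 2 :=
    integral_nonneg fun z => mul_nonneg (hE0 _) (sq_nonneg _)
  exact (ENNReal.ofReal_le_ofReal_iff (by positivity)).mp h1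

section LowerBounds

variable {u ut : SpaceTime d → ℝ} {Du : SpaceTime d → Space d}
  {D2u : Fin d → Fin d → SpaceTime d → ℝ} {m p R : ℝ}

lemma integral_weight_mono {f : SpaceTime d → ℝ} {χ₁ χ₂ : ℝ → ℝ} (hΩ : IsOpen Ω)
    (h₁ : ContDiff ℝ ∞ χ₁) (h₂ : ContDiff ℝ ∞ χ₂)
    (hf : Integrable f (volume.restrict (stCylinder Ω 0 T))) (hf0 : ∀ z, 0 ≤ f z)
    (h : ∀ t ∈ Ioo 0 T, χ₁ t ≤ χ₂ t) :
    ∫ z in stCylinder Ω 0 T, χ₁ z.2 * f z ≤ ∫ z in stCylinder Ω 0 T, χ₂ z.2 * f z :=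
  setIntegral_mono_on (integrable_smooth_mul hΩ h₁ hf) (integrable_smooth_mul hΩ h₂ hf)
    (isOpen_stCylinder hΩ 0 T).measurableSet
    fun z hz => mul_le_mul_of_nonneg_right (h z.2 hz.2) (hf0 z)

/-- What the forward Carleman estimate controls, for a rate between `m` and `p`. -/
lemma IsH21.forward_lower (hu : IsH21 (stCylinder Ω 0 T) u ut Du D2u)
    (hN : NeumannZero Ω T Du D2u) (hΩ : IsOpen Ω) (hw : IsCarlemanWeight lam E P)
    (hlam : 1 ≤ lam) (hm : lam ≤ m) (hp0 : 0 ≤ p) (hmp : ∀ t ∈ Ioo 0 T, m ≤ P t ∧ P t ≤ p)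
    (h : (∫ z in stCylinder Ω 0 T, E z.2 * (lap D2u z + P z.2 * u z) ^ 2) +
      lam * (∫ z in stCylinder Ω 0 T, P z.2 * E z.2 * u z ^ 2) ≤ R) :
    lam * (∫ z in stCylinder Ω 0 T, E z.2 * u z ^ 2) ≤ R ∧
    lam * (∫ z in stCylinder Ω 0 T, E z.2 * ‖Du z‖ ^ 2) ≤ 2 * R ∧
    (∫ z in stCylinder Ω 0 T, E z.2 * lap D2u z ^ 2) ≤ 2 * (1 + p) * R := by
  have hE := hw.smooth
  have hP := hw.smooth_rate
  have hPE : ContDiff ℝ ∞ fun t => P t * E t := hP.mul hE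
  have mu := hu.time.memLp
  have mL := hu.memLp_lap
  have mPu : MemLp (fun z => P z.2 * u z) 2 (volume.restrict (stCylinder Ω 0 T)) :=
    memLp_smooth_mul hΩ hP mu
  have mS : MemLp (fun z => lap D2u z + P z.2 * u z) 2 (volume.restrict (stCylinder Ω 0 T)) :=
    mL.add mPu
  have iu := integrable_smooth_mul hΩ hE mu.integrable_sq
  have iPu := integrable_smooth_mul hΩ hPE mu.integrable_sq
  have iS := integrable_smooth_mul hΩ hE mS.integrable_sq
  set I := ∫ z in stCylinder Ω 0 T, E z.2 * (lap D2u z + P z.2 * u z) ^ 2 with hI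
  set J := ∫ z in stCylinder Ω 0 T, P z.2 * E z.2 * u z ^ 2 with hJ
  set V := ∫ z in stCylinder Ω 0 T, E z.2 * u z ^ 2 with hV
  have hI0 : 0 ≤ I := integral_nonneg fun z => mul_nonneg (hw.nonneg _) (sq_nonneg _)
  have hV0 : 0 ≤ V := integral_nonneg fun z => mul_nonneg (hw.nonneg _) (sq_nonneg _)
  have hVJ : m * V ≤ J := by
    rw [hV, ← integral_const_mul]
    refine (setIntegral_mono_on (iu.const_mul m) iPu (isOpen_stCylinder hΩ 0 T).measurableSet
      fun z hz => ?_)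
    have := mul_le_mul_of_nonneg_right (hmp z.2 hz.2).1
      (mul_nonneg (hw.nonneg z.2) (sq_nonneg (u z)))
    linarith
  have hVJ' : lam * V ≤ J := (mul_le_mul_of_nonneg_right hm hV0).trans hVJ
  have hJ0 : 0 ≤ J := le_trans (by positivity) hVJ'
  have hJR : J ≤ R := by nlinarith
  refine ⟨hVJ'.trans hJR, ?_, ?_⟩
  · have h1 := hN.integral_lap_mul hΩ hu hE hu.grad mu
    simp only [real_inner_self_eq_norm_sq] at h1
    have h2 : -(2 * lam) * ∫ z in stCylinder Ω 0 T, E z.2 * (lap D2u z * u z) ≤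
        I + lam ^ 2 * V + 2 * lam * J := by
      have := integral_linear_combination
        (F := fun z => E z.2 * (lap D2u z + P z.2 * u z) ^ 2 + lam ^ 2 * (E z.2 * u z ^ 2) +
          2 * lam * (P z.2 * E z.2 * u z ^ 2)) (μ := volume.restrict (stCylinder Ω 0 T))
        ![1, lam ^ 2, 2 * lam] (f := ![_, _, _])
        (by simp only [Fin.forall_fin_succ]; exact ⟨iS, iu, iPu, fun i => i.elim0⟩)
        fun z => by
          simp [Fin.sum_univ_succ]
          ring
      simp [Fin.sum_univ_succ] at this
      rw [add_assoc, ← this, ← integral_const_mul]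
      refine integral_mono ((integrable_smooth_mul hΩ hE (mL.integrable_mul_two mu)).const_mul _)
        ((iS.add (iu.const_mul _)).add (iPu.const_mul _)) fun z => ?_
      have := mul_nonneg (hw.nonneg z.2) (sq_nonneg (lap D2u z + P z.2 * u z + lam * u z))
      nlinarith
    have h3 : lam ^ 2 * V ≤ lam * J := by nlinarith
    nlinarith
  · have h1 : ∫ z in stCylinder Ω 0 T, E z.2 * lap D2u z ^ 2 ≤ 2 * I + 2 * p * J := by
      rw [hI, hJ, ← integral_const_mul, ← integral_const_mul,
        ← integral_add (iS.const_mul _) (iPu.const_mul _)]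
      refine setIntegral_mono_on (integrable_smooth_mul hΩ hE mL.integrable_sq)
        ((iS.const_mul _).add (iPu.const_mul _)) (isOpen_stCylinder hΩ 0 T).measurableSet
        fun z hz => ?_
      have h2 := mul_nonneg (hw.nonneg z.2) (sq_nonneg (lap D2u z + 2 * P z.2 * u z))
      have h3 := mul_le_mul_of_nonneg_left (hmp z.2 hz.2).2 (mul_nonneg
        (mul_nonneg (hw.rate_nonneg z.2) (hw.nonneg z.2)) (sq_nonneg (u z)))
      nlinarith
    have : p * J ≤ p * R := mul_le_mul_of_nonneg_left hJR hp0
    have : I ≤ R := by nlinarith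
    linarith

/-- What the backward Carleman estimate controls, for a rate not below `m`. -/
lemma IsH21.backward_lower (hu : IsH21 (stCylinder Ω 0 T) u ut Du D2u)
    (hΩ : IsOpen Ω) (hw : IsCarlemanWeight lam E P)
    (hm : 1 ≤ m) (hmp : ∀ t ∈ Ioo 0 T, m ≤ P t)
    (h : (∫ z in stCylinder Ω 0 T, E z.2 * lap D2u z ^ 2) +
      2 * (∫ z in stCylinder Ω 0 T, P z.2 * E z.2 * ‖Du z‖ ^ 2) +
      (∫ z in stCylinder Ω 0 T, P z.2 ^ 2 * E z.2 * u z ^ 2) ≤ R) :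
    (∫ z in stCylinder Ω 0 T, E z.2 * lap D2u z ^ 2) +
      m * (∫ z in stCylinder Ω 0 T, E z.2 * ‖Du z‖ ^ 2) +
      m * (∫ z in stCylinder Ω 0 T, E z.2 * u z ^ 2) ≤ R := by
  have hE := hw.smooth
  have hP := hw.smooth_rate
  have i1 : Integrable (fun z => ‖Du z‖ ^ 2) (volume.restrict (stCylinder Ω 0 T)) :=
    hu.memLp_grad.integrable_norm_pow (by norm_num)
  have h1 := integral_weight_mono (χ₁ := fun t => m * E t) (χ₂ := fun t => P t * E t) hΩ
    (contDiff_const.mul hE) (hP.mul hE) i1 (fun z => by positivity)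
    fun t ht => mul_le_mul_of_nonneg_right (hmp t ht) (hw.nonneg t)
  have h2 := integral_weight_mono (χ₁ := fun t => m * E t) (χ₂ := fun t => P t ^ 2 * E t) hΩ
    (contDiff_const.mul hE) ((hP.pow 2).mul hE) hu.time.memLp.integrable_sq
    (fun z => by positivity)
    fun t ht => mul_le_mul_of_nonneg_right (by nlinarith [hmp t ht]) (hw.nonneg t)
  have h3 : 0 ≤ ∫ z in stCylinder Ω 0 T, P z.2 * E z.2 * ‖Du z‖ ^ 2 := integral_nonneg fun z =>
    mul_nonneg (mul_nonneg (hw.rate_nonneg _) (hw.nonneg _)) (sq_nonneg _)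
  simp only [mul_assoc, integral_const_mul] at h h1 h2 h3 ⊢
  linarith

end LowerBounds

end

section

lemma integral_le_linear_combination {ι X : Type*} [Fintype ι] {m : MeasurableSpace X}
    {μ : Measure X} {F : X → ℝ} (c : ι → ℝ) {f : ι → X → ℝ} (hF : Integrable F μ)
    (hf : ∀ i, Integrable (f i) μ) (h : ∀ᵐ z ∂μ, F z ≤ ∑ i, c i * f i z) :
    ∫ z, F z ∂μ ≤ ∑ i, c i * ∫ z, f i z ∂μ := by
  rw [← integral_linear_combination c hf fun _ => rfl]
  exact integral_mono_ae hF (integrable_finsetSum _ fun i _ => (hf i).const_mul (c i)) h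

/-- The algebra of absorption: the coupled inequalities produced by the two Carleman estimates
close up once `lam` is large in terms of the coefficients `k` and `r` of the lower-order terms. -/
lemma exists_absorption_constants {k r : ℝ} (hk : 0 ≤ k) (hr : 0 ≤ r) :
    ∃ lam C : ℝ, 1 ≤ lam ∧ 0 ≤ C ∧ ∀ {m p U H LU V G LV F₁ F₂ b₁ b₂ : ℝ}, lam ≤ m → 0 ≤ p →
      0 ≤ U → 0 ≤ H → 0 ≤ LU → 0 ≤ V → 0 ≤ G → 0 ≤ b₁ → 0 ≤ b₂ →
      LU + m * H + m * U ≤ F₁ + b₁ → lam * V ≤ F₂ + b₂ → lam * G ≤ 2 * (F₂ + b₂) →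
      LV ≤ 2 * (1 + p) * (F₂ + b₂) → F₁ ≤ 3 * k * (U + H + V) →
      F₂ ≤ 5 * k * (U + V + H + G) + 5 * r * LU →
      U + H + LU + V + G + LV + (2 * F₁ + 2 * LU) + (2 * F₂ + 2 * LV) ≤
        C * (1 + p) * (b₁ + b₂) := by
  obtain ⟨A, hA⟩ : ∃ A, A = 5 * k + (5 * k + 5 * r) * (3 * k + 1) + 1 := ⟨_, rfl⟩
  have hA1 : 1 ≤ A := by
    have : 0 ≤ (5 * k + 5 * r) * (3 * k + 1) := by positivity
    linarith
  obtain ⟨C₁, hC₁⟩ : ∃ C₁, C₁ = 9 * k * A + 1 + 3 * A := ⟨_, rfl⟩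
  have hC₁0 : 0 ≤ C₁ := by
    rw [hC₁]
    positivity
  refine ⟨3 * A + 3 * k + 2, 3 * C₁ + 6 * k * C₁ + 8 * (A * (3 * A + 1)), by linarith,
    by positivity, ?_⟩
  intro m p U H LU V G LV F₁ F₂ b₁ b₂ hm hp hU hH hLU hV hG hb₁ hb₂ h1 h2 h3 h4 h5 h6
  -- the solution of the backward equation is controlled by that of the forward one
  have hW : LU + H + U ≤ 3 * k * V + b₁ := by
    have e1 : (3 * k + 1) * H ≤ m * H := mul_le_mul_of_nonneg_right (by linarith) hH
    have e2 : (3 * k + 1) * U ≤ m * U := mul_le_mul_of_nonneg_right (by linarith) hU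
    linarith
  have hF : F₂ + b₂ ≤ A * (V + G + (b₁ + b₂)) := by
    have e1 : 5 * r * LU + 5 * k * (U + H) ≤ (5 * k + 5 * r) * (3 * k * V + b₁) := by
      refine le_trans ?_ (mul_le_mul_of_nonneg_left hW (by positivity))
      have : 0 ≤ 5 * r * (H + U) := by positivity
      have : 0 ≤ 5 * k * LU := by positivity
      linarith
    have e2 : 0 ≤ (5 * k + 5 * r) * (V + G * (3 * k + 1) + b₁ * (3 * k) + b₂ * (3 * k + 1)) := by
      positivity
    have e3 : 0 ≤ 5 * k * (b₁ + b₂) := by positivity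
    rw [hA]
    linarith
  have hVG : V + G ≤ 3 * A * (b₁ + b₂) := by
    have : 0 ≤ (3 * k + 1) * (V + G) := by positivity
    linarith
  have hF' : F₂ + b₂ ≤ A * (3 * A + 1) * (b₁ + b₂) := by
    have := mul_le_mul_of_nonneg_left hVG (by linarith : 0 ≤ A)
    linarith
  have hsum : U + H + LU + V + G ≤ C₁ * (b₁ + b₂) := by
    have e1 : 3 * k * V ≤ 3 * k * (3 * A * (b₁ + b₂)) :=
      mul_le_mul_of_nonneg_left (by linarith) (by positivity)
    rw [hC₁]
    linarith
  have hF1 : F₁ ≤ 3 * k * (C₁ * (b₁ + b₂)) :=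
    h5.trans (mul_le_mul_of_nonneg_left (by linarith) (by positivity))
  have hLV : LV ≤ 2 * (1 + p) * (A * (3 * A + 1) * (b₁ + b₂)) :=
    h4.trans (mul_le_mul_of_nonneg_left hF' (by positivity))
  have e1 : 0 ≤ p * ((3 * C₁ + 6 * k * C₁ + 2 * (A * (3 * A + 1))) * (b₁ + b₂)) := by positivity
  linarith

variable {d : ℕ} {Ω : Set (Space d)} {T : ℝ}

/-- All the terms of the `H^{2,1}` norms of `u` and `v`, with the Laplacian in place of the
Hessian, squared at a point. -/
noncomputable def density (u ut : SpaceTime d → ℝ) (Du : SpaceTime d → Space d)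
    (D2u : Fin d → Fin d → SpaceTime d → ℝ) (z : SpaceTime d) : ℝ :=
  u z ^ 2 + ‖Du z‖ ^ 2 + lap D2u z ^ 2 + ut z ^ 2

lemma density_nonneg (u ut : SpaceTime d → ℝ) (Du : SpaceTime d → Space d)
    (D2u : Fin d → Fin d → SpaceTime d → ℝ) (z : SpaceTime d) : 0 ≤ density u ut Du D2u z := by
  unfold density
  positivity

lemma IsH21.integrable_density {D : Set (SpaceTime d)} {u ut : SpaceTime d → ℝ}
    {Du : SpaceTime d → Space d} {D2u : Fin d → Fin d → SpaceTime d → ℝ}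
    (h : IsH21 D u ut Du D2u) : Integrable (density u ut Du D2u) (volume.restrict D) :=
  ((h.time.memLp.integrable_sq.add (h.memLp_grad.integrable_norm_pow (p := 2) (by norm_num))).add
    h.memLp_lap.integrable_sq).add h.time.memLp_deriv.integrable_sq

set_option maxHeartbeats 1000000 in
/-- The weighted estimate of the whole system. -/
theorem exists_system_estimate {K ρ₀ : ℝ} (hK : 0 ≤ K) :
    ∃ lam C : ℝ, 1 ≤ lam ∧ 0 ≤ C ∧ ∀ {Ω : Set (Space d)} {T : ℝ}
      {u ut : SpaceTime d → ℝ} {Du : SpaceTime d → Space d}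
      {D2u : Fin d → Fin d → SpaceTime d → ℝ}
      {v vt : SpaceTime d → ℝ} {Dv : SpaceTime d → Space d}
      {D2v : Fin d → Fin d → SpaceTime d → ℝ} {w : SpaceTime d → ℝ}
      {uT vT v₀ : Space d → ℝ} {DuT Dv₀ : Space d → Space d},
      IsOpen Ω → Bornology.IsBounded Ω → 0 < T →
      IsH21 (stCylinder Ω 0 T) u ut Du D2u → IsH21 (stCylinder Ω 0 T) v vt Dv D2v →
      NeumannZero Ω T Du D2u → NeumannZero Ω T Dv D2v →
      (∀ᵐ z ∂(volume.restrict (stCylinder Ω 0 T)),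
        |ut z + lap D2u z| ≤ K * (|u z| + ‖Du z‖) + |w z|) →
      (∀ᵐ z ∂(volume.restrict (stCylinder Ω 0 T)),
        |vt z - lap D2v z| ≤ K * (|u z| + |v z| + ‖Du z‖ + ‖Dv z‖) + |ρ₀| * |lap D2u z|) →
      AEStronglyMeasurable w (volume.restrict (stCylinder Ω 0 T)) →
      ((∀ᵐ z ∂(volume.restrict (stCylinder Ω 0 T)), |w z| ≤ K * |v z|) ∨
        (∀ᵐ t ∂(volume.restrict (Ioo 0 T)), eLpNorm (fun x => w (x, t)) 2 (volume.restrict Ω) ≤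
          ENNReal.ofReal K * eLpNorm (fun x => v (x, t)) 2 (volume.restrict Ω))) →
      HasTimeTrace Ω T u T uT → HasTimeTrace Ω T v T vT → HasTimeTrace Ω T v 0 v₀ →
      IsH1 Ω uT DuT → IsH1 Ω v₀ Dv₀ →
      ∀ {E P : ℝ → ℝ} {m p : ℝ}, IsCarlemanWeight lam E P → lam ≤ m → 0 ≤ p →
      (∀ t ∈ Ioo 0 T, m ≤ P t ∧ P t ≤ p) →
      ∫ z in stCylinder Ω 0 T, E z.2 * (density u ut Du D2u z + density v vt Dv D2v z) ≤
        C * (1 + p) * (E T * (∫ x in Ω, ‖DuT x‖ ^ 2) + P T * E T * (∫ x in Ω, uT x ^ 2) +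
          (E 0 * (∫ x in Ω, ‖Dv₀ x‖ ^ 2) + P T * E T * ∫ x in Ω, vT x ^ 2)) := by
  obtain ⟨lam, C, hlam, hC, key⟩ := exists_absorption_constants (sq_nonneg K) (sq_nonneg ρ₀)
  refine ⟨lam, C, hlam, hC, ?_⟩
  intro Ω T u ut Du D2u v vt Dv D2v w uT vT v₀ DuT Dv₀ hΩ hb hT hu hv hNu hNv hequ heqv hwm hwv
    htu htv htv₀ huT hv₀ E P m p hw hm hp hmp
  have hE := hw.smooth
  obtain ⟨mw, hwle⟩ := integrable_sq_and_integral_weight_le hK hΩ hwm hv.time.memLp hwv hE hw.nonneg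
  have ihu : Integrable (fun z => ‖Du z‖ ^ 2) (volume.restrict (stCylinder Ω 0 T)) :=
    hu.memLp_grad.integrable_norm_pow (by norm_num)
  have ihv : Integrable (fun z => ‖Dv z‖ ^ 2) (volume.restrict (stCylinder Ω 0 T)) :=
    hv.memLp_grad.integrable_norm_pow (by norm_num)
  have iu := integrable_smooth_mul hΩ hE hu.time.memLp.integrable_sq
  have iut := integrable_smooth_mul hΩ hE hu.time.memLp_deriv.integrable_sq
  have iDu := integrable_smooth_mul hΩ hE ihu
  have iLu := integrable_smooth_mul hΩ hE hu.memLp_lap.integrable_sq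
  have iv := integrable_smooth_mul hΩ hE hv.time.memLp.integrable_sq
  have ivt := integrable_smooth_mul hΩ hE hv.time.memLp_deriv.integrable_sq
  have iDv := integrable_smooth_mul hΩ hE ihv
  have iLv := integrable_smooth_mul hΩ hE hv.memLp_lap.integrable_sq
  have iw := integrable_smooth_mul hΩ hE mw.integrable_sq
  have iF₁ := integrable_smooth_mul hΩ hE
    (hu.time.memLp_deriv.add hu.memLp_lap).integrable_sq
  have iF₂ := integrable_smooth_mul hΩ hE
    (hv.time.memLp_deriv.sub hv.memLp_lap).integrable_sq
  simp only [Pi.add_apply, Pi.sub_apply] at iF₁ iF₂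
  have pos : ∀ {f : SpaceTime d → ℝ}, (∀ z, 0 ≤ f z) →
      0 ≤ ∫ z in stCylinder Ω 0 T, E z.2 * f z := fun hf =>
    integral_nonneg fun z => mul_nonneg (hw.nonneg _) (hf z)
  have hET := hw.nonneg T
  have hPT := hw.rate_nonneg T
  have hE0 := hw.nonneg 0
  have hcu := hu.backward_lower hΩ hw (hlam.trans hm) (fun t ht => (hmp t ht).1)
    ((hu.carleman_backward hNu hΩ hb hT htu huT (by linarith) hw).trans (add_assoc _ _ _).le)
  obtain ⟨hcv, hcDv, hcLv⟩ := hv.forward_lower hNv hΩ hw hlam hm hp hmp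
    ((hv.carleman_forward hNv hΩ hb hT htv htv₀ hv₀ hw).trans (add_assoc _ _ _).le)
  -- the right-hand sides
  have hF₁ : ∫ z in stCylinder Ω 0 T, E z.2 * (ut z + lap D2u z) ^ 2 ≤ 3 * K ^ 2 *
      ((∫ z in stCylinder Ω 0 T, E z.2 * u z ^ 2) +
        (∫ z in stCylinder Ω 0 T, E z.2 * ‖Du z‖ ^ 2) +
        ∫ z in stCylinder Ω 0 T, E z.2 * v z ^ 2) := by
    have hi := integral_le_linear_combination ![3 * K ^ 2, 3 * K ^ 2, 3] (f := ![_, _, _]) iF₁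
      (by simp only [Fin.forall_fin_succ]; exact ⟨iu, iDu, iw, fun i => i.elim0⟩) (by
      filter_upwards [hequ] with z hz
      have h1 := sq_le_of_forall_abs_le hz
      have h2 : (K * (|u z| + ‖Du z‖) + |w z|) ^ 2 ≤
          3 * K ^ 2 * u z ^ 2 + 3 * K ^ 2 * ‖Du z‖ ^ 2 + 3 * w z ^ 2 := by
        rw [← sq_abs (u z), ← sq_abs (w z)]
        nlinarith [sq_nonneg (K * |u z| - K * ‖Du z‖), sq_nonneg (K * |u z| - |w z|),
          sq_nonneg (K * ‖Du z‖ - |w z|)]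
      have h3 := mul_le_mul_of_nonneg_left (h1.trans h2) (hw.nonneg z.2)
      simp [Fin.sum_univ_succ]
      linarith)
    simp [Fin.sum_univ_succ] at hi
    linarith
  have hF₂ : ∫ z in stCylinder Ω 0 T, E z.2 * (vt z - lap D2v z) ^ 2 ≤ 5 * K ^ 2 *
      ((∫ z in stCylinder Ω 0 T, E z.2 * u z ^ 2) +
        (∫ z in stCylinder Ω 0 T, E z.2 * v z ^ 2) +
        (∫ z in stCylinder Ω 0 T, E z.2 * ‖Du z‖ ^ 2) +
        ∫ z in stCylinder Ω 0 T, E z.2 * ‖Dv z‖ ^ 2) +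
      5 * ρ₀ ^ 2 * ∫ z in stCylinder Ω 0 T, E z.2 * lap D2u z ^ 2 := by
    have hi := integral_le_linear_combination
      ![5 * K ^ 2, 5 * K ^ 2, 5 * K ^ 2, 5 * K ^ 2, 5 * ρ₀ ^ 2] (f := ![_, _, _, _, _]) iF₂
      (by simp only [Fin.forall_fin_succ]; exact ⟨iu, iv, iDu, iDv, iLu, fun i => i.elim0⟩) (by
      filter_upwards [heqv] with z hz
      have h1 := sq_le_of_forall_abs_le hz
      have h2 : ∀ a b c e f : ℝ, (a + b + c + e + f) ^ 2 ≤
          5 * (a ^ 2 + b ^ 2 + c ^ 2 + e ^ 2 + f ^ 2) := fun a b c e f => by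
        nlinarith [sq_nonneg (a - b), sq_nonneg (a - c), sq_nonneg (a - e), sq_nonneg (a - f),
          sq_nonneg (b - c), sq_nonneg (b - e), sq_nonneg (b - f), sq_nonneg (c - e),
          sq_nonneg (c - f), sq_nonneg (e - f)]
      have h3 := h2 (K * |u z|) (K * |v z|) (K * ‖Du z‖) (K * ‖Dv z‖) (|ρ₀| * |lap D2u z|)
      simp only [mul_pow, sq_abs] at h3
      have h4 : K * (|u z| + |v z| + ‖Du z‖ + ‖Dv z‖) + |ρ₀| * |lap D2u z| =
          K * |u z| + K * |v z| + K * ‖Du z‖ + K * ‖Dv z‖ + |ρ₀| * |lap D2u z| := by ring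
      rw [h4] at h1
      have h5 := mul_le_mul_of_nonneg_left (h1.trans h3) (hw.nonneg z.2)
      simp [Fin.sum_univ_succ]
      linarith)
    simp [Fin.sum_univ_succ] at hi
    linarith
  have hfin := key hm hp (pos fun z => sq_nonneg (u z)) (pos fun z => sq_nonneg ‖Du z‖)
    (pos fun z => sq_nonneg (lap D2u z)) (pos fun z => sq_nonneg (v z))
    (pos fun z => sq_nonneg ‖Dv z‖)
    (b₁ := E T * (∫ x in Ω, ‖DuT x‖ ^ 2) + P T * E T * (∫ x in Ω, uT x ^ 2))
    (b₂ := E 0 * (∫ x in Ω, ‖Dv₀ x‖ ^ 2) + P T * E T * ∫ x in Ω, vT x ^ 2)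
    (by positivity) (by positivity) (by linarith) hcv hcDv hcLv hF₁ hF₂
  refine le_trans ?_ hfin
  have hi := integral_le_linear_combination ![1, 1, 2 + 1, 1, 1, 2 + 1, 2, 2]
    (f := ![_, _, _, _, _, _, _, _])
    (integrable_smooth_mul hΩ hE (hu.integrable_density.add hv.integrable_density))
    (by
      simp only [Fin.forall_fin_succ]
      exact ⟨iu, iDu, iLu, iv, iDv, iLv, iF₁, iF₂, fun i => i.elim0⟩)
    (ae_of_all _ fun z => by
      have h1 : ut z ^ 2 ≤ 2 * (ut z + lap D2u z) ^ 2 + 2 * lap D2u z ^ 2 := by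
        nlinarith [sq_nonneg (ut z + 2 * lap D2u z)]
      have h2 : vt z ^ 2 ≤ 2 * (vt z - lap D2v z) ^ 2 + 2 * lap D2v z ^ 2 := by
        nlinarith [sq_nonneg (vt z - 2 * lap D2v z)]
      have h3 := mul_le_mul_of_nonneg_left (add_le_add h1 h2) (hw.nonneg z.2)
      simp [Fin.sum_univ_succ, density]
      linarith)
  simp [Fin.sum_univ_succ] at hi
  linarith

end

/-! ### Choice of the large parameter -/

section

/-- Optimizing a Carleman estimate in its large parameter gives a Hölder rate. -/
lemma exists_holder_rate {a b A N : ℝ} (ha : 0 < a) (hb : 0 < b) (hA : 0 ≤ A) (hN : 0 ≤ N) :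
    ∃ C θ : ℝ, 0 < C ∧ θ ∈ Ioo (0 : ℝ) 1 ∧ ∀ D Z : ℝ, 0 < D → D < 1 →
      (∀ s, 1 ≤ s → Z ≤ A * s ^ 2 * (Real.exp (-(2 * s * a)) * N + Real.exp (2 * s * b) * D ^ 2)) →
      Z ≤ C * (D ^ θ) ^ 2 := by
  -- with `s = 1 + κ log (1 / D)` both exponentials are powers of `D`
  set κ := 1 / (2 * b) with hκ
  have hκ0 : 0 < κ := by positivity
  have hκb : κ * b = 1 / 2 := by rw [hκ]; field_simp
  set θ := min (1 / 4) (κ * a / 2) with hθ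
  have hθ0 : 0 < θ := by positivity
  have hθ1 : θ ≤ 1 / 4 := min_le_left _ _
  have hθ2 : θ ≤ κ * a / 2 := min_le_right _ _
  refine ⟨A * (1 + κ / θ) ^ 2 * (N + Real.exp (2 * b)) + 1, θ, by positivity,
    ⟨hθ0, by linarith⟩, fun D Z hD0 hD1 h => ?_⟩
  set l := -Real.log D with hl
  have hl0 : 0 < l := neg_pos.mpr (Real.log_neg hD0 hD1)
  have hDθ : D ^ θ = Real.exp (-(θ * l)) := by
    rw [Real.rpow_def_of_pos hD0, hl]
    ring_nf
  have hD2 : D ^ 2 = Real.exp (-(2 * l)) := by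
    rw [hl, ← Real.exp_log (by positivity : 0 < D ^ 2), Real.log_pow]
    ring_nf
  have hs := h (1 + κ * l) (by nlinarith)
  have e1 : Real.exp (-(2 * (1 + κ * l) * a)) ≤ Real.exp (-(4 * θ * l)) := by
    refine Real.exp_le_exp.mpr ?_
    nlinarith [mul_le_mul_of_nonneg_right hθ2 hl0.le]
  have e2 : Real.exp (2 * (1 + κ * l) * b) * D ^ 2 ≤ Real.exp (2 * b) * Real.exp (-(4 * θ * l)) := by
    rw [hD2, ← Real.exp_add, ← Real.exp_add]
    refine Real.exp_le_exp.mpr ?_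
    have h1 : 2 * (1 + κ * l) * b = 2 * b + 2 * (κ * b) * l := by ring
    rw [h1, hκb]
    nlinarith [mul_le_mul_of_nonneg_right hθ1 hl0.le]
  have e3 : 1 + κ * l ≤ (1 + κ / θ) * Real.exp (θ * l) := by
    have h1 := Real.add_one_le_exp (θ * l)
    have h2 : (1 + κ / θ) * (θ * l + 1) = 1 + κ * l + θ * l + κ / θ := by
      field_simp
      ring
    have h3 := mul_le_mul_of_nonneg_left h1 (by positivity : 0 ≤ 1 + κ / θ)
    have h4 : 0 < κ / θ := by positivity
    nlinarith
  have e4 : (1 + κ * l) ^ 2 ≤ (1 + κ / θ) ^ 2 * Real.exp (2 * (θ * l)) := by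
    refine (pow_le_pow_left₀ (by positivity) e3 2).trans (le_of_eq ?_)
    rw [mul_pow, ← Real.exp_nat_mul]
    norm_num
  have e5 : Real.exp (-(2 * (1 + κ * l) * a)) * N + Real.exp (2 * (1 + κ * l) * b) * D ^ 2 ≤
      (N + Real.exp (2 * b)) * Real.exp (-(4 * θ * l)) := by
    nlinarith [mul_le_mul_of_nonneg_right e1 hN]
  have e6 : (D ^ θ) ^ 2 = Real.exp (2 * (θ * l)) * Real.exp (-(4 * θ * l)) := by
    rw [hDθ, ← Real.exp_nat_mul, ← Real.exp_add]
    congr 1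
    push_cast
    ring
  calc Z ≤ A * (1 + κ * l) ^ 2 * (Real.exp (-(2 * (1 + κ * l) * a)) * N +
        Real.exp (2 * (1 + κ * l) * b) * D ^ 2) := hs
    _ ≤ A * ((1 + κ / θ) ^ 2 * Real.exp (2 * (θ * l))) *
        ((N + Real.exp (2 * b)) * Real.exp (-(4 * θ * l))) := by gcongr
    _ = A * (1 + κ / θ) ^ 2 * (N + Real.exp (2 * b)) * (D ^ θ) ^ 2 := by
        rw [e6]
        ring
    _ ≤ _ := by
        gcongr
        linarith

/-! ### From the weighted estimate to the norms -/

variable {d : ℕ} {Ω : Set (Space d)} {T : ℝ}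

lemma IsH21.mono {D D' : Set (SpaceTime d)} {u ut : SpaceTime d → ℝ} {Du : SpaceTime d → Space d}
    {D2u : Fin d → Fin d → SpaceTime d → ℝ} (h : IsH21 D' u ut Du D2u)
    (hs : D ⊆ D') : IsH21 D u ut Du D2u :=
  ⟨h.time.mono hs, fun i => (h.grad i).mono hs, fun i j => (h.hess i j).mono hs⟩

/-- The `H^{2,1}` norm is bounded by the square root of the integrated density. -/
lemma IsH21.h21Norm_le {D : Set (SpaceTime d)} {u ut : SpaceTime d → ℝ} {Du : SpaceTime d → Space d}
    {D2u : Fin d → Fin d → SpaceTime d → ℝ} (h : IsH21 D u ut Du D2u) {C R : ℝ} (hC : 0 ≤ C)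
    (hR : 0 ≤ R)
    (hhess : ∀ j k, ∫ z in D, D2u j k z ^ 2 ≤ C * ∫ z in D, (lap D2u z ^ 2 + ‖Du z‖ ^ 2))
    (hd : ∫ z in D, density u ut Du D2u z ≤ R ^ 2) :
    h21Norm D u ≤ ENNReal.ofReal (√(1 + d ^ 2 * C) * R) := by
  unfold h21Norm
  refine iInf_le_of_le ut (iInf_le_of_le Du (iInf_le_of_le D2u (iInf_le_of_le h ?_)))
  have i1 := h.time.memLp.integrable_sq
  have i2 : Integrable (fun z => ‖Du z‖ ^ 2) (volume.restrict D) :=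
    h.memLp_grad.integrable_norm_pow (by norm_num)
  have i3 := h.memLp_lap.integrable_sq
  have i4 := h.time.memLp_deriv.integrable_sq
  have hsum : ∫ z in D, density u ut Du D2u z = (∫ z in D, u z ^ 2) + (∫ z in D, ‖Du z‖ ^ 2) +
      (∫ z in D, lap D2u z ^ 2) + ∫ z in D, ut z ^ 2 := by
    have := integral_linear_combination (F := density u ut Du D2u) ![1, 1, 1, 1] (f := ![_, _, _, _])
      (by simp only [Fin.forall_fin_succ]; exact ⟨i1, i2, i3, i4, fun i => i.elim0⟩)
      fun z => by
        simp [Fin.sum_univ_succ, density]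
        ring
    simp [Fin.sum_univ_succ] at this
    rw [this]
    ring
  rw [integral_add i3 i2] at hhess
  have p1 : 0 ≤ ∫ z in D, u z ^ 2 := integral_nonneg fun z => sq_nonneg _
  have p2 : 0 ≤ ∫ z in D, ‖Du z‖ ^ 2 := integral_nonneg fun z => sq_nonneg _
  have p3 : 0 ≤ ∫ z in D, lap D2u z ^ 2 := integral_nonneg fun z => sq_nonneg _
  have p4 : 0 ≤ ∫ z in D, ut z ^ 2 := integral_nonneg fun z => sq_nonneg _
  have p5 : ∀ i j, 0 ≤ ∫ z in D, D2u i j z ^ 2 := fun i j => integral_nonneg fun z => sq_nonneg _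
  have hH : ∑ i, ∑ j, ∫ z in D, D2u i j z ^ 2 ≤
      d ^ 2 * (C * ((∫ z in D, lap D2u z ^ 2) + ∫ z in D, ‖Du z‖ ^ 2)) := by
    refine (Finset.sum_le_card_nsmul _ _ _ fun i _ =>
      Finset.sum_le_card_nsmul _ _ _ fun j _ => hhess i j).trans (le_of_eq ?_)
    simp
    ring
  have hE : ∀ {f : SpaceTime d → ℝ}, MemLp f 2 (volume.restrict D) →
      eLpNorm f 2 (volume.restrict D) ^ 2 = ENNReal.ofReal (∫ z in D, f z ^ 2) := fun hf => by
    rw [eLpNorm_two_sq_eq_ofReal hf]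
    simp only [Real.norm_eq_abs, sq_abs]
  rw [hE h.time.memLp, hE h.time.memLp_deriv, eLpNorm_two_sq_eq_ofReal h.memLp_grad]
  simp only [hE (h.hess _ _).memLp_deriv]
  have hsumE : ∑ i, ∑ j, ENNReal.ofReal (∫ z in D, D2u i j z ^ 2) =
      ENNReal.ofReal (∑ i, ∑ j, ∫ z in D, D2u i j z ^ 2) := by
    rw [ENNReal.ofReal_sum_of_nonneg fun i _ => Finset.sum_nonneg fun j _ => p5 i j]
    exact Finset.sum_congr rfl fun i _ =>
      (ENNReal.ofReal_sum_of_nonneg fun j _ => p5 i j).symm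
  have p6 : 0 ≤ ∑ i, ∑ j, ∫ z in D, D2u i j z ^ 2 :=
    Finset.sum_nonneg fun i _ => Finset.sum_nonneg fun j _ => p5 i j
  rw [hsumE, ← ENNReal.ofReal_add p1 p2, ← ENNReal.ofReal_add (by positivity) p6,
    ← ENNReal.ofReal_add (by positivity) p4,
    ENNReal.ofReal_rpow_of_nonneg (by positivity) (by norm_num), ← Real.sqrt_eq_rpow]
  refine ENNReal.ofReal_le_ofReal ?_
  rw [← Real.sqrt_sq hR, ← Real.sqrt_mul (by positivity)]
  refine Real.sqrt_le_sqrt ?_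
  have h1 : (1 + (d : ℝ) ^ 2 * C) * (∫ z in D, density u ut Du D2u z) ≤ (1 + d ^ 2 * C) * R ^ 2 :=
    mul_le_mul_of_nonneg_left hd (by positivity)
  rw [hsum] at h1
  have h2 : 0 ≤ (d : ℝ) ^ 2 * C * ((∫ z in D, u z ^ 2) + ∫ z in D, ut z ^ 2) := by positivity
  linarith

lemma integral_norm_sq_le_of_eLpNorm_le {X F : Type*} {m : MeasurableSpace X} {μ : Measure X}
    [NormedAddCommGroup F] {f : X → F} (hf : MemLp f 2 μ) {R : ℝ} (hR : 0 ≤ R)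
    (h : eLpNorm f 2 μ ≤ ENNReal.ofReal R) : ∫ x, ‖f x‖ ^ 2 ∂μ ≤ R ^ 2 := by
  have h1 : eLpNorm f 2 μ ^ 2 ≤ ENNReal.ofReal R ^ 2 := by gcongr
  rw [eLpNorm_two_sq_eq_ofReal hf, ← ENNReal.ofReal_pow hR] at h1
  exact (ENNReal.ofReal_le_ofReal_iff (by positivity)).mp h1

lemma gradNorm_le_h1Norm (Ω : Set (Space d)) (g : Space d → ℝ) : gradNorm Ω g ≤ h1Norm Ω g := by
  rw [h1Norm, one_div, ENNReal.le_rpow_inv_iff two_pos, ENNReal.rpow_two]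
  exact le_add_self

lemma eLpNorm_le_h1Norm (Ω : Set (Space d)) (g : Space d → ℝ) :
    eLpNorm g 2 (volume.restrict Ω) ≤ h1Norm Ω g := by
  rw [h1Norm, one_div, ENNReal.le_rpow_inv_iff two_pos, ENNReal.rpow_two]
  exact le_self_add

lemma exists_isH1_of_gradNorm_lt {g : Space d → ℝ} {R : ℝ≥0∞} (h : gradNorm Ω g < R) :
    ∃ Dg, IsH1 Ω g Dg ∧ eLpNorm Dg 2 (volume.restrict Ω) < R := by
  obtain ⟨Dg, hDg⟩ := iInf_lt_iff.mp h
  obtain ⟨h1, h2⟩ := iInf_lt_iff.mp hDg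
  exact ⟨Dg, h1, h2⟩

end

section

variable {d : ℕ}

/-- The weighted estimate of the system, read on the slab `Ω × (ε, T)`: for every large parameter
`s`, the data at time `0` come with a small factor and the data at time `T` with a large one. -/
theorem exists_slab_estimate {K ρ₀ T ε : ℝ} (hK : 0 ≤ K) (hT : 0 < T) (hε : ε ∈ Ioo 0 T)
    {N : ℝ} (hN : 0 ≤ N) :
    ∃ a b A : ℝ, 0 < a ∧ 0 < b ∧ 0 ≤ A ∧ ∀ {Ω : Set (Space d)}
      {u ut : SpaceTime d → ℝ} {Du : SpaceTime d → Space d}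
      {D2u : Fin d → Fin d → SpaceTime d → ℝ}
      {v vt : SpaceTime d → ℝ} {Dv : SpaceTime d → Space d}
      {D2v : Fin d → Fin d → SpaceTime d → ℝ} {w : SpaceTime d → ℝ}
      {uT vT v₀ : Space d → ℝ} {DuT Dv₀ : Space d → Space d},
      IsOpen Ω → Bornology.IsBounded Ω →
      IsH21 (stCylinder Ω 0 T) u ut Du D2u → IsH21 (stCylinder Ω 0 T) v vt Dv D2v →
      NeumannZero Ω T Du D2u → NeumannZero Ω T Dv D2v →
      (∀ᵐ z ∂(volume.restrict (stCylinder Ω 0 T)),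
        |ut z + lap D2u z| ≤ K * (|u z| + ‖Du z‖) + |w z|) →
      (∀ᵐ z ∂(volume.restrict (stCylinder Ω 0 T)),
        |vt z - lap D2v z| ≤ K * (|u z| + |v z| + ‖Du z‖ + ‖Dv z‖) + |ρ₀| * |lap D2u z|) →
      AEStronglyMeasurable w (volume.restrict (stCylinder Ω 0 T)) →
      ((∀ᵐ z ∂(volume.restrict (stCylinder Ω 0 T)), |w z| ≤ K * |v z|) ∨
        (∀ᵐ t ∂(volume.restrict (Ioo 0 T)), eLpNorm (fun x => w (x, t)) 2 (volume.restrict Ω) ≤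
          ENNReal.ofReal K * eLpNorm (fun x => v (x, t)) 2 (volume.restrict Ω))) →
      HasTimeTrace Ω T u T uT → HasTimeTrace Ω T v T vT → HasTimeTrace Ω T v 0 v₀ →
      IsH1 Ω uT DuT → IsH1 Ω v₀ Dv₀ → (∫ x in Ω, ‖Dv₀ x‖ ^ 2) ≤ N →
      ∀ {D : ℝ}, (∫ x in Ω, ‖DuT x‖ ^ 2) ≤ D ^ 2 → (∫ x in Ω, uT x ^ 2) ≤ D ^ 2 →
      (∫ x in Ω, vT x ^ 2) ≤ D ^ 2 → ∀ s, 1 ≤ s →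
      ∫ z in stCylinder Ω ε T, (density u ut Du D2u z + density v vt Dv D2v z) ≤
        A * s ^ 2 * (Real.exp (-(2 * s * a)) * N + Real.exp (2 * s * b) * D ^ 2) := by
  obtain ⟨lam, C, hlam, hC, key⟩ := exists_system_estimate (d := d) (ρ₀ := ρ₀) hK
  have hlam0 : 0 < lam := by linarith
  set φ : ℝ → ℝ := fun t => Real.exp (lam * t) with hφ
  have hφm : StrictMono φ := fun x y hxy => Real.exp_lt_exp.mpr (by nlinarith)
  set q := lam * φ T with hq
  have hq0 : 0 ≤ q := by positivity
  refine ⟨φ ε - φ 0, φ T - φ ε, C * (1 + q) * (1 + 2 * q), sub_pos.mpr (hφm hε.1),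
    sub_pos.mpr (hφm hε.2), by positivity, ?_⟩
  intro Ω u ut Du D2u v vt Dv D2v w uT vT v₀ DuT Dv₀ hΩ hb hu hv hNu hNv hequ heqv hwm hwv
    htu htv htv₀ huT hv₀ hvN D h1 h2 h3 s hs
  have hs0 : 0 < s := by linarith
  have hw := isCarlemanWeight_exp (s := s) hs0.le hlam0.le
  have hest := key hΩ hb hT hu hv hNu hNv hequ heqv hwm hwv htu htv htv₀ huT hv₀ hw
    (m := s * lam) (p := s * q) (by nlinarith) (by positivity) fun t ht => by
      have e1 : 1 ≤ Real.exp (lam * t) := Real.one_le_exp (mul_nonneg hlam0.le ht.1.le)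
      have e2 : Real.exp (lam * t) ≤ φ T := (hφm ht.2).le
      have e3 : 0 ≤ s * lam := by positivity
      constructor
      · nlinarith
      · rw [hq]
        nlinarith
  set I := ∫ z in stCylinder Ω ε T, (density u ut Du D2u z + density v vt Dv D2v z) with hI
  have iI : Integrable (fun z => density u ut Du D2u z + density v vt Dv D2v z)
      (volume.restrict (stCylinder Ω 0 T)) := hu.integrable_density.add hv.integrable_density
  have hsub : stCylinder Ω ε T ⊆ stCylinder Ω 0 T :=
    prod_mono_right (Ioo_subset_Ioo_left hε.1.le)
  have iE := integrable_smooth_mul hΩ hw.smooth iI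
  -- the weight is increasing in time
  have hlow : Real.exp (2 * s * φ ε) * I ≤ ∫ z in stCylinder Ω 0 T,
      Real.exp (2 * s * φ z.2) * (density u ut Du D2u z + density v vt Dv D2v z) := by
    rw [hI, ← integral_const_mul]
    refine le_trans ?_ (setIntegral_mono_set iE (ae_of_all _ fun z =>
      mul_nonneg (Real.exp_pos _).le (add_nonneg (density_nonneg _ _ _ _ _)
        (density_nonneg _ _ _ _ _))) hsub.eventuallyLE)
    refine setIntegral_mono_on
      ((iI.mono_measure (Measure.restrict_mono_set volume hsub)).const_mul _)
      (iE.mono_measure (Measure.restrict_mono_set volume hsub))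
      (isOpen_stCylinder hΩ ε T).measurableSet fun z hz => ?_
    refine mul_le_mul_of_nonneg_right (Real.exp_le_exp.mpr ?_)
      (add_nonneg (density_nonneg _ _ _ _ _) (density_nonneg _ _ _ _ _))
    exact mul_le_mul_of_nonneg_left (hφm hz.2.1).le (by positivity)
  have hup : C * (1 + s * q) * (Real.exp (2 * s * φ T) * (∫ x in Ω, ‖DuT x‖ ^ 2) +
      s * q * Real.exp (2 * s * φ T) * (∫ x in Ω, uT x ^ 2) +
      (Real.exp (2 * s * φ 0) * (∫ x in Ω, ‖Dv₀ x‖ ^ 2) +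
        s * q * Real.exp (2 * s * φ T) * ∫ x in Ω, vT x ^ 2)) ≤
      C * (1 + q) * (1 + 2 * q) * s ^ 2 * (Real.exp (2 * s * φ 0) * N +
        Real.exp (2 * s * φ T) * D ^ 2) := by
    have e1 : 1 + s * q ≤ s * (1 + q) := by linarith
    have e2 : 1 + 2 * (s * q) ≤ s * (1 + 2 * q) := by linarith
    have e3 : 1 ≤ s * (1 + 2 * q) := by nlinarith
    calc _ ≤ C * (1 + s * q) * (Real.exp (2 * s * φ T) * D ^ 2 +
          s * q * Real.exp (2 * s * φ T) * D ^ 2 +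
          (Real.exp (2 * s * φ 0) * N + s * q * Real.exp (2 * s * φ T) * D ^ 2)) := by gcongr
      _ = C * (1 + s * q) * (1 * (Real.exp (2 * s * φ 0) * N) +
          (1 + 2 * (s * q)) * (Real.exp (2 * s * φ T) * D ^ 2)) := by ring
      _ ≤ C * (s * (1 + q)) * (s * (1 + 2 * q) * (Real.exp (2 * s * φ 0) * N) +
          s * (1 + 2 * q) * (Real.exp (2 * s * φ T) * D ^ 2)) := by gcongr
      _ = _ := by ring
  have hq' : s * q = s * lam * φ T := by rw [hq]; ring
  rw [hq'] at hup
  have hall : Real.exp (2 * s * φ ε) * I ≤ _ := hlow.trans ((by simpa only [hq'] using hest :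
    _ ≤ _).trans hup)
  have hexp : C * (1 + q) * (1 + 2 * q) * s ^ 2 * (Real.exp (2 * s * φ 0) * N +
        Real.exp (2 * s * φ T) * D ^ 2) = Real.exp (2 * s * φ ε) * (C * (1 + q) * (1 + 2 * q) *
        s ^ 2 * (Real.exp (-(2 * s * (φ ε - φ 0))) * N +
          Real.exp (2 * s * (φ T - φ ε)) * D ^ 2)) := by
    have e1 : Real.exp (2 * s * φ 0) =
        Real.exp (2 * s * φ ε) * Real.exp (-(2 * s * (φ ε - φ 0))) := by
      rw [← Real.exp_add]
      ring_nf
    have e2 : Real.exp (2 * s * φ T) =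
        Real.exp (2 * s * φ ε) * Real.exp (2 * s * (φ T - φ ε)) := by
      rw [← Real.exp_add]
      ring_nf
    rw [e1, e2]
    ring
  rw [hexp] at hall
  exact le_of_mul_le_mul_left hall (Real.exp_pos _)

end

end MFG

theorem theorem1p1 (d : ℕ) (hd : 0 < d) (Ω : Set (MFG.Space d))
    (hΩ : MFG.IsSmoothBoundedDomain Ω) (T : ℝ) (hT : 0 < T) (ρ₀ K : ℝ) (hK : 0 < K)
    (M : ℝ) (hM : 0 < M) (ε : ℝ) (hε : ε ∈ Ioo 0 T) :
    ∃ C θ δ : ℝ, 0 < C ∧ θ ∈ Ioo (0 : ℝ) 1 ∧ 0 < δ ∧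
      ∀ (Q₁ S : (MFG.SpaceTime d → ℝ) → MFG.SpaceTime d → ℝ)
        (Q₂ : (MFG.SpaceTime d → ℝ) → (MFG.SpaceTime d → ℝ) → MFG.SpaceTime d → ℝ)
        (u ut : MFG.SpaceTime d → ℝ) (Du : MFG.SpaceTime d → MFG.Space d)
        (D2u : Fin d → Fin d → MFG.SpaceTime d → ℝ)
        (v vt : MFG.SpaceTime d → ℝ) (Dv : MFG.SpaceTime d → MFG.Space d)
        (D2v : Fin d → Fin d → MFG.SpaceTime d → ℝ)
        (uT vT v0 : MFG.Space d → ℝ),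
        -- `u` and `v` belong to `H^{2,1}(Q)` and satisfy the Neumann condition
        MFG.IsH21 (MFG.stCylinder Ω 0 T) u ut Du D2u →
        MFG.IsH21 (MFG.stCylinder Ω 0 T) v vt Dv D2v →
        MFG.NeumannZero Ω T Du D2u →
        MFG.NeumannZero Ω T Dv D2v →
        -- the two equations, almost everywhere in `Q`
        (∀ᵐ z ∂(volume.restrict (MFG.stCylinder Ω 0 T)),
          ut z + MFG.lap D2u z = Q₁ u z + S v z) →
        (∀ᵐ z ∂(volume.restrict (MFG.stCylinder Ω 0 T)),
          vt z - MFG.lap D2v z = Q₂ u v z + ρ₀ * MFG.lap D2u z) →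
        -- the bounds on the lower-order operators
        (∀ᵐ z ∂(volume.restrict (MFG.stCylinder Ω 0 T)),
          |Q₁ u z| ≤ K * (|u z| + ‖Du z‖)) →
        (∀ᵐ z ∂(volume.restrict (MFG.stCylinder Ω 0 T)),
          |Q₂ u v z| ≤ K * (|u z| + |v z| + ‖Du z‖ + ‖Dv z‖)) →
        AEStronglyMeasurable (S v) (volume.restrict (MFG.stCylinder Ω 0 T)) →
        ((∀ᵐ z ∂(volume.restrict (MFG.stCylinder Ω 0 T)), |S v z| ≤ K * |v z|) ∨
          (∀ᵐ t ∂(volume.restrict (Ioo 0 T)),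
            eLpNorm (fun x => S v (x, t)) 2 (volume.restrict Ω) ≤
              ENNReal.ofReal K * eLpNorm (fun x => v (x, t)) 2 (volume.restrict Ω))) →
        -- `uT`, `vT`, `v0` are `u(·, T)`, `v(·, T)`, `v(·, 0)`
        MFG.HasTimeTrace Ω T u T uT →
        MFG.HasTimeTrace Ω T v T vT →
        MFG.HasTimeTrace Ω T v 0 v0 →
        -- the a priori bound and the smallness of the final data
        MFG.gradNorm Ω v0 ≤ ENNReal.ofReal M →
        MFG.h1Norm Ω uT + eLpNorm vT 2 (volume.restrict Ω) < ENNReal.ofReal δ →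
        MFG.h21Norm (MFG.stCylinder Ω ε T) u + MFG.h21Norm (MFG.stCylinder Ω ε T) v ≤
          ENNReal.ofReal C *
            (MFG.h1Norm Ω uT + eLpNorm vT 2 (volume.restrict Ω)) ^ θ := by
  obtain ⟨a, b, A, ha, hb, hA, hslab⟩ := MFG.exists_slab_estimate (d := d) (ρ₀ := ρ₀) hK.le hT hε
    (N := (2 * M) ^ 2) (by positivity)
  obtain ⟨CH, hCH, hhess⟩ := hΩ.exists_hess_estimate_slab hd
  obtain ⟨C, θ, hC, hθ, hrate⟩ := MFG.exists_holder_rate ha hb hA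
    (by positivity : 0 ≤ (2 * M) ^ 2)
  set B := √(1 + d ^ 2 * CH) with hB
  have hB0 : 0 < B := Real.sqrt_pos.mpr (by positivity)
  refine ⟨2 * B * √C, θ, 1, by positivity, hθ, one_pos, ?_⟩
  intro Q₁ S Q₂ u ut Du D2u v vt Dv D2v uT vT v0 hu hv hNu hNv hequ heqv hQ₁ hQ₂ hS hSv htu htv htv0
    hM0 hδ
  set X := MFG.h1Norm Ω uT + eLpNorm vT 2 (volume.restrict Ω) with hX
  rw [ENNReal.ofReal_one] at hδ
  -- the estimate for every `Y > X`, from which it follows for `X`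
  have hY : ∀ Y ∈ Ioo X 1, MFG.h21Norm (MFG.stCylinder Ω ε T) u +
      MFG.h21Norm (MFG.stCylinder Ω ε T) v ≤ ENNReal.ofReal (2 * B * √C) * Y ^ θ := by
    intro Y hY
    have hYt : Y ≠ ⊤ := (hY.2.trans ENNReal.one_lt_top).ne
    set D := Y.toReal with hD
    have hYD : Y = ENNReal.ofReal D := (ENNReal.ofReal_toReal hYt).symm
    have hD0 : 0 < D := ENNReal.toReal_pos (pos_of_gt hY.1).ne' hYt
    have hD1 : D < 1 := by
      have := (ENNReal.toReal_lt_toReal hYt ENNReal.one_ne_top).mpr hY.2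
      simpa using this
    obtain ⟨DuT, huT, huTn⟩ := MFG.exists_isH1_of_gradNorm_lt
      ((MFG.gradNorm_le_h1Norm Ω uT).trans_lt (le_self_add.trans_lt hY.1))
    obtain ⟨Dv0, hv0, hv0n⟩ := MFG.exists_isH1_of_gradNorm_lt (R := ENNReal.ofReal (2 * M))
      (hM0.trans_lt ((ENNReal.ofReal_lt_ofReal_iff (by positivity)).mpr (by linarith)))
    have n1 := MFG.integral_norm_sq_le_of_eLpNorm_le huT.memLp_grad hD0.le (hYD ▸ huTn.le)
    have n2 := MFG.integral_norm_sq_le_of_eLpNorm_le htu.1 hD0.le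
      (hYD ▸ (MFG.eLpNorm_le_h1Norm Ω uT).trans (le_self_add.trans hY.1.le))
    have n3 := MFG.integral_norm_sq_le_of_eLpNorm_le htv.1 hD0.le
      (hYD ▸ (le_add_self.trans hY.1.le))
    have n4 := MFG.integral_norm_sq_le_of_eLpNorm_le hv0.memLp_grad (by positivity) hv0n.le
    simp only [Real.norm_eq_abs, sq_abs] at n2 n3
    have hdens := hrate D _ hD0 hD1 (hslab hΩ.isOpen hΩ.isBounded hu hv hNu hNv
      (by
        filter_upwards [hequ, hQ₁] with z h1 h2
        rw [h1]
        exact (abs_add_le _ _).trans (add_le_add h2 le_rfl))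
      (by
        filter_upwards [heqv, hQ₂] with z h1 h2
        rw [h1]
        exact (abs_add_le _ _).trans (add_le_add h2 (abs_mul _ _).le))
      hS hSv htu htv htv0 huT hv0 n4 n1 n2 n3)
    have hsub : MFG.stCylinder Ω ε T ⊆ MFG.stCylinder Ω 0 T :=
      prod_mono_right (Ioo_subset_Ioo_left hε.1.le)
    have hu' := hu.mono hsub
    have hv' := hv.mono hsub
    have hCD : C * (D ^ θ) ^ 2 = (√C * D ^ θ) ^ 2 := by rw [mul_pow, Real.sq_sqrt hC.le]
    rw [integral_add hu'.integrable_density hv'.integrable_density, hCD] at hdens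
    have hu0 := integral_nonneg (μ := volume.restrict (MFG.stCylinder Ω ε T))
      (f := MFG.density u ut Du D2u) (MFG.density_nonneg u ut Du D2u)
    have hv0' := integral_nonneg (μ := volume.restrict (MFG.stCylinder Ω ε T))
      (f := MFG.density v vt Dv D2v) (MFG.density_nonneg v vt Dv D2v)
    have bu := hu'.h21Norm_le hCH (by positivity : 0 ≤ √C * D ^ θ)
      (hhess T ε u ut Du D2u hε.1.le hu hNu) (by linarith)
    have bv := hv'.h21Norm_le hCH (by positivity : 0 ≤ √C * D ^ θ)
      (hhess T ε v vt Dv D2v hε.1.le hv hNv) (by linarith)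
    refine (add_le_add bu bv).trans (le_of_eq ?_)
    rw [← ENNReal.ofReal_add (by positivity) (by positivity), hYD,
      ENNReal.ofReal_rpow_of_pos hD0, ← ENNReal.ofReal_mul (by positivity)]
    congr 1
    ring
  have hlim : Tendsto (fun Y : ℝ≥0∞ => ENNReal.ofReal (2 * B * √C) * Y ^ θ) (𝓝[>] X)
      (𝓝 (ENNReal.ofReal (2 * B * √C) * X ^ θ)) :=
    ((ENNReal.continuous_const_mul ENNReal.ofReal_ne_top).comp
      ENNReal.continuous_rpow_const).continuousAt.tendsto.mono_left nhdsWithin_le_nhds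
  have : (𝓝[>] X).NeBot := nhdsGT_neBot_of_exists_gt ⟨1, hδ⟩
  refine ge_of_tendsto hlim ?_
  filter_upwards [Ioo_mem_nhdsGT hδ] with Y h using hY Y h
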